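/- **Setting.** Let $H$ be a real Hilbert space and let $A$ be a nonnegative self-adjoint linear operator on $H$, in general unbounded. For $c\colon[0,T_0]\to\mathbb R$ consider $$u''(t)+c(t)Au(t)=0,\qquad t\in[0,T_0]. \tag{1}$$ For $s\in\mathbb R$ let $D(A^s)$ be the usual scale of spaces: for $s\ge 0$ it is the domain of $A^s$, and for $s<0$ it is the completion of $H$ with respect to the norm $\|(1+A)^s x\|$. Solutions of (1) take values in the hyperdistributions of $A$, that is, the linear functionals on $\bigcup_{R>0}1_{[0,R]}(A)H$ that are bounded on $1_{[0,R]}(A)H$ for every $R$; this space contains every $D(A^s)$, and (1) is understood after testing with the vectors of $\bigcup_{R>0}1_{[0,R]}(A)H$. Equation (1) exhibits an *infinite derivative loss* if it has a solution $u$ such that $$(u(0),u'(0))\in D(A^{\beta+1/2})\times D(A^{\beta})\qquad\forall \beta>0,$$ but $$(u(t),u'(t))\notin D(A^{-\beta+1/2})\times D(A^{-\beta})\qquad\forall\beta>0,\ \forall t\in(0,T_0].$$ The operator $A$ is an *unbounded positive multiplication operator* if there are an orthonormal sequence $\{e_n\}$ in $H$ (not necessarily a Hilbert basis) and an unbounded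 sequence $\{\lambda_n\}$ of positive real numbers such that $Ae_n=\lambda_ne_n$ for every $n$. Let $T_0>0$ and $\mu_2>\mu_1>0$ be real numbers, and let $\omega,\psi\colon(0,T_0]\to(0,+\infty)$ be nonincreasing. Let $\mathcal{PS}^{(2)}=\mathcal{PS}^{(2)}(T_0,\mu_1,\mu_2,\omega,\psi)$ be the set of functions $c\in C^0([0,T_0])\cap C^2((0,T_0])$ such that $\mu_1\le c(t)\le\mu_2$ for every $t\in(0,T_0)$ and $$|c'(t)|\le\frac{\omega(t)}{t},\qquad |c''(t)|\le\frac{\omega(t)^2}{t^2}\,e^{\psi(t)}\qquad\forall t\in(0,T_0],$$ with the distance $$d(c_1,c_2)=\sup_{t\in(0,T_0)}|c_1(t)-c_2(t)|+\sup_{t\in(0,T_0)}\frac{t^2}{\omega(t)}|c_1'(t)-c_2'(t)|+\sup_{t\in(0,T_0)}\frac{t^3e^{-\psi(t)}}{\omega(t)^2}|c_1''(t)-c_2''(t)|.$$ **Theorem.** Let $A$ be an unbounded positive multiplication operator on $H$ (nonnegative and self-adjoint, as above). Assume that $$\lim_{t\to0^+}\omega(t)=+\infty\qquad\text{and}\qquad\lim_{t\to0^+}\frac{\omega(t)\psi(t)}{|\log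 t|}=+\infty.$$ Then $(\mathcal{PS}^{(2)},d)$ is a complete metric space, and the set of propagation speeds $c\in\mathcal{PS}^{(2)}$ for which equation (1) exhibits an infinite derivative loss is residual in it. -/

import Mathlib

open Set Filter Topology

noncomputable section

namespace DerivLoss

/-! ## Unbounded operators, real powers and hyperdistributions -/

section Operators

variable {H : Type*} [NormedAddCommGroup H] [InnerProductSpace ℝ H]

/-- `f` is the sequence of iterates `v, A v, A² v, …` of a vector `v = f 0`, all of which lie in
the domain of `A`. -/
def IsOrbit (A : H →ₗ.[ℝ] H) (f : ℕ → H) : Prop :=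
  ∀ n, ∃ h : f n ∈ A.domain, A ⟨f n, h⟩ = f (n + 1)

theorem IsOrbit.add {A : H →ₗ.[ℝ] H} {f g : ℕ → H} (hf : IsOrbit A f) (hg : IsOrbit A g) :
    IsOrbit A (fun n => f n + g n) := by
  intro n
  obtain ⟨h1, e1⟩ := hf n
  obtain ⟨h2, e2⟩ := hg n
  refine ⟨A.domain.add_mem h1 h2, ?_⟩
  change _ = f (n + 1) + g (n + 1)
  rw [← e1, ← e2, ← A.map_add]
  rfl

theorem IsOrbit.smul {A : H →ₗ.[ℝ] H} {f : ℕ → H} (a : ℝ) (hf : IsOrbit A f) :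
    IsOrbit A (fun n => a • f n) := by
  intro n
  obtain ⟨h1, e1⟩ := hf n
  refine ⟨A.domain.smul_mem a h1, ?_⟩
  change _ = a • f (n + 1)
  rw [← e1, ← A.map_smul]
  rfl

/-- The space `V` of vectors of exponential type: `v ∈ D(A^n)` for all `n` and `‖A^n v‖ ≤ C R^n`
for some `C`, `R`. For a nonnegative self-adjoint `A` it is the (dense) union over `R` of the
spectral subspaces `1_{[0,R]}(A) H`. -/
def testSpace (A : H →ₗ.[ℝ] H) : Submodule ℝ H where
  carrier := {v | ∃ f : ℕ → H, f 0 = v ∧ IsOrbit A f ∧ ∃ R C : ℝ, ∀ n, ‖f n‖ ≤ C * R ^ n}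
  add_mem' := by
    rintro v w ⟨f, hf0, hf, R, C, hfb⟩ ⟨g, hg0, hg, S, D, hgb⟩
    refine ⟨fun n => f n + g n, by simp [hf0, hg0], hf.add hg, max |R| |S|, |C| + |D|, ?_⟩
    have key : ∀ (E Q : ℝ) (n : ℕ), |Q| ≤ max |R| |S| →
        E * Q ^ n ≤ |E| * max |R| |S| ^ n := by
      intro E Q n hQ
      calc E * Q ^ n ≤ |E * Q ^ n| := le_abs_self _
        _ = |E| * |Q| ^ n := by rw [abs_mul, abs_pow]
        _ ≤ |E| * max |R| |S| ^ n := by gcongr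
    intro n
    have h1 := (hfb n).trans (key C R n (le_max_left _ _))
    have h2 := (hgb n).trans (key D S n (le_max_right _ _))
    calc ‖f n + g n‖ ≤ ‖f n‖ + ‖g n‖ := norm_add_le _ _
      _ ≤ (|C| + |D|) * max |R| |S| ^ n := by linarith
  zero_mem' := by
    refine ⟨fun _ => 0, rfl, ?_, 0, 0, by simp⟩
    intro n
    exact ⟨A.domain.zero_mem, A.map_zero⟩
  smul_mem' := by
    rintro a v ⟨f, hf0, hf, R, C, hfb⟩
    refine ⟨fun n => a • f n, by simp [hf0], hf.smul a, R, |a| * C, ?_⟩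
    intro n
    rw [norm_smul, Real.norm_eq_abs, mul_assoc]
    exact mul_le_mul_of_nonneg_left (hfb n) (abs_nonneg a)

theorem mem_domain_of_mem_testSpace {A : H →ₗ.[ℝ] H} {v : H} (hv : v ∈ testSpace A) :
    v ∈ A.domain := by
  obtain ⟨f, rfl, hf, -⟩ := hv
  exact (hf 0).1

theorem apply_mem_testSpace {A : H →ₗ.[ℝ] H} {v : H} (hv : v ∈ testSpace A) :
    A ⟨v, mem_domain_of_mem_testSpace hv⟩ ∈ testSpace A := by
  obtain ⟨f, rfl, hf, R, C, hfb⟩ := hv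
  refine ⟨fun n => f (n + 1), (hf 0).2.symm, fun n => hf (n + 1), R, C * R, fun n => ?_⟩
  have := hfb (n + 1)
  rwa [pow_succ', ← mul_assoc] at this

/-- The restriction of `A` to the vectors of exponential type, as an endomorphism. -/
def testOp (A : H →ₗ.[ℝ] H) : Module.End ℝ (testSpace A) where
  toFun v := ⟨A ⟨v, mem_domain_of_mem_testSpace v.2⟩, apply_mem_testSpace v.2⟩
  map_add' v w := by
    apply Subtype.ext
    change A _ = A _ + A _
    rw [← A.map_add]
    rfl
  map_smul' a v := by
    apply Subtype.ext
    change A _ = a • A _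
    rw [← A.map_smul]
    rfl

/-- `v` has exponential type at most `R`, that is `v ∈ 1_{[0,R]}(A) H`. -/
def HasType (A : H →ₗ.[ℝ] H) (R : ℝ) (v : testSpace A) : Prop :=
  ∃ C : ℝ, ∀ n : ℕ, ‖(testOp A ^ n) v‖ ≤ C * R ^ n

/-- The hyperdistributions associated with `A`: linear functionals on the space of vectors of
exponential type that are bounded on the vectors of type at most `R`, for each `R`.
A vector `x : H` is identified with the functional `v ↦ ⟪x, v⟫`. -/
def Hyper (A : H →ₗ.[ℝ] H) : Submodule ℝ (Module.Dual ℝ (testSpace A)) where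
  carrier := {φ | ∀ R : ℝ, ∃ C : ℝ, ∀ v : testSpace A, HasType A R v → |φ v| ≤ C * ‖v‖}
  add_mem' := by
    intro φ χ hφ hχ R
    obtain ⟨C, hC⟩ := hφ R
    obtain ⟨D, hD⟩ := hχ R
    refine ⟨C + D, fun v hv => ?_⟩
    have h1 := hC v hv
    have h2 := hD v hv
    rw [LinearMap.add_apply]
    have := abs_add_le (φ v) (χ v)
    linarith
  zero_mem' := fun _ => ⟨0, fun v _ => by simp⟩
  smul_mem' := by
    intro a φ hφ R
    obtain ⟨C, hC⟩ := hφ R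
    refine ⟨|a| * C, fun v hv => ?_⟩
    rw [LinearMap.smul_apply, smul_eq_mul, abs_mul, mul_assoc]
    exact mul_le_mul_of_nonneg_left (hC v hv) (abs_nonneg a)

/-- `w = (1 + A)^s v`, for a real `s` and a vector `v` of exponential type, through the continuous
functional calculus: on vectors of type at most `R` the operator `A` has spectrum in `[0,R]`, and
`w` is the limit of `p(A) v` for polynomials `p` that tend to `(1 + x)^s` uniformly on `[0,R]`. -/
def IsRpow (A : H →ₗ.[ℝ] H) (s : ℝ) (v w : testSpace A) : Prop :=
  ∃ R : ℝ, HasType A R v ∧ ∀ ε > 0, ∃ p : Polynomial ℝ,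
    (∀ x ∈ Icc 0 R, |p.eval x - (1 + x) ^ s| ≤ ε) ∧ ‖Polynomial.aeval (testOp A) p v - w‖ ≤ ε

/-- `φ ∈ D(A^s)`, for a real `s` of any sign: `(1 + A)^s φ` belongs to `H`, that is
`v ↦ φ ((1 + A)^s v)` is bounded for the norm of `H`. For `s ≥ 0` these are the functionals
`⟪x, ·⟫` with `x` in the domain of `A^s`; for `s < 0` this is the completion of `H` with respect to
the norm `‖(1 + A)^s x‖`. -/
def MemDomPow (A : H →ₗ.[ℝ] H) (s : ℝ) (φ : Hyper A) : Prop :=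
  ∃ C : ℝ, ∀ v w : testSpace A, IsRpow A s v w →
    |(φ : Module.Dual ℝ (testSpace A)) w| ≤ C * ‖v‖

/-- `A` has an orthonormal sequence of eigenvectors (not necessarily a Hilbert basis) with an
unbounded sequence of positive eigenvalues. -/
def IsUnboundedPosMult (A : H →ₗ.[ℝ] H) : Prop :=
  ∃ (e : ℕ → H) (l : ℕ → ℝ), Orthonormal ℝ e ∧ (∀ n, 0 < l n) ∧ ¬ BddAbove (range l) ∧
    ∀ n, ∃ h : e n ∈ A.domain, A ⟨e n, h⟩ = l n • e n

/-- `u` is a solution in `[0,T₀]` of `u''(t) + c(t) A u(t) = 0` with values in hyperdistributions,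
and `u'` is its time derivative. -/
def IsSolution (A : H →ₗ.[ℝ] H) (T₀ : ℝ) (c : ℝ → ℝ) (u u' : ℝ → Hyper A) : Prop :=
  ∀ v : testSpace A, ∀ t ∈ Icc 0 T₀,
    HasDerivWithinAt (fun r => (u r : Module.Dual ℝ (testSpace A)) v)
      ((u' t : Module.Dual ℝ (testSpace A)) v) (Icc 0 T₀) t ∧
    HasDerivWithinAt (fun r => (u' r : Module.Dual ℝ (testSpace A)) v)
      (-(c t * (u t : Module.Dual ℝ (testSpace A)) (testOp A v))) (Icc 0 T₀) t

/-- Infinite derivative loss: some solution has data `(u(0),u'(0)) ∈ D(A^{β+1/2}) × D(A^β)` for all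
`β > 0`, but `(u(t),u'(t)) ∉ D(A^{-β+1/2}) × D(A^{-β})` for all `β > 0` and `t ∈ (0,T₀]`. -/
def InfiniteDerivativeLoss (A : H →ₗ.[ℝ] H) (T₀ : ℝ) (c : ℝ → ℝ) : Prop :=
  ∃ u u' : ℝ → Hyper A, IsSolution A T₀ c u u' ∧
    (∀ β > (0 : ℝ), MemDomPow A (β + 1 / 2) (u 0) ∧ MemDomPow A β (u' 0)) ∧
    ∀ β > (0 : ℝ), ∀ t ∈ Ioc 0 T₀,
      ¬ (MemDomPow A (-β + 1 / 2) (u t) ∧ MemDomPow A (-β) (u' t))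

end Operators

/-! ## The metric space of propagation speeds -/

/-- A function on `[0,T₀]` extended by `0` to the line. -/
def speedFun {T₀ : ℝ} (c : C(Icc (0 : ℝ) T₀, ℝ)) (t : ℝ) : ℝ :=
  open Classical in if h : t ∈ Icc (0 : ℝ) T₀ then c ⟨t, h⟩ else 0

/-- First derivative in `(0,T₀]` (one-sided at `T₀`). -/
def D1 {T₀ : ℝ} (c : C(Icc (0 : ℝ) T₀, ℝ)) : ℝ → ℝ :=
  derivWithin (speedFun c) (Ioc 0 T₀)

/-- Second derivative in `(0,T₀]` (one-sided at `T₀`). -/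
def D2 {T₀ : ℝ} (c : C(Icc (0 : ℝ) T₀, ℝ)) : ℝ → ℝ :=
  derivWithin (D1 c) (Ioc 0 T₀)

/-- The class `PS⁽²⁾(T₀, μ₁, μ₂, ω, ψ)` of propagation speeds. -/
def PS2 (T₀ μ₁ μ₂ : ℝ) (ω ψ : ℝ → ℝ) : Type :=
  {c : C(Icc (0 : ℝ) T₀, ℝ) //
    ContDiffOn ℝ 2 (speedFun c) (Ioc 0 T₀) ∧
    (∀ t ∈ Ioo 0 T₀, μ₁ ≤ speedFun c t ∧ speedFun c t ≤ μ₂) ∧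
    (∀ t ∈ Ioc 0 T₀, |D1 c t| ≤ ω t / t) ∧
    (∀ t ∈ Ioc 0 T₀, |D2 c t| ≤ ω t ^ 2 / t ^ 2 * Real.exp (ψ t))}

/-- The distance on `PS⁽²⁾`. The three suprema are finite. -/
def PS2.d {T₀ μ₁ μ₂ : ℝ} {ω ψ : ℝ → ℝ} (c₁ c₂ : PS2 T₀ μ₁ μ₂ ω ψ) : ℝ :=
  (⨆ t : Ioo 0 T₀, |speedFun c₁.1 t - speedFun c₂.1 t|) +
  (⨆ t : Ioo 0 T₀, (t : ℝ) ^ 2 / ω t * |D1 c₁.1 t - D1 c₂.1 t|) +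
  ⨆ t : Ioo 0 T₀, (t : ℝ) ^ 3 * Real.exp (-ψ t) / ω t ^ 2 * |D2 c₁.1 t - D2 c₂.1 t|

section Metric

variable {T₀ μ₁ μ₂ : ℝ} {ω ψ : ℝ → ℝ}

theorem PS2.bdd0 (c₁ c₂ : PS2 T₀ μ₁ μ₂ ω ψ) :
    BddAbove (range fun t : Ioo 0 T₀ => |speedFun c₁.1 t - speedFun c₂.1 t|) := by
  refine ⟨μ₂ - μ₁, ?_⟩
  rintro _ ⟨t, rfl⟩
  have h1 := c₁.2.2.1 t t.2
  have h2 := c₂.2.2.1 t t.2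
  exact abs_le.2 ⟨by linarith, by linarith⟩

theorem PS2.bdd1 (hω : ∀ t ∈ Ioc 0 T₀, 0 < ω t) (c₁ c₂ : PS2 T₀ μ₁ μ₂ ω ψ) :
    BddAbove (range fun t : Ioo 0 T₀ => (t : ℝ) ^ 2 / ω t * |D1 c₁.1 t - D1 c₂.1 t|) := by
  refine ⟨2 * T₀, ?_⟩
  rintro _ ⟨⟨t, hto⟩, rfl⟩
  have ht : t ∈ Ioc 0 T₀ := ⟨hto.1, hto.2.le⟩
  have hw := hω t ht
  have ht0 := ht.1
  have h3 : |D1 c₁.1 t - D1 c₂.1 t| ≤ ω t / t + ω t / t :=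
    (abs_sub _ _).trans (add_le_add (c₁.2.2.2.1 t ht) (c₂.2.2.2.1 t ht))
  calc (t : ℝ) ^ 2 / ω t * |D1 c₁.1 t - D1 c₂.1 t|
      ≤ (t : ℝ) ^ 2 / ω t * (ω t / t + ω t / t) := by gcongr
    _ = 2 * t := by field_simp; ring
    _ ≤ 2 * T₀ := by linarith [ht.2]

theorem PS2.bdd2 (hω : ∀ t ∈ Ioc 0 T₀, 0 < ω t) (c₁ c₂ : PS2 T₀ μ₁ μ₂ ω ψ) :
    BddAbove (range fun t : Ioo 0 T₀ =>
      (t : ℝ) ^ 3 * Real.exp (-ψ t) / ω t ^ 2 * |D2 c₁.1 t - D2 c₂.1 t|) := by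
  refine ⟨2 * T₀, ?_⟩
  rintro _ ⟨⟨t, hto⟩, rfl⟩
  have ht : t ∈ Ioc 0 T₀ := ⟨hto.1, hto.2.le⟩
  have hw := hω t ht
  have ht0 := ht.1
  have h3 : |D2 c₁.1 t - D2 c₂.1 t| ≤
      ω t ^ 2 / t ^ 2 * Real.exp (ψ t) + ω t ^ 2 / t ^ 2 * Real.exp (ψ t) :=
    (abs_sub _ _).trans (add_le_add (c₁.2.2.2.2 t ht) (c₂.2.2.2.2 t ht))
  calc (t : ℝ) ^ 3 * Real.exp (-ψ t) / ω t ^ 2 * |D2 c₁.1 t - D2 c₂.1 t|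
      ≤ (t : ℝ) ^ 3 * Real.exp (-ψ t) / ω t ^ 2 *
        (ω t ^ 2 / t ^ 2 * Real.exp (ψ t) + ω t ^ 2 / t ^ 2 * Real.exp (ψ t)) := by gcongr
    _ = 2 * t := by rw [Real.exp_neg]; field_simp; ring
    _ ≤ 2 * T₀ := by linarith [ht.2]

theorem ciSup_weighted_triangle {ι : Type*} [Nonempty ι] {w f g h : ι → ℝ} (hw : ∀ i, 0 ≤ w i)
    (h1 : BddAbove (range fun i => w i * |f i - g i|))
    (h2 : BddAbove (range fun i => w i * |g i - h i|)) :
    (⨆ i, w i * |f i - h i|) ≤ (⨆ i, w i * |f i - g i|) + ⨆ i, w i * |g i - h i| := by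
  refine ciSup_le fun i => ?_
  have a1 := le_ciSup h1 i
  have a2 := le_ciSup h2 i
  have a3 := mul_le_mul_of_nonneg_left (abs_sub_le (f i) (g i) (h i)) (hw i)
  linarith

/-- `PS⁽²⁾` with the distance `PS2.d`, as a metric space. -/
@[reducible] def PS2.metricSpace (hT : 0 < T₀) (hω : ∀ t ∈ Ioc 0 T₀, 0 < ω t) :
    MetricSpace (PS2 T₀ μ₁ μ₂ ω ψ) where
  dist := PS2.d
  dist_self c := by simp [PS2.d]
  dist_comm c₁ c₂ := by simp only [PS2.d, abs_sub_comm]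
  dist_triangle c₁ c₂ c₃ := by
    have : Nonempty (Ioo 0 T₀) := ⟨⟨T₀ / 2, by constructor <;> linarith⟩⟩
    have hw : ∀ t : Ioo 0 T₀, 0 < ω t := fun t => hω t ⟨t.2.1, t.2.2.le⟩
    have i0 := ciSup_weighted_triangle (ι := Ioo 0 T₀) (w := fun _ => 1)
      (f := fun t => speedFun c₁.1 t) (g := fun t => speedFun c₂.1 t) (h := fun t => speedFun c₃.1 t)
      (fun _ => zero_le_one) (by simpa using PS2.bdd0 c₁ c₂) (by simpa using PS2.bdd0 c₂ c₃)
    simp only [one_mul] at i0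
    have i1 := ciSup_weighted_triangle (ι := Ioo 0 T₀) (w := fun t => (t : ℝ) ^ 2 / ω t)
      (f := fun t => D1 c₁.1 t) (g := fun t => D1 c₂.1 t) (h := fun t => D1 c₃.1 t)
      (fun t => div_nonneg (sq_nonneg _) (hw t).le) (PS2.bdd1 hω c₁ c₂) (PS2.bdd1 hω c₂ c₃)
    have i2 := ciSup_weighted_triangle (ι := Ioo 0 T₀)
      (w := fun t => (t : ℝ) ^ 3 * Real.exp (-ψ t) / ω t ^ 2)
      (f := fun t => D2 c₁.1 t) (g := fun t => D2 c₂.1 t) (h := fun t => D2 c₃.1 t)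
      (fun t => div_nonneg (mul_nonneg (pow_nonneg t.2.1.le 3) (Real.exp_pos _).le) (sq_nonneg _))
      (PS2.bdd2 hω c₁ c₂) (PS2.bdd2 hω c₂ c₃)
    simp only [PS2.d]
    linarith
  eq_of_dist_eq_zero := by
    intro c₁ c₂ h
    have hw : ∀ t : Ioo 0 T₀, 0 < ω t := fun t => hω t ⟨t.2.1, t.2.2.le⟩
    have n1 : 0 ≤ ⨆ t : Ioo 0 T₀, (t : ℝ) ^ 2 / ω t * |D1 c₁.1 t - D1 c₂.1 t| :=
      Real.iSup_nonneg fun t => mul_nonneg (div_nonneg (sq_nonneg _) (hw t).le) (abs_nonneg _)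
    have n2 : 0 ≤ ⨆ t : Ioo 0 T₀,
        (t : ℝ) ^ 3 * Real.exp (-ψ t) / ω t ^ 2 * |D2 c₁.1 t - D2 c₂.1 t| :=
      Real.iSup_nonneg fun t => mul_nonneg (div_nonneg
        (mul_nonneg (pow_nonneg t.2.1.le 3) (Real.exp_pos _).le) (sq_nonneg _)) (abs_nonneg _)
    have h' : PS2.d c₁ c₂ = 0 := h
    have n0 : (⨆ t : Ioo 0 T₀, |speedFun c₁.1 t - speedFun c₂.1 t|) ≤ 0 := by
      simp only [PS2.d] at h'
      linarith
    have key : ∀ t (ht : t ∈ Ioo 0 T₀),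
        c₁.1 ⟨t, Ioo_subset_Icc_self ht⟩ = c₂.1 ⟨t, Ioo_subset_Icc_self ht⟩ := by
      intro t ht
      have := (le_ciSup (PS2.bdd0 c₁ c₂) ⟨t, ht⟩).trans n0
      have h0 := abs_eq_zero.1 (le_antisymm this (abs_nonneg _))
      simp only [speedFun, dif_pos (Ioo_subset_Icc_self ht)] at h0
      linarith
    have hcl : closure (Ioo (0 : ℝ) T₀) = Icc 0 T₀ := closure_Ioo hT.ne
    have hd : Dense {x : Icc (0 : ℝ) T₀ | (x : ℝ) ∈ Ioo 0 T₀} := by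
      intro x
      rw [closure_subtype]
      have : ((↑) '' {x : Icc (0 : ℝ) T₀ | (x : ℝ) ∈ Ioo 0 T₀} : Set ℝ) = Ioo 0 T₀ := by
        ext y
        constructor
        · rintro ⟨z, hz, rfl⟩
          exact hz
        · intro hy
          exact ⟨⟨y, Ioo_subset_Icc_self hy⟩, hy, rfl⟩
      rw [this, hcl]
      exact x.2
    apply Subtype.ext
    apply ContinuousMap.coe_injective
    exact Continuous.ext_on hd c₁.1.continuous c₂.1.continuous fun x hx => key x hx

end Metric

end DerivLoss

end

noncomputable section

namespace DerivLoss

/-! ## The scalar equation `w'' + l c(t) w = 0` -/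

/-! The argument is a Baire category argument. On an eigenvector with eigenvalue `l`, the equation
reduces to `w'' + l c w = 0`. The set `activators … k` collects the speeds for which some eigenvalue
`l ≥ 2 ^ k` has a mode, with data `(0, 1)`, whose energy exceeds `l ^ (4 * k)` on all of `[T₀ / (k +
1), T₀]`. Each of these sets is open (`isOpen_activators`) and dense (`dense_activators`), so their
intersection is residual. A speed in the intersection has eigenvalues `l i ≥ 2 ^ i` with such modes
`w i`, and `∑ (l i)⁻ⁱ w i (t) e i` has an infinite derivative loss
(`infiniteDerivativeLoss_of_modes`): the factor `(l i)⁻ⁱ` decays faster than every power of `l i`,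
so the data are smooth, while at each `t > 0` the energies still grow faster than every power.

Openness is continuous dependence on the coefficient in the uniform norm. Density is the core. The
weights of the distance carry one more factor `t` than the bounds of the class, so whatever happens
to the derivatives near `0` costs little; hence speeds equal to a constant `γ = s²` near `0` are
dense (`exists_constant_near_zero`). Such a speed is then perturbed on a short interval `(0, B)` so
as to resonate with the frequency `x = √l` (`exists_resonant_speed`). The perturbation `q` is
reverse engineered from the explicit solution `sin(sxt) exp(∫ p sin²(sxr) dr) / (sx)`, with `p = k /
t` on `[2a, b]`; the energy gains a factor of order `(b / a) ^ k`.

The sizes `q ~ k / (x a)`, `q' ~ k / t`, `q'' ~ k x / t` dictate the choices `k ~ ω(2B)`, `a ~ ω(2B)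
/ x`, `b ~ B`, together with `x ≤ ω(B) exp(ψ(B)) / B`. The exponent gained is then of order `ω(2B)
log(B x / ω(2B))`. Taking `B` dyadic and as large as the last constraint permits makes this
logarithm at least `1 + ψ(2B)`, and the two limit hypotheses make the exponent exceed any multiple
of `log x` (`exists_time_scale`). After time `B` the energy drops by at most a factor independent of
`x`. -/

/-- `w` solves `w'' + l c(t) w = 0` in `[0,T]` with `w(0) = 0` and `w'(0) = 1`, and `w' = w₁`. -/
def IsModeSolution (T l : ℝ) (c w w₁ : ℝ → ℝ) : Prop :=
  w 0 = 0 ∧ w₁ 0 = 1 ∧ ∀ t ∈ Icc 0 T, HasDerivWithinAt w (w₁ t) (Icc 0 T) t ∧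
    HasDerivWithinAt w₁ (-(c t * (l * w t))) (Icc 0 T) t

theorem hasDerivWithinAt_Ici_of_Icc {E : Type*} [NormedAddCommGroup E] [NormedSpace ℝ E]
    {f : ℝ → E} {f' : E} {a b t : ℝ}
    (h : HasDerivWithinAt f f' (Icc a b) t) (ht : t ∈ Ico a b) :
    HasDerivWithinAt f f' (Ici t) t :=
  (h.mono (Icc_subset_Icc_left ht.1)).mono_of_mem_nhdsWithin (Icc_mem_nhdsGE ht.2)

/-- Grönwall's inequality for a pair of real functions, in the maximum norm. -/
theorem pair_gronwall {T K δ ε : ℝ} {x y p r : ℝ → ℝ}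
    (hx : ∀ t ∈ Icc 0 T, HasDerivWithinAt x (p t) (Icc 0 T) t)
    (hy : ∀ t ∈ Icc 0 T, HasDerivWithinAt y (r t) (Icc 0 T) t)
    (hx0 : |x 0| ≤ δ) (hy0 : |y 0| ≤ δ)
    (hp : ∀ t ∈ Icc 0 T, |p t| ≤ K * max |x t| |y t| + ε)
    (hr : ∀ t ∈ Icc 0 T, |r t| ≤ K * max |x t| |y t| + ε) :
    ∀ t ∈ Icc 0 T, |x t| ≤ gronwallBound δ K ε t ∧ |y t| ≤ gronwallBound δ K ε t := by
  intro t ht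
  have hd : ∀ t ∈ Icc 0 T, HasDerivWithinAt (fun t => (x t, y t)) (p t, r t) (Icc 0 T) t :=
    fun t ht => (hx t ht).prodMk (hy t ht)
  have := norm_le_gronwallBound_of_norm_deriv_right_le (f := fun t => (x t, y t))
    (f' := fun t => (p t, r t)) (δ := δ) (K := K) (ε := ε) (a := 0) (b := T)
    (fun t ht => (hd t ht).continuousWithinAt)
    (fun t ht => hasDerivWithinAt_Ici_of_Icc (hd t (Ico_subset_Icc_self ht)) ht)
    (by simp only [Prod.norm_def, Real.norm_eq_abs]; exact max_le hx0 hy0)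
    (fun t ht => by
      simp only [Prod.norm_def, Real.norm_eq_abs]
      exact max_le (hp t (Ico_subset_Icc_self ht)) (hr t (Ico_subset_Icc_self ht))) t ht
  simp only [Prod.norm_def, Real.norm_eq_abs, sub_zero] at this
  exact max_le_iff.1 this

theorem abs_clamp_le {M : ℝ} (hM : 0 ≤ M) (x : ℝ) : |max (-M) (min M x)| ≤ M :=
  abs_le.2 ⟨le_max_left _ _, max_le (by linarith) (min_le_left _ _)⟩

theorem clamp_eq {M x : ℝ} (hx : |x| ≤ M) : max (-M) (min M x) = x := by
  rw [min_eq_right (abs_le.1 hx).2, max_eq_right (abs_le.1 hx).1]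

theorem abs_clamp_le_abs {M : ℝ} (hM : 0 ≤ M) (x : ℝ) : |max (-M) (min M x)| ≤ |x| := by
  rcases le_total |x| M with h | h
  · rw [clamp_eq h]
  · exact (abs_clamp_le hM x).trans h

theorem abs_clamp_sub_clamp_le (M x y : ℝ) :
    |max (-M) (min M x) - max (-M) (min M y)| ≤ |x - y| := by
  refine (abs_max_sub_max_le_max _ _ _ _).trans ?_
  simp only [sub_self, abs_zero]
  refine max_le (abs_nonneg _) ((abs_min_sub_min_le_max _ _ _ _).trans ?_)
  simp

/-- Picard–Lindelöf is applied on the whole of `[0, T]` to a truncated vector field, which is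
bounded; Grönwall's inequality then shows that the truncation is never active. -/
theorem exists_isModeSolution {T l : ℝ} (hT : 0 ≤ T) {c : ℝ → ℝ}
    (hc : ContinuousOn c (Icc 0 T)) : ∃ w w₁, IsModeSolution T l c w w₁ := by
  obtain ⟨Q, hQ⟩ := isCompact_Icc.exists_bound_of_continuousOn (hc.mul continuousOn_const :
    ContinuousOn (fun t => c t * l) (Icc 0 T))
  set K : ℝ := max 1 Q with hK
  have hK1 : 1 ≤ K := le_max_left _ _
  have hK0 : 0 ≤ K := zero_le_one.trans hK1
  have hq : ∀ t ∈ Icc 0 T, |c t * l| ≤ K := fun t ht => (hQ t ht).trans (le_max_right _ _)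
  -- This is the Grönwall bound on `[0, T]` for initial data of maximum norm `1`.
  set M : ℝ := Real.exp (K * T) with hM
  have hM0 : 0 ≤ M := (Real.exp_pos _).le
  let cl : ℝ → ℝ := fun x => max (-M) (min M x)
  let v : ℝ → ℝ × ℝ → ℝ × ℝ := fun t z => (cl z.2, -(c t * (l * cl z.1)))
  have hpl : IsPicardLindelof v (tmin := 0) (tmax := T) ⟨0, le_rfl, hT⟩ ((0, 1) : ℝ × ℝ)
      ⟨K * M * T, by positivity⟩ 0 ⟨K * M, by positivity⟩ ⟨K, hK0⟩ := by
    refine ⟨?_, ?_, ?_, ?_⟩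
    · intro t ht
      apply LipschitzOnWith.of_dist_le_mul
      intro z _ z' _
      have h1 := abs_clamp_sub_clamp_le M z.1 z'.1
      have h2 := abs_clamp_sub_clamp_le M z.2 z'.2
      simp only [v, cl, Prod.dist_eq, Real.dist_eq]
      change _ ≤ K * _
      have m1 := le_max_left |z.1 - z'.1| |z.2 - z'.2|
      have m2 := le_max_right |z.1 - z'.1| |z.2 - z'.2|
      set m := max |z.1 - z'.1| |z.2 - z'.2|
      have m0 : 0 ≤ m := (abs_nonneg _).trans m1
      refine max_le ?_ ?_
      · nlinarith
      · have : -(c t * (l * max (-M) (min M z.1))) - -(c t * (l * max (-M) (min M z'.1))) =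
          -((c t * l) * (max (-M) (min M z.1) - max (-M) (min M z'.1))) := by ring
        rw [this, abs_neg, abs_mul]
        exact mul_le_mul (hq t ht) (h1.trans m1) (abs_nonneg _) hK0
    · intro z _
      exact continuousOn_const.prodMk (hc.mul continuousOn_const).neg
    · intro t ht z _
      simp only [v, cl, Prod.norm_def, Real.norm_eq_abs]
      change _ ≤ K * M
      have h1 := abs_clamp_le hM0 z.1
      have h2 := abs_clamp_le hM0 z.2
      refine max_le ?_ ?_
      · nlinarith
      · rw [← mul_assoc, abs_neg, abs_mul]
        exact mul_le_mul (hq t ht) h1 (abs_nonneg _) hK0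
    · simp only [sub_zero, NNReal.coe_zero]
      change K * M * max T 0 ≤ K * M * T
      rw [max_eq_left hT]
  obtain ⟨α, h0, hα⟩ := hpl.exists_eq_forall_mem_Icc_hasDerivWithinAt₀
  have d1 : ∀ t ∈ Icc 0 T, HasDerivWithinAt (fun t => (α t).1) (cl (α t).2) (Icc 0 T) t :=
    fun t ht => by simpa [v, Function.comp_def] using
      (hasFDerivAt_fst (𝕜 := ℝ) (E := ℝ) (F := ℝ)).comp_hasDerivWithinAt t (hα t ht)
  have d2 : ∀ t ∈ Icc 0 T, HasDerivWithinAt (fun t => (α t).2) (-(c t * (l * cl (α t).1)))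
      (Icc 0 T) t :=
    fun t ht => by simpa [v, Function.comp_def] using
      (hasFDerivAt_snd (𝕜 := ℝ) (E := ℝ) (F := ℝ)).comp_hasDerivWithinAt t (hα t ht)
  have h0' : α 0 = (0, 1) := h0
  have bd := pair_gronwall (δ := 1) (K := K) (ε := 0) d1 d2 (by simp [h0']) (by simp [h0'])
    (fun t ht => by
      have := abs_clamp_le_abs hM0 (α t).2
      have m2 := le_max_right |(α t).1| |(α t).2|
      have m0 : 0 ≤ max |(α t).1| |(α t).2| := (abs_nonneg _).trans m2
      change |max (-M) (min M (α t).2)| ≤ _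
      nlinarith)
    (fun t ht => by
      have := abs_clamp_le_abs hM0 (α t).1
      rw [add_zero, ← mul_assoc, abs_neg, abs_mul]
      exact mul_le_mul (hq t ht) (this.trans (le_max_left _ _)) (abs_nonneg _) hK0)
  have hMt : ∀ t ∈ Icc 0 T, gronwallBound 1 K 0 t ≤ M := by
    intro t ht
    rw [gronwallBound_ε0, one_mul]
    exact Real.exp_le_exp.2 (mul_le_mul_of_nonneg_left ht.2 hK0)
  refine ⟨fun t => (α t).1, fun t => (α t).2, by simp [h0'], by simp [h0'], fun t ht => ⟨?_, ?_⟩⟩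
  · have := d1 t ht
    rwa [show cl (α t).2 = (α t).2 from clamp_eq ((bd t ht).2.trans (hMt t ht))] at this
  · have := d2 t ht
    rwa [show cl (α t).1 = (α t).1 from clamp_eq ((bd t ht).1.trans (hMt t ht))] at this

/-- Quantitative continuous dependence on the coefficient. -/
theorem IsModeSolution.sub_le {T l ε K M : ℝ} {c c' w w₁ z z₁ : ℝ → ℝ}
    (hw : IsModeSolution T l c w w₁) (hz : IsModeSolution T l c' z z₁)
    (hK : 1 ≤ K) (hM : 0 ≤ M) (hq : ∀ t ∈ Icc 0 T, |c' t * l| ≤ K) (hwM : ∀ t ∈ Icc 0 T, |w t| ≤ M)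
    (hcc : ∀ t ∈ Icc 0 T, |c t - c' t| ≤ ε) :
    ∀ t ∈ Icc 0 T, |w t - z t| ≤ gronwallBound 0 K (ε * (|l| * M)) t ∧
      |w₁ t - z₁ t| ≤ gronwallBound 0 K (ε * (|l| * M)) t := by
  refine pair_gronwall (x := fun t => w t - z t) (y := fun t => w₁ t - z₁ t)
    (fun t ht => (hw.2.2 t ht).1.sub (hz.2.2 t ht).1)
    (fun t ht => (hw.2.2 t ht).2.sub (hz.2.2 t ht).2) (by simp [hw.1, hz.1])
    (by simp [hw.2.1, hz.2.1]) ?_ ?_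
  · intro t ht
    have hε : 0 ≤ ε := (abs_nonneg _).trans (hcc t ht)
    have m2 := le_max_right |w t - z t| |w₁ t - z₁ t|
    have m0 : 0 ≤ max |w t - z t| |w₁ t - z₁ t| := (abs_nonneg _).trans m2
    have : 0 ≤ ε * (|l| * M) := by positivity
    nlinarith
  · intro t ht
    have hε : 0 ≤ ε := (abs_nonneg _).trans (hcc t ht)
    have e : -(c t * (l * w t)) - -(c' t * (l * z t)) =
      -((c' t * l) * (w t - z t)) - (c t - c' t) * (l * w t) := by ring
    rw [e]
    refine (abs_sub _ _).trans (add_le_add ?_ ?_)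
    · rw [abs_neg, abs_mul]
      exact mul_le_mul (hq t ht) (le_max_left _ _) (abs_nonneg _) (by linarith)
    · rw [abs_mul, abs_mul]
      exact mul_le_mul (hcc t ht) (mul_le_mul_of_nonneg_left (hwM t ht) (abs_nonneg _))
        (by positivity) hε

theorem IsModeSolution.continuousOn {T l : ℝ} {c w w₁ : ℝ → ℝ}
    (hw : IsModeSolution T l c w w₁) : ContinuousOn w (Icc 0 T) ∧ ContinuousOn w₁ (Icc 0 T) :=
  ⟨fun t ht => (hw.2.2 t ht).1.continuousWithinAt, fun t ht => (hw.2.2 t ht).2.continuousWithinAt⟩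

theorem IsModeSolution.unique {T l : ℝ} {c w w₁ z z₁ : ℝ → ℝ} (hc : ContinuousOn c (Icc 0 T))
    (hw : IsModeSolution T l c w w₁) (hz : IsModeSolution T l c z z₁) {t : ℝ} (ht : t ∈ Icc 0 T) :
    w t = z t ∧ w₁ t = z₁ t := by
  obtain ⟨Q, hQ⟩ := isCompact_Icc.exists_bound_of_continuousOn (hc.mul continuousOn_const :
    ContinuousOn (fun t => c t * l) (Icc 0 T))
  obtain ⟨M, hM⟩ := isCompact_Icc.exists_bound_of_continuousOn hw.continuousOn.1
  have := hw.sub_le hz (ε := 0) (K := max 1 Q) (M := max 0 M) (le_max_left _ _) (le_max_left _ _)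
    (fun t ht => (hQ t ht).trans (le_max_right _ _)) (fun t ht => (hM t ht).trans (le_max_right _ _))
    (by simp) t ht
  rw [zero_mul, gronwallBound_ε0_δ0] at this
  exact ⟨sub_eq_zero.1 (abs_nonpos_iff.1 this.1), sub_eq_zero.1 (abs_nonpos_iff.1 this.2)⟩

theorem IsModeSolution.mono {T S l : ℝ} {c w w₁ : ℝ → ℝ} (hw : IsModeSolution T l c w w₁)
    (hS : S ≤ T) : IsModeSolution S l c w w₁ :=
  ⟨hw.1, hw.2.1, fun t ht =>
    ⟨(hw.2.2 t ⟨ht.1, ht.2.trans hS⟩).1.mono (Icc_subset_Icc_right hS),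
      (hw.2.2 t ⟨ht.1, ht.2.trans hS⟩).2.mono (Icc_subset_Icc_right hS)⟩⟩

/-- A lower bound for the energy on a compact subinterval is stable under small perturbations of
the coefficient. -/
theorem IsModeSolution.energy_stable {T l b s : ℝ} {c w w₁ : ℝ → ℝ} (hT : 0 ≤ T) (hs : 0 ≤ s)
    (hc : ContinuousOn c (Icc 0 T)) (hw : IsModeSolution T l c w w₁)
    (hb : ∀ t ∈ Icc s T, b < w₁ t ^ 2 + l * w t ^ 2) :
    ∃ ε > 0, ∀ c' : ℝ → ℝ, ContinuousOn c' (Icc 0 T) → (∀ t ∈ Icc 0 T, |c t - c' t| ≤ ε) →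
      ∃ z z₁, IsModeSolution T l c' z z₁ ∧ ∀ t ∈ Icc s T, b < z₁ t ^ 2 + l * z t ^ 2 := by
  obtain ⟨Q, hQ⟩ := isCompact_Icc.exists_bound_of_continuousOn (hc.mul continuousOn_const :
    ContinuousOn (fun t => c t * l) (Icc 0 T))
  obtain ⟨M, hM⟩ := isCompact_Icc.exists_bound_of_continuousOn hw.continuousOn.1
  have hsub : Icc s T ⊆ Icc 0 T := Icc_subset_Icc_left hs
  set W : Set (ℝ × ℝ) := {p | b < p.2 ^ 2 + l * p.1 ^ 2} with hW
  have hWo : IsOpen W := isOpen_lt continuous_const (by fun_prop)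
  have hcomp : IsCompact ((fun t => (w t, w₁ t)) '' Icc s T) :=
    isCompact_Icc.image_of_continuousOn ((hw.continuousOn.1.mono hsub).prodMk
      (hw.continuousOn.2.mono hsub))
  have hKW : (fun t => (w t, w₁ t)) '' Icc s T ⊆ W := by
    rintro _ ⟨t, ht, rfl⟩
    exact hb t ht
  -- The trajectory over `[s, T]` is a compact subset of the open set of states of energy above `b`,
  -- so a whole `δ`-neighbourhood stays in that set.
  obtain ⟨δ, hδ, hδW⟩ := hcomp.exists_thickening_subset_open hWo hKW
  -- The summand `|l|` makes `K` a bound for `|c' l|` uniformly over all `c'` within distance `1` of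
  -- `c`.
  set K : ℝ := max 1 (|Q| + |l|) with hK
  have hK1 : 1 ≤ K := le_max_left _ _
  set C : ℝ := |l| * max 0 M * Real.exp (K * T) / K with hC
  have hC0 : 0 ≤ C := by positivity
  have hgb : ∀ ε t, 0 ≤ ε → t ∈ Icc 0 T → gronwallBound 0 K (ε * (|l| * max 0 M)) t ≤ ε * C := by
    intro ε t hε ht
    rw [gronwallBound_of_K_ne_0 (by positivity)]
    simp only [zero_mul, zero_add, hC]
    have : Real.exp (K * t) - 1 ≤ Real.exp (K * T) := by
      have := Real.exp_le_exp.2 (mul_le_mul_of_nonneg_left ht.2 (zero_le_one.trans hK1))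
      linarith
    calc _ ≤ ε * (|l| * max 0 M) / K * Real.exp (K * T) :=
          mul_le_mul_of_nonneg_left this (by positivity)
      _ = _ := by ring
  refine ⟨min 1 (δ / (2 * (C + 1))), by positivity, fun c' hc' hcc => ?_⟩
  obtain ⟨z, z₁, hz⟩ := exists_isModeSolution (l := l) hT hc'
  refine ⟨z, z₁, hz, fun t ht => ?_⟩
  have hq : ∀ t ∈ Icc 0 T, |c' t * l| ≤ K := by
    intro t ht
    have h1 : |c t - c' t| ≤ 1 := (hcc t ht).trans (min_le_left _ _)
    have h2 : |c t * l| ≤ |Q| := (hQ t ht).trans (le_abs_self _)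
    have e : c' t * l = c t * l - (c t - c' t) * l := by ring
    rw [e]
    refine (abs_sub _ _).trans (le_trans ?_ (le_max_right _ _))
    rw [abs_mul (c t - c' t)]
    have := mul_le_mul_of_nonneg_right h1 (abs_nonneg l)
    linarith
  have h := hw.sub_le hz hK1 (le_max_left 0 M) hq
    (fun t ht => (hM t ht).trans (le_max_right _ _)) hcc t (hsub ht)
  have hε0 : 0 ≤ min 1 (δ / (2 * (C + 1))) := by positivity
  have hlt : min 1 (δ / (2 * (C + 1))) * C < δ := by
    calc _ ≤ δ / (2 * (C + 1)) * C := mul_le_mul_of_nonneg_right (min_le_right _ _) hC0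
      _ < δ := by
        rw [div_mul_eq_mul_div, div_lt_iff₀ (by positivity)]
        nlinarith
  have h3 := hgb _ t hε0 (hsub ht)
  have : (z t, z₁ t) ∈ W := by
    apply hδW
    rw [Metric.mem_thickening_iff]
    refine ⟨(w t, w₁ t), ⟨t, ht, rfl⟩, ?_⟩
    rw [dist_comm, Prod.dist_eq, Real.dist_eq, Real.dist_eq]
    exact max_lt (by linarith [h.1]) (by linarith [h.2])
  exact this

/-! ## Testing with eigenvectors -/

section Eigenvectors

variable {H : Type*} [NormedAddCommGroup H] [InnerProductSpace ℝ H]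

/-- `A e = l e`. -/
def IsEigenpair (A : H →ₗ.[ℝ] H) (e : H) (l : ℝ) : Prop :=
  ∃ h : e ∈ A.domain, A ⟨e, h⟩ = l • e

/-- The functional `v ↦ ⟪e, v⟫` on the vectors of exponential type. -/
def coeff (A : H →ₗ.[ℝ] H) (e : H) : Module.Dual ℝ (testSpace A) :=
  (innerₛₗ ℝ e).comp (testSpace A).subtype

theorem abs_coeff_le {A : H →ₗ.[ℝ] H} {e : H} (he : ‖e‖ = 1) (v : testSpace A) :
    |coeff A e v| ≤ ‖v‖ := by
  have := abs_real_inner_le_norm e (v : H)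
  rw [he, one_mul] at this
  exact this

variable {A : H →ₗ.[ℝ] H} {e : H} {l : ℝ}

theorem IsEigenpair.mem_testSpace (h : IsEigenpair A e l) : e ∈ testSpace A := by
  obtain ⟨hd, he⟩ := h
  refine ⟨fun n => l ^ n • e, by simp, fun n => ⟨A.domain.smul_mem _ hd, ?_⟩, |l|, ‖e‖, fun n => ?_⟩
  · have : A ⟨l ^ n • e, A.domain.smul_mem _ hd⟩ = l ^ n • A ⟨e, hd⟩ := by
      rw [← A.map_smul]
      rfl
    rw [this, he, smul_smul, ← pow_succ]
  · rw [norm_smul, norm_pow, Real.norm_eq_abs, mul_comm]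

theorem IsEigenpair.testOp_eq (h : IsEigenpair A e l) :
    testOp A ⟨e, h.mem_testSpace⟩ = l • ⟨e, h.mem_testSpace⟩ := by
  obtain ⟨hd, he⟩ := h
  exact Subtype.ext he

theorem IsEigenpair.pow_testOp (h : IsEigenpair A e l) (n : ℕ) :
    (testOp A ^ n) ⟨e, h.mem_testSpace⟩ = l ^ n • ⟨e, h.mem_testSpace⟩ := by
  induction n with
  | zero => simp
  | succ n ih => rw [pow_succ', Module.End.mul_apply, ih, map_smul, h.testOp_eq, smul_smul, pow_succ]

theorem IsEigenpair.aeval_testOp (h : IsEigenpair A e l) (p : Polynomial ℝ) :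
    Polynomial.aeval (testOp A) p ⟨e, h.mem_testSpace⟩ = p.eval l • ⟨e, h.mem_testSpace⟩ :=
  Module.End.aeval_apply_of_mem_apply_eq_smul h.testOp_eq

theorem IsEigenpair.coeff_testOp [CompleteSpace H] (hA : IsSelfAdjoint A) (h : IsEigenpair A e l)
    (v : testSpace A) : coeff A e (testOp A v) = l * coeff A e v := by
  have hf : A.IsFormalAdjoint A := by
    have := LinearPMap.adjoint_isFormalAdjoint hA.dense_domain
    rwa [LinearPMap.isSelfAdjoint_def.1 hA] at this
  obtain ⟨hd, he⟩ := h
  have := hf ⟨e, hd⟩ ⟨v, mem_domain_of_mem_testSpace v.2⟩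
  rw [he, real_inner_smul_left] at this
  exact this.symm

theorem IsEigenpair.coeff_pow_testOp [CompleteSpace H] (hA : IsSelfAdjoint A)
    (h : IsEigenpair A e l) (n : ℕ) (v : testSpace A) :
    coeff A e ((testOp A ^ n) v) = l ^ n * coeff A e v := by
  induction n with
  | zero => simp
  | succ n ih => rw [pow_succ', Module.End.mul_apply, h.coeff_testOp hA, ih, pow_succ']; ring

theorem IsEigenpair.coeff_aeval_testOp [CompleteSpace H] (hA : IsSelfAdjoint A)
    (h : IsEigenpair A e l) (p : Polynomial ℝ) (v : testSpace A) :
    coeff A e (Polynomial.aeval (testOp A) p v) = p.eval l * coeff A e v := by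
  induction p using Polynomial.induction_on' with
  | add p q hp hq => rw [map_add, LinearMap.add_apply, map_add, hp, hq, Polynomial.eval_add, add_mul]
  | monomial n a =>
    rw [Polynomial.aeval_monomial, Polynomial.eval_monomial, Module.End.mul_apply,
      Module.algebraMap_end_apply, map_smul, h.coeff_pow_testOp hA, smul_eq_mul, mul_assoc]

/-- By symmetry `l ^ n * |⟪e, v⟫| = |⟪e, Aⁿ v⟫| ≤ C * R ^ n` for all `n`, which is impossible for `R
< l` unless the coefficient vanishes. A negative `R` is also allowed, and there `n = 1` suffices. -/
theorem IsEigenpair.coeff_eq_zero [CompleteSpace H] (hA : IsSelfAdjoint A) (h : IsEigenpair A e l)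
    (he : ‖e‖ = 1) (hl : 0 < l) {R : ℝ} (hR : R < l) {v : testSpace A} (hv : HasType A R v) :
    coeff A e v = 0 := by
  obtain ⟨C, hC⟩ := hv
  have key : ∀ n, l ^ n * |coeff A e v| ≤ C * R ^ n := by
    intro n
    have := (abs_coeff_le he ((testOp A ^ n) v)).trans (hC n)
    rwa [h.coeff_pow_testOp hA, abs_mul, abs_of_pos (pow_pos hl n)] at this
  have hC0 : 0 ≤ C := by
    have := (norm_nonneg _).trans (hC 0)
    simpa using this
  rcases lt_or_ge R 0 with hR0 | hR0
  · have h1 := key 1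
    rw [pow_one, pow_one] at h1
    have h2 : C * R ≤ 0 := mul_nonpos_of_nonneg_of_nonpos hC0 hR0.le
    have h3 := abs_nonneg (coeff A e v)
    exact abs_eq_zero.1 (le_antisymm (by nlinarith) h3)
  · have ht : Tendsto (fun n : ℕ => C * (R / l) ^ n) atTop (𝓝 (C * 0)) :=
      (tendsto_pow_atTop_nhds_zero_of_lt_one (by positivity) ((div_lt_one hl).2 hR)).const_mul C
    rw [mul_zero] at ht
    refine abs_eq_zero.1 (le_antisymm (ge_of_tendsto ht (Eventually.of_forall fun n => ?_))
      (abs_nonneg _))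
    rw [div_pow, ← mul_div_assoc, le_div_iff₀ (pow_pos hl n), mul_comm]
    exact key n

/-- For polynomials in `A` the identity is exact, and it passes to the limit because the
approximation at `l` is good when `l ≤ R`. When `l > R` the approximation says nothing at `l`, but
there the coefficient of `v` is zero. -/
theorem IsEigenpair.coeff_isRpow [CompleteSpace H] (hA : IsSelfAdjoint A) (h : IsEigenpair A e l)
    (he : ‖e‖ = 1) (hl : 0 < l) {s : ℝ} {v w : testSpace A} (hvw : IsRpow A s v w) :
    coeff A e w = (1 + l) ^ s * coeff A e v := by
  obtain ⟨R, hR, hp⟩ := hvw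
  refine eq_of_forall_dist_le fun ε hε => ?_
  obtain ⟨p, hp1, hp2⟩ := hp (ε / (1 + |coeff A e v|)) (by positivity)
  set η := ε / (1 + |coeff A e v|)
  have hη : η * (1 + |coeff A e v|) = ε := div_mul_cancel₀ _ (by positivity)
  have h1 : |p.eval l * coeff A e v - coeff A e w| ≤ η := by
    rw [← h.coeff_aeval_testOp hA, ← map_sub]
    exact (abs_coeff_le he _).trans hp2
  have h2 : |(p.eval l - (1 + l) ^ s) * coeff A e v| ≤ η * |coeff A e v| := by
    rcases le_or_gt l R with hlR | hlR
    · rw [abs_mul]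
      exact mul_le_mul_of_nonneg_right (hp1 l ⟨hl.le, hlR⟩) (abs_nonneg _)
    · rw [h.coeff_eq_zero hA he hl hlR hR]
      simp
  rw [Real.dist_eq]
  have e1 : coeff A e w - (1 + l) ^ s * coeff A e v =
    (p.eval l - (1 + l) ^ s) * coeff A e v - (p.eval l * coeff A e v - coeff A e w) := by ring
  rw [e1]
  refine (abs_sub _ _).trans ?_
  linarith

theorem IsEigenpair.isRpow (h : IsEigenpair A e l) (hl : 0 < l) (s : ℝ) :
    IsRpow A s ⟨e, h.mem_testSpace⟩ ((1 + l) ^ s • ⟨e, h.mem_testSpace⟩) := by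
  refine ⟨l, ⟨‖e‖, fun n => ?_⟩, fun ε hε => ?_⟩
  · rw [h.pow_testOp, norm_smul, norm_pow, Real.norm_eq_abs, abs_of_pos hl, mul_comm]
    exact le_rfl
  · have hc : ContinuousOn (fun x : ℝ => (1 + x) ^ s) (Icc 0 l) :=
      (continuousOn_const.add continuousOn_id).rpow_const fun x hx => Or.inl (by
        have := hx.1
        have : 0 < 1 + x := by linarith
        exact this.ne')
    obtain ⟨p, hp⟩ := exists_polynomial_near_of_continuousOn 0 l _ hc (ε / (1 + ‖e‖)) (by positivity)
    have hle : ε / (1 + ‖e‖) ≤ ε := div_le_self hε.le (by linarith [norm_nonneg e])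
    refine ⟨p, fun x hx => (hp x hx).le.trans hle, ?_⟩
    rw [h.aeval_testOp, ← sub_smul, norm_smul, Real.norm_eq_abs]
    calc |p.eval l - (1 + l) ^ s| * ‖e‖ ≤ ε / (1 + ‖e‖) * (1 + ‖e‖) :=
          mul_le_mul (hp l ⟨hl.le, le_rfl⟩).le (by linarith) (norm_nonneg _) (by positivity)
      _ = ε := div_mul_cancel₀ _ (by positivity)

theorem exists_hasType (v : testSpace A) : ∃ R, HasType A R v := by
  obtain ⟨f, hf0, hf, R, C, hC⟩ := v.2
  refine ⟨R, C, fun n => ?_⟩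
  have : ∀ n, ((testOp A ^ n) v : H) = f n := by
    intro n
    induction n with
    | zero => exact hf0.symm
    | succ n ih =>
      rw [pow_succ', Module.End.mul_apply]
      obtain ⟨h1, h2⟩ := hf n
      rw [← h2]
      change A _ = A _
      congr 1
      exact Subtype.ext ih
  have h := hC n
  rwa [← this n] at h

end Eigenvectors

/-! ## Superposition of modes -/

section Superposition

variable {H : Type*} [NormedAddCommGroup H] [InnerProductSpace ℝ H] [CompleteSpace H]
  {A : H →ₗ.[ℝ] H} {e : ℕ → H} {l : ℕ → ℝ}

theorem exists_forall_coeff_eq_zero_of_hasType (hA : IsSelfAdjoint A) (he : ∀ i, ‖e i‖ = 1)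
    (heig : ∀ i, IsEigenpair A (e i) (l i)) (hl : ∀ i, (2 : ℝ) ^ i ≤ l i) (R : ℝ) :
    ∃ N : ℕ, ∀ v, HasType A R v → ∀ i ≥ N, coeff A (e i) v = 0 := by
  obtain ⟨N, hN⟩ := pow_unbounded_of_one_lt R one_lt_two
  refine ⟨N, fun v hv i hi => (heig i).coeff_eq_zero hA (he i)
    ((by positivity : (0 : ℝ) < 2 ^ i).trans_le (hl i)) ?_ hv⟩
  exact hN.trans_le ((pow_le_pow_right₀ one_le_two hi).trans (hl i))

theorem exists_forall_coeff_eq_zero (hA : IsSelfAdjoint A) (he : ∀ i, ‖e i‖ = 1)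
    (heig : ∀ i, IsEigenpair A (e i) (l i)) (hl : ∀ i, (2 : ℝ) ^ i ≤ l i) (v : testSpace A) :
    ∃ N : ℕ, ∀ i ≥ N, coeff A (e i) v = 0 := by
  obtain ⟨R, hR⟩ := exists_hasType v
  obtain ⟨N, hN⟩ := exists_forall_coeff_eq_zero_of_hasType hA he heig hl R
  exact ⟨N, hN v hR⟩

/-- The series `∑ bᵢ eᵢ` makes sense as a hyperdistribution for every choice of the coefficients
when the eigenvalues tend to infinity. -/
theorem exists_hyper_series (hA : IsSelfAdjoint A) (he : ∀ i, ‖e i‖ = 1)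
    (heig : ∀ i, IsEigenpair A (e i) (l i)) (hl : ∀ i, (2 : ℝ) ^ i ≤ l i) :
    ∃ F : (ℕ → ℝ) → Hyper A, ∀ (b : ℕ → ℝ) (v : testSpace A) (N : ℕ),
      (∀ i ≥ N, coeff A (e i) v = 0) →
        (F b : Module.Dual ℝ (testSpace A)) v = ∑ i ∈ Finset.range N, b i * coeff A (e i) v := by
  have hvan := exists_forall_coeff_eq_zero_of_hasType hA he heig hl
  have hnull := exists_forall_coeff_eq_zero hA he heig hl
  have hsub : ∀ (b : ℕ → ℝ) (v : testSpace A) (N : ℕ), (∀ i ≥ N, coeff A (e i) v = 0) →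
      Function.support (fun i => b i * coeff A (e i) v) ⊆ Finset.range N := by
    intro b v N hN i hi
    by_contra h
    simp only [Finset.coe_range, mem_Iio, not_lt] at h
    exact hi (by simp [hN i h])
  have hfin : ∀ (b : ℕ → ℝ) (v : testSpace A),
      (Function.support (fun i => b i * coeff A (e i) v)).Finite := by
    intro b v
    obtain ⟨N, hN⟩ := hnull v
    exact (Finset.finite_toSet _).subset (hsub b v N hN)
  -- Since `l i ≥ 2 ^ i`, a vector of type `R` pairs nontrivially with only finitely many `e i`,
  -- with a cutoff index depending on `R` alone. The sum is therefore finite, and its bound is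
  -- uniform over vectors of type `R`.
  let G : (ℕ → ℝ) → Module.Dual ℝ (testSpace A) := fun b =>
    { toFun := fun v => ∑ᶠ i, b i * coeff A (e i) v
      map_add' := fun v w => by
        rw [← finsum_add_distrib (hfin b v) (hfin b w)]
        simp only [map_add, mul_add]
      map_smul' := fun a v => by
        rw [RingHom.id_apply, smul_eq_mul, mul_finsum]
        refine finsum_congr fun i => ?_
        rw [map_smul, smul_eq_mul]
        ring }
  have hG : ∀ (b : ℕ → ℝ) (v : testSpace A) (N : ℕ), (∀ i ≥ N, coeff A (e i) v = 0) →
      G b v = ∑ i ∈ Finset.range N, b i * coeff A (e i) v := fun b v N hN =>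
    finsum_eq_sum_of_support_subset _ (hsub b v N hN)
  refine ⟨fun b => ⟨G b, fun R => ?_⟩, hG⟩
  obtain ⟨N, hN⟩ := hvan R
  refine ⟨∑ i ∈ Finset.range N, |b i|, fun v hv => ?_⟩
  rw [hG b v N (hN v hv), Finset.sum_mul]
  refine (Finset.abs_sum_le_sum_abs _ _).trans (Finset.sum_le_sum fun i _ => ?_)
  rw [abs_mul]
  exact mul_le_mul_of_nonneg_left (abs_coeff_le (he i) v) (abs_nonneg _)

/-- With `m > β` one has `(1 + l i) ^ β ≤ (2 * l i) ^ m`; one further power of `l i` absorbs the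
constant `2 ^ m * |D|`, and `i ≥ m + 1` does the rest. -/
theorem eventually_rpow_lt {l : ℕ → ℝ} (hl : ∀ i, (2 : ℝ) ^ i ≤ l i) {β : ℝ} (D : ℝ) :
    ∀ᶠ i in atTop, (1 + l i) ^ β * D < l i ^ i := by
  obtain ⟨m, hm⟩ := exists_nat_gt (max β 0)
  obtain ⟨n, hn⟩ := pow_unbounded_of_one_lt (2 ^ m * |D|) one_lt_two (R := ℝ)
  filter_upwards [eventually_ge_atTop (m + 1), eventually_ge_atTop n] with i hi hin
  have h1 : 1 ≤ l i := (one_le_pow₀ one_le_two).trans (hl i)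
  have h2 : (1 + l i) ^ β ≤ (2 * l i) ^ m := by
    rw [← Real.rpow_natCast]
    calc (1 + l i) ^ β ≤ (1 + l i) ^ (m : ℝ) :=
          Real.rpow_le_rpow_of_exponent_le (by linarith) ((le_max_left _ _).trans hm.le)
      _ ≤ _ := Real.rpow_le_rpow (by linarith) (by linarith) (by positivity)
  have h3 : 2 ^ m * |D| < l i :=
    hn.trans_le ((pow_le_pow_right₀ one_le_two hin).trans (hl i))
  calc (1 + l i) ^ β * D ≤ (2 * l i) ^ m * |D| :=
        (mul_le_mul_of_nonneg_left (le_abs_self D)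
          (Real.rpow_nonneg (by linarith) _)).trans (mul_le_mul_of_nonneg_right h2 (abs_nonneg _))
    _ = 2 ^ m * |D| * l i ^ m := by ring
    _ < l i * l i ^ m := mul_lt_mul_of_pos_right h3 (by positivity)
    _ = l i ^ (m + 1) := by ring
    _ ≤ l i ^ i := pow_le_pow_right₀ h1 hi

theorem summable_rpow_mul_inv_pow {l : ℕ → ℝ} (hl : ∀ i, (2 : ℝ) ^ i ≤ l i) (s : ℝ) :
    Summable fun i => (1 + l i) ^ s * (l i ^ i)⁻¹ := by
  have hpos : ∀ i, 0 < l i := fun i => (by positivity : (0 : ℝ) < 2 ^ i).trans_le (hl i)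
  refine Summable.of_norm_bounded_eventually_nat (g := fun i : ℕ => ((1 : ℝ) / 2) ^ i)
    (summable_geometric_of_lt_one (by norm_num) (by norm_num)) ?_
  -- The exponent `s + 1` yields a spare factor `1 + l i ≥ 2 ^ i`, hence comparison with a geometric
  -- series.
  filter_upwards [eventually_rpow_lt hl (β := s + 1) 1] with i hi
  have h0 := hpos i
  have h1 : (1 + l i) ^ (s + 1) = (1 + l i) ^ s * (1 + l i) := by
    rw [Real.rpow_add (by linarith), Real.rpow_one]
  have h2 : 0 < (1 + l i) ^ s := Real.rpow_pos_of_pos (by linarith) _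
  rw [Real.norm_of_nonneg (by positivity), ← div_eq_mul_inv, div_le_iff₀ (by positivity), one_div,
    inv_pow, inv_mul_eq_div, le_div_iff₀ (by positivity)]
  rw [h1, mul_one] at hi
  have h3 := hl i
  calc _ ≤ (1 + l i) ^ s * (1 + l i) := mul_le_mul_of_nonneg_left (by linarith) h2.le
    _ ≤ _ := hi.le

/-- A superposition of modes with rapidly growing energies has an infinite derivative loss. -/
theorem infiniteDerivativeLoss_of_modes (hA : IsSelfAdjoint A) (he : Orthonormal ℝ e)
    (heig : ∀ i, IsEigenpair A (e i) (l i)) (hl : ∀ i, (2 : ℝ) ^ i ≤ l i) {T₀ : ℝ}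
    {c : ℝ → ℝ} {w w₁ : ℕ → ℝ → ℝ} (hT : 0 < T₀)
    (hw : ∀ i, IsModeSolution T₀ (l i) c (w i) (w₁ i))
    (hE : ∀ i : ℕ, ∀ t ∈ Icc (T₀ / (i + 1)) T₀, l i ^ (4 * i) < w₁ i t ^ 2 + l i * w i t ^ 2) :
    InfiniteDerivativeLoss A T₀ c := by
  have hlpos : ∀ i, 0 < l i := fun i => (by positivity : (0 : ℝ) < 2 ^ i).trans_le (hl i)
  have hnull := exists_forall_coeff_eq_zero hA he.1 heig hl
  obtain ⟨F, hF⟩ := exists_hyper_series hA he.1 heig hl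
  have hF1 : ∀ b i, (F b : Module.Dual ℝ (testSpace A)) ⟨e i, (heig i).mem_testSpace⟩ = b i := by
    intro b i
    have hort : ∀ j, coeff A (e j) ⟨e i, (heig i).mem_testSpace⟩ = if j = i then 1 else 0 :=
      fun j => orthonormal_iff_ite.1 he j i
    rw [hF b _ (i + 1) fun j hj => by rw [hort, if_neg (by omega)]]
    simp [hort]
  -- Of the `4 * i` powers of `l i` in the energy, `2 * i` are spent on `a i ^ 2`, and the remaining
  -- `2 * i` still defeat every fixed power.
  set a : ℕ → ℝ := fun i => (l i ^ i)⁻¹ with ha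
  have ha0 : ∀ i, 0 < a i := fun i => inv_pos.2 (pow_pos (hlpos i) i)
  refine ⟨fun t => F fun i => a i * w i t, fun t => F fun i => a i * w₁ i t, ?_, ?_, ?_⟩
  · intro v t ht
    obtain ⟨N, hN⟩ := hnull v
    have hN' : ∀ i ≥ N, coeff A (e i) (testOp A v) = 0 := fun i hi => by
      rw [(heig i).coeff_testOp hA, hN i hi, mul_zero]
    simp only [hF _ v N hN, hF _ (testOp A v) N hN']
    refine ⟨?_, ?_⟩
    · exact HasDerivWithinAt.fun_sum fun i _ =>
        (((hw i).2.2 t ht).1.const_mul (a i)).mul_const _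
    · have := HasDerivWithinAt.fun_sum (u := Finset.range N) fun i _ =>
        (((hw i).2.2 t ht).2.const_mul (a i)).mul_const (coeff A (e i) v)
      refine this.congr_deriv ?_
      rw [Finset.mul_sum, ← Finset.sum_neg_distrib]
      refine Finset.sum_congr rfl fun i _ => ?_
      rw [(heig i).coeff_testOp hA]
      ring
  · have hdom : ∀ (s : ℝ) (b : ℕ → ℝ), (∀ i, |b i| ≤ a i) → MemDomPow A s (F b) := by
      intro s b hb
      refine ⟨∑' i, (1 + l i) ^ s * a i, fun v x hvx => ?_⟩
      obtain ⟨N, hN⟩ := hnull v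
      have hx : ∀ i, coeff A (e i) x = (1 + l i) ^ s * coeff A (e i) v := fun i =>
        (heig i).coeff_isRpow hA (he.1 i) (hlpos i) hvx
      have hp : ∀ i, 0 ≤ (1 + l i) ^ s := fun i =>
        Real.rpow_nonneg (by linarith [hlpos i]) _
      rw [hF b x N fun i hi => by rw [hx, hN i hi, mul_zero]]
      refine (Finset.abs_sum_le_sum_abs _ _).trans ?_
      calc _ ≤ ∑ i ∈ Finset.range N, (1 + l i) ^ s * a i * ‖v‖ := by
            refine Finset.sum_le_sum fun i _ => ?_
            rw [hx, abs_mul, abs_mul, abs_of_nonneg (hp i), mul_left_comm, ← mul_assoc, mul_assoc]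
            rw [mul_assoc]
            exact mul_le_mul_of_nonneg_left (mul_le_mul (hb i) (abs_coeff_le (he.1 i) v)
              (abs_nonneg _) (ha0 i).le) (hp i)
        _ = (∑ i ∈ Finset.range N, (1 + l i) ^ s * a i) * ‖v‖ := by rw [Finset.sum_mul]
        _ ≤ _ := by
            refine mul_le_mul_of_nonneg_right ?_ (norm_nonneg _)
            exact (summable_rpow_mul_inv_pow hl s).sum_le_tsum _ fun i _ =>
              mul_nonneg (hp i) (ha0 i).le
    refine fun β _ => ⟨hdom _ _ fun i => ?_, hdom _ _ fun i => ?_⟩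
    · rw [(hw i).1, mul_zero, abs_zero]
      exact (ha0 i).le
    · rw [(hw i).2.1, mul_one, abs_of_pos (ha0 i)]
  · rintro β hβ t ht ⟨⟨C, hC⟩, ⟨D, hD⟩⟩
    have hC' : ∀ i, (1 + l i) ^ (-β + 1 / 2) * (a i * |w i t|) ≤ C := by
      intro i
      have := hC _ _ ((heig i).isRpow (hlpos i) _)
      have hn : ‖(⟨e i, (heig i).mem_testSpace⟩ : testSpace A)‖ = 1 := he.1 i
      rwa [map_smul, hF1, hn, mul_one, smul_eq_mul, abs_mul, abs_mul, abs_of_pos (ha0 i),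
        abs_of_pos (Real.rpow_pos_of_pos (by linarith [hlpos i]) _)] at this
    have hD' : ∀ i, (1 + l i) ^ (-β) * (a i * |w₁ i t|) ≤ D := by
      intro i
      have := hD _ _ ((heig i).isRpow (hlpos i) _)
      have hn : ‖(⟨e i, (heig i).mem_testSpace⟩ : testSpace A)‖ = 1 := he.1 i
      rwa [map_smul, hF1, hn, mul_one, smul_eq_mul, abs_mul, abs_mul, abs_of_pos (ha0 i),
        abs_of_pos (Real.rpow_pos_of_pos (by linarith [hlpos i]) _)] at this
    obtain ⟨n, hn⟩ := exists_nat_gt (T₀ / t)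
    -- Membership in the two domains would bound `a i ^ 2` times the energy at `t` by `(C ^ 2 + D ^
    -- 2) * (1 + l i) ^ (2 * β)`. The index is chosen so that this is below `l i ^ i`, and with `i ≥
    -- n > T₀ / t` so that `t` lies in the interval where the energy is large.
    obtain ⟨i, hi, hin⟩ := ((eventually_rpow_lt hl (β := 2 * β) (C ^ 2 + D ^ 2)).and
      (eventually_ge_atTop n)).exists
    have hti : t ∈ Icc (T₀ / (i + 1)) T₀ := by
      refine ⟨?_, ht.2⟩
      rw [div_le_iff₀ (by positivity)]
      rw [div_lt_iff₀ ht.1] at hn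
      have : (n : ℝ) ≤ i := by exact_mod_cast hin
      nlinarith [ht.1]
    have h0 := hlpos i
    have h1 : 1 ≤ l i := (one_le_pow₀ one_le_two).trans (hl i)
    set X := (1 + l i) ^ β with hX
    have hXp : 0 < X := Real.rpow_pos_of_pos (by linarith) _
    have hX2 : (1 + l i) ^ (2 * β) = X ^ 2 := by
      rw [hX, mul_comm, Real.rpow_mul (by linarith), Real.rpow_two]
    have hX3 : (1 + l i) ^ (-β) = X⁻¹ := Real.rpow_neg (by linarith) _
    have hX4 : (1 + l i) ^ (-β + 1 / 2) = X⁻¹ * √(1 + l i) := by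
      rw [Real.rpow_add (by linarith), hX3, Real.sqrt_eq_rpow]
    have c1 := hC' i
    have d1 := hD' i
    rw [hX4] at c1
    rw [hX3] at d1
    have c2 : √(1 + l i) * (a i * |w i t|) ≤ C * X := by
      rw [mul_assoc, inv_mul_le_iff₀ hXp] at c1
      linarith
    have d2 : a i * |w₁ i t| ≤ D * X := by
      rw [inv_mul_le_iff₀ hXp] at d1
      linarith
    have c3 := pow_le_pow_left₀ (by have := ha0 i; positivity) c2 2
    have d3 := pow_le_pow_left₀ (by have := ha0 i; positivity) d2 2
    rw [mul_pow, mul_pow, Real.sq_sqrt (by linarith), sq_abs] at c3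
    rw [mul_pow, sq_abs] at d3
    have hai : a i ^ 2 * l i ^ (4 * i) = l i ^ (2 * i) := by
      rw [ha, inv_pow, ← pow_mul, inv_mul_eq_div, div_eq_iff (by positivity), ← pow_add]
      ring_nf
    have hEi := mul_lt_mul_of_pos_left (hE i t hti) (pow_pos (ha0 i) 2)
    rw [hai] at hEi
    rw [hX2] at hi
    have h5 : l i ^ i ≤ l i ^ (2 * i) := pow_le_pow_right₀ h1 (by omega)
    have h6 : 0 ≤ a i ^ 2 * w i t ^ 2 := by positivity
    nlinarith

end Superposition

/-! ## The space of propagation speeds -/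

section Speeds

variable {T₀ μ₁ μ₂ : ℝ} {ω ψ : ℝ → ℝ}

theorem continuousOn_speedFun (c : C(Icc (0 : ℝ) T₀, ℝ)) : ContinuousOn (speedFun c) (Icc 0 T₀) := by
  rw [continuousOn_iff_continuous_domRestrict]
  refine c.continuous.congr fun x => ?_
  simp [speedFun]

namespace PS2

theorem hasDerivWithinAt_speedFun (c : PS2 T₀ μ₁ μ₂ ω ψ) {t : ℝ} (ht : t ∈ Ioc 0 T₀) :
    HasDerivWithinAt (speedFun c.1) (D1 c.1 t) (Ioc 0 T₀) t :=
  (c.2.1.differentiableOn two_ne_zero t ht).hasDerivWithinAt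

theorem contDiffOn_D1 (c : PS2 T₀ μ₁ μ₂ ω ψ) : ContDiffOn ℝ 1 (D1 c.1) (Ioc 0 T₀) :=
  c.2.1.derivWithin (uniqueDiffOn_Ioc 0 T₀) (by norm_num)

theorem hasDerivWithinAt_D1 (c : PS2 T₀ μ₁ μ₂ ω ψ) {t : ℝ} (ht : t ∈ Ioc 0 T₀) :
    HasDerivWithinAt (D1 c.1) (D2 c.1 t) (Ioc 0 T₀) t :=
  (c.contDiffOn_D1.differentiableOn one_ne_zero t ht).hasDerivWithinAt

theorem continuousOn_D2 (c : PS2 T₀ μ₁ μ₂ ω ψ) : ContinuousOn (D2 c.1) (Ioc 0 T₀) :=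
  c.contDiffOn_D1.continuousOn_derivWithin (uniqueDiffOn_Ioc 0 T₀) le_rfl

theorem continuousOn_D1 (c : PS2 T₀ μ₁ μ₂ ω ψ) : ContinuousOn (D1 c.1) (Ioc 0 T₀) :=
  c.contDiffOn_D1.continuousOn

/-- This is how all new speeds are produced (limits, cutoffs, perturbations): explicit candidates
for the derivatives replace iterated `derivWithin`, by uniqueness of derivatives on `(0, T₀]`. -/
theorem exists_of_hasDerivWithinAt {g g₁ g₂ : ℝ → ℝ} (hg : ContinuousOn g (Icc 0 T₀))
    (h1 : ∀ t ∈ Ioc 0 T₀, HasDerivWithinAt g (g₁ t) (Ioc 0 T₀) t)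
    (h2 : ∀ t ∈ Ioc 0 T₀, HasDerivWithinAt g₁ (g₂ t) (Ioc 0 T₀) t)
    (hc : ContinuousOn g₂ (Ioc 0 T₀)) (b0 : ∀ t ∈ Ioo 0 T₀, μ₁ ≤ g t ∧ g t ≤ μ₂)
    (b1 : ∀ t ∈ Ioc 0 T₀, |g₁ t| ≤ ω t / t)
    (b2 : ∀ t ∈ Ioc 0 T₀, |g₂ t| ≤ ω t ^ 2 / t ^ 2 * Real.exp (ψ t)) :
    ∃ c : PS2 T₀ μ₁ μ₂ ω ψ, (∀ t ∈ Icc 0 T₀, speedFun c.1 t = g t) ∧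
      (∀ t ∈ Ioc 0 T₀, D1 c.1 t = g₁ t) ∧ ∀ t ∈ Ioc 0 T₀, D2 c.1 t = g₂ t := by
  have hu := uniqueDiffOn_Ioc 0 T₀
  let c : C(Icc (0 : ℝ) T₀, ℝ) := ⟨fun t => g t, continuousOn_iff_continuous_domRestrict.1 hg⟩
  have e0 : ∀ t ∈ Icc 0 T₀, speedFun c t = g t := fun t ht => by rw [speedFun, dif_pos ht]; rfl
  have e0' : ∀ t ∈ Ioc 0 T₀, speedFun c t = g t := fun t ht => e0 t (Ioc_subset_Icc_self ht)
  have e1 : ∀ t ∈ Ioc 0 T₀, D1 c t = g₁ t := fun t ht =>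
    ((h1 t ht).congr e0' (e0' t ht)).derivWithin (hu t ht)
  have e2 : ∀ t ∈ Ioc 0 T₀, D2 c t = g₂ t := fun t ht =>
    ((h2 t ht).congr e1 (e1 t ht)).derivWithin (hu t ht)
  have hcd1 : ContDiffOn ℝ 1 g₁ (Ioc 0 T₀) := by
    have := (contDiffOn_succ_iff_derivWithin (𝕜 := ℝ) (n := 0) (f := g₁) hu).2
      ⟨fun t ht => (h2 t ht).differentiableWithinAt, by simp, contDiffOn_zero.2
        (hc.congr fun t ht => (h2 t ht).derivWithin (hu t ht))⟩
    simpa using this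
  have hcd : ContDiffOn ℝ 2 g (Ioc 0 T₀) := by
    have := (contDiffOn_succ_iff_derivWithin (𝕜 := ℝ) (n := 1) (f := g) hu).2
      ⟨fun t ht => (h1 t ht).differentiableWithinAt, by simp,
        hcd1.congr fun t ht => (h1 t ht).derivWithin (hu t ht)⟩
    rwa [one_add_one_eq_two] at this
  refine ⟨⟨c, hcd.congr e0', fun t ht => ?_, fun t ht => ?_, fun t ht => ?_⟩, e0, e1, e2⟩
  · rw [e0 t (Ioo_subset_Icc_self ht)]
    exact b0 t ht
  · rw [e1 t ht]
    exact b1 t ht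
  · rw [e2 t ht]
    exact b2 t ht

theorem d_le (hT : 0 < T₀) {c₁ c₂ : PS2 T₀ μ₁ μ₂ ω ψ} {a₀ a₁ a₂ : ℝ}
    (h0 : ∀ t ∈ Ioo 0 T₀, |speedFun c₁.1 t - speedFun c₂.1 t| ≤ a₀)
    (h1 : ∀ t ∈ Ioo 0 T₀, t ^ 2 / ω t * |D1 c₁.1 t - D1 c₂.1 t| ≤ a₁)
    (h2 : ∀ t ∈ Ioo 0 T₀,
      t ^ 3 * Real.exp (-ψ t) / ω t ^ 2 * |D2 c₁.1 t - D2 c₂.1 t| ≤ a₂) :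
    PS2.d c₁ c₂ ≤ a₀ + a₁ + a₂ := by
  have : Nonempty (Ioo 0 T₀) := ⟨⟨T₀ / 2, by constructor <;> linarith⟩⟩
  exact add_le_add (add_le_add (ciSup_le fun t => h0 t t.2) (ciSup_le fun t => h1 t t.2))
    (ciSup_le fun t => h2 t t.2)

theorem le_d (hω : ∀ t ∈ Ioc 0 T₀, 0 < ω t) (c₁ c₂ : PS2 T₀ μ₁ μ₂ ω ψ) {t : ℝ} (ht : t ∈ Ioo 0 T₀) :
    |speedFun c₁.1 t - speedFun c₂.1 t| ≤ PS2.d c₁ c₂ ∧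
    t ^ 2 / ω t * |D1 c₁.1 t - D1 c₂.1 t| ≤ PS2.d c₁ c₂ ∧
    t ^ 3 * Real.exp (-ψ t) / ω t ^ 2 * |D2 c₁.1 t - D2 c₂.1 t| ≤ PS2.d c₁ c₂ := by
  have hw : ∀ t : Ioo 0 T₀, 0 < ω t := fun t => hω t ⟨t.2.1, t.2.2.le⟩
  have n0 : 0 ≤ ⨆ t : Ioo 0 T₀, |speedFun c₁.1 t - speedFun c₂.1 t| :=
    Real.iSup_nonneg fun t => abs_nonneg _
  have n1 : 0 ≤ ⨆ t : Ioo 0 T₀, (t : ℝ) ^ 2 / ω t * |D1 c₁.1 t - D1 c₂.1 t| :=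
    Real.iSup_nonneg fun t => mul_nonneg (div_nonneg (sq_nonneg _) (hw t).le) (abs_nonneg _)
  have n2 : 0 ≤ ⨆ t : Ioo 0 T₀,
      (t : ℝ) ^ 3 * Real.exp (-ψ t) / ω t ^ 2 * |D2 c₁.1 t - D2 c₂.1 t| :=
    Real.iSup_nonneg fun t => mul_nonneg (div_nonneg
      (mul_nonneg (pow_nonneg t.2.1.le 3) (Real.exp_pos _).le) (sq_nonneg _)) (abs_nonneg _)
  have i0 := le_ciSup (PS2.bdd0 c₁ c₂) ⟨t, ht⟩
  have i1 := le_ciSup (PS2.bdd1 hω c₁ c₂) ⟨t, ht⟩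
  have i2 := le_ciSup (PS2.bdd2 hω c₁ c₂) ⟨t, ht⟩
  simp only at i0 i1 i2
  simp only [PS2.d]
  exact ⟨by linarith, by linarith, by linarith⟩

theorem abs_speedFun_sub_le (hT : 0 < T₀) (hω : ∀ t ∈ Ioc 0 T₀, 0 < ω t)
    (c₁ c₂ : PS2 T₀ μ₁ μ₂ ω ψ) {t : ℝ} (ht : t ∈ Icc 0 T₀) :
    |speedFun c₁.1 t - speedFun c₂.1 t| ≤ PS2.d c₁ c₂ := by
  rw [← closure_Ioo hT.ne] at ht
  refine le_on_closure (fun x hx => (le_d hω c₁ c₂ hx).1) ?_ continuousOn_const ht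
  rw [closure_Ioo hT.ne]
  exact ((continuousOn_speedFun _).sub (continuousOn_speedFun _)).abs

/-- The weight `t ^ 2 / ω t` degenerates at `0`, so derivatives are controlled only away from `0`.
Monotonicity of `ω` makes the constant uniform on `[s, T₀]`, and continuity recovers the endpoint
`T₀`, which is absent from the suprema. -/
theorem abs_D1_sub_le (hω : ∀ t ∈ Ioc 0 T₀, 0 < ω t) (hω' : AntitoneOn ω (Ioc 0 T₀))
    (c₁ c₂ : PS2 T₀ μ₁ μ₂ ω ψ) {s t : ℝ} (hs : s ∈ Ioo 0 T₀) (ht : t ∈ Icc s T₀) :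
    |D1 c₁.1 t - D1 c₂.1 t| ≤ ω s / s ^ 2 * PS2.d c₁ c₂ := by
  rw [← closure_Ico hs.2.ne] at ht
  refine le_on_closure (f := fun x => |D1 c₁.1 x - D1 c₂.1 x|) (fun x hx => ?_) ?_
    continuousOn_const ht
  · have h0 : 0 < x := hs.1.trans_le hx.1
    have hx' : x ∈ Ioc 0 T₀ := ⟨h0, hx.2.le⟩
    have hw := hω x hx'
    have h := (le_d hω c₁ c₂ ⟨h0, hx.2⟩).2.1
    have hd : 0 ≤ PS2.d c₁ c₂ := le_trans (by positivity) h
    rw [div_mul_eq_mul_div, div_le_iff₀ hw, mul_comm, ← le_div_iff₀ (by positivity)] at h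
    refine h.trans ?_
    rw [div_mul_eq_mul_div, mul_comm]
    have h1 := hω' ⟨hs.1, hs.2.le⟩ hx' hx.1
    have h2 := hs.1
    have h3 := hx.1
    have h5 := hω s ⟨hs.1, hs.2.le⟩
    gcongr
  · rw [closure_Ico hs.2.ne]
    exact ((c₁.continuousOn_D1.sub c₂.continuousOn_D1).abs).mono
      fun x hx => ⟨hs.1.trans_le hx.1, hx.2⟩

theorem abs_D2_sub_le (hω : ∀ t ∈ Ioc 0 T₀, 0 < ω t) (hω' : AntitoneOn ω (Ioc 0 T₀))
    (hψ' : AntitoneOn ψ (Ioc 0 T₀))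
    (c₁ c₂ : PS2 T₀ μ₁ μ₂ ω ψ) {s t : ℝ} (hs : s ∈ Ioo 0 T₀) (ht : t ∈ Icc s T₀) :
    |D2 c₁.1 t - D2 c₂.1 t| ≤ ω s ^ 2 * Real.exp (ψ s) / s ^ 3 * PS2.d c₁ c₂ := by
  rw [← closure_Ico hs.2.ne] at ht
  refine le_on_closure (f := fun x => |D2 c₁.1 x - D2 c₂.1 x|) (fun x hx => ?_) ?_
    continuousOn_const ht
  · have h0 : 0 < x := hs.1.trans_le hx.1
    have hx' : x ∈ Ioc 0 T₀ := ⟨h0, hx.2.le⟩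
    have hw := hω x hx'
    have h := (le_d hω c₁ c₂ ⟨h0, hx.2⟩).2.2
    have hd : 0 ≤ PS2.d c₁ c₂ := le_trans (by positivity) h
    have e : |D2 c₁.1 x - D2 c₂.1 x| = ω x ^ 2 * Real.exp (ψ x) / x ^ 3 *
        (x ^ 3 * Real.exp (-ψ x) / ω x ^ 2 * |D2 c₁.1 x - D2 c₂.1 x|) := by
      rw [Real.exp_neg]
      field_simp
    rw [e]
    have h1 := hω' ⟨hs.1, hs.2.le⟩ hx' hx.1
    have h4 := hψ' ⟨hs.1, hs.2.le⟩ hx' hx.1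
    have h2 := hs.1
    have h3 := hx.1
    gcongr
  · rw [closure_Ico hs.2.ne]
    exact ((c₁.continuousOn_D2.sub c₂.continuousOn_D2).abs).mono
      fun x hx => ⟨hs.1.trans_le hx.1, hx.2⟩

end PS2

/-- Locally uniform convergence of derivatives on the half-open interval `(0,T]`. -/
theorem hasDerivWithinAt_Ioc_of_tendstoUniformlyOn {T : ℝ} {f f' : ℕ → ℝ → ℝ} {g g' : ℝ → ℝ}
    (hT : 0 < T)
    (hf : ∀ n, ∀ t ∈ Ioc 0 T, HasDerivWithinAt (f n) (f' n t) (Ioc 0 T) t)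
    (hf' : ∀ s ∈ Ioo 0 T, TendstoUniformlyOn f' g' atTop (Icc s T))
    (hfg : ∀ t ∈ Ioc 0 T, Tendsto (fun n => f n t) atTop (𝓝 (g t))) {t : ℝ} (ht : t ∈ Ioc 0 T) :
    HasDerivWithinAt g (g' t) (Ioc 0 T) t := by
  -- Each function is continued beyond `T` by its tangent line, so that `T` becomes an interior
  -- point and the differentiation of limits on an open set applies.
  let F : ℕ → ℝ → ℝ := fun n t => if t ≤ T then f n t else f n T + f' n T * (t - T)
  let G : ℝ → ℝ := fun t => if t ≤ T then g t else g T + g' T * (t - T)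
  have hTm : T ∈ Ioc 0 T := ⟨hT, le_rfl⟩
  have hF : ∀ n, ∀ t > 0, HasDerivAt (F n) (f' n (min t T)) t := by
    intro n t ht
    have hlin : ∀ x, HasDerivAt (fun t => f n T + f' n T * (t - T)) (f' n T) x := fun x => by
      simpa using (((hasDerivAt_id x).sub_const T).const_mul (f' n T)).const_add (f n T)
    rcases lt_trichotomy t T with h | rfl | h
    · rw [min_eq_left h.le]
      have := (hf n t ⟨ht, h.le⟩).hasDerivAt (Ioc_mem_nhds ht h)
      refine this.congr_of_eventuallyEq ?_
      filter_upwards [Iio_mem_nhds h] with x hx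
      exact if_pos (le_of_lt hx)
    · rw [min_self]
      have hl : HasDerivWithinAt (F n) (f' n t) (Iic t) t :=
        ((hf n t hTm).mono_of_mem_nhdsWithin (Ioc_mem_nhdsLE hT)).congr
          (fun x hx => if_pos hx) (if_pos le_rfl)
      have hr : HasDerivWithinAt (F n) (f' n t) (Ici t) t := by
        refine (hlin t).hasDerivWithinAt.congr (fun x hx => ?_) ?_
        · rcases eq_or_lt_of_le (show t ≤ x from hx) with rfl | h
          · simp [F]
          · exact if_neg (not_le.2 h)
        · simp [F]
      have := hl.union hr
      rwa [Iic_union_Ici, hasDerivWithinAt_univ] at this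
    · rw [min_eq_right h.le]
      refine (hlin t).congr_of_eventuallyEq ?_
      filter_upwards [Ioi_mem_nhds h] with x hx
      exact if_neg (not_le.2 hx)
  have hs : min (t / 2) (T / 2) ∈ Ioo 0 T :=
    ⟨by have := ht.1; positivity, (min_le_right _ _).trans_lt (by linarith)⟩
  set s := min (t / 2) (T / 2)
  have hst : s < t := (min_le_left _ _).trans_lt (by linarith [ht.1])
  have hunif : TendstoUniformlyOn (fun n x => f' n (min x T)) (fun x => g' (min x T)) atTop
      (Ioi s) := by
    intro u hu
    filter_upwards [hf' s hs u hu] with n hn x hx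
    exact hn _ ⟨le_min (le_of_lt hx) hs.2.le, min_le_right _ _⟩
  have hFG : ∀ x ∈ Ioi s, Tendsto (fun n => F n x) atTop (𝓝 (G x)) := by
    intro x hx
    have hx0 : 0 < x := hs.1.trans hx
    by_cases h : x ≤ T
    · simpa [F, G, h] using hfg x ⟨hx0, h⟩
    · have h1 := hfg T hTm
      have h2 := (hf' s hs).tendsto_at (right_mem_Icc.2 hs.2.le)
      simpa [F, G, h] using h1.add (h2.mul_const (x - T))
  have key := hasDerivAt_of_tendstoUniformlyOn isOpen_Ioi hunif
    (Eventually.of_forall fun n x hx => hF n x (hs.1.trans hx)) hFG hst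
  rw [min_eq_left ht.2] at key
  exact key.hasDerivWithinAt.congr (fun x hx => (if_pos hx.2).symm) (if_pos ht.2).symm

theorem continuousOn_Ioc_of_tendstoUniformlyOn {T : ℝ} {f : ℕ → ℝ → ℝ} {g : ℝ → ℝ} (hT : 0 < T)
    (hf : ∀ n, ContinuousOn (f n) (Ioc 0 T))
    (hfg : ∀ s ∈ Ioo 0 T, TendstoUniformlyOn f g atTop (Icc s T)) : ContinuousOn g (Ioc 0 T) := by
  intro t ht
  have hs : t / 2 ∈ Ioo 0 T := ⟨by linarith [ht.1], by linarith [ht.1, ht.2]⟩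
  have hc : ContinuousOn g (Icc (t / 2) T) := (hfg _ hs).continuousOn
    (Frequently.of_forall fun n => (hf n).mono fun x hx => ⟨hs.1.trans_le hx.1, hx.2⟩)
  refine (hc t ⟨by linarith [ht.1], ht.2⟩).mono_of_mem_nhdsWithin ?_
  refine mem_nhdsWithin.2 ⟨Ioi (t / 2), isOpen_Ioi, by simp; linarith [ht.1], fun x hx => ?_⟩
  exact ⟨le_of_lt hx.1, hx.2.2⟩

theorem exists_forall_tendsto_of_abs_sub_le {X : Type*} [PseudoMetricSpace X] {u : ℕ → X}
    (hu : CauchySeq u) {Φ : X → ℝ → ℝ} {S : Set ℝ}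
    (h : ∀ t ∈ S, ∃ C : ℝ, ∀ x y, |Φ x t - Φ y t| ≤ C * dist x y) :
    ∃ g : ℝ → ℝ, ∀ t ∈ S, Tendsto (fun n => Φ (u n) t) atTop (𝓝 (g t)) := by
  have : ∀ t, ∃ y, t ∈ S → Tendsto (fun n => Φ (u n) t) atTop (𝓝 y) := by
    intro t
    by_cases ht : t ∈ S
    · obtain ⟨C, hC⟩ := h t ht
      have hL : LipschitzWith _ (fun x => Φ x t) := LipschitzWith.of_dist_le' hC
      exact (cauchySeq_tendsto_of_complete (hL.uniformContinuous.comp_cauchySeq hu)).imp fun y hy _ => hy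
    · exact ⟨0, fun h => absurd h ht⟩
  choose g hg using this
  exact ⟨g, hg⟩

theorem tendstoUniformlyOn_of_abs_sub_le {X : Type*} [PseudoMetricSpace X] {u : ℕ → X}
    (hu : CauchySeq u) {Φ : X → ℝ → ℝ} {S : Set ℝ} {g : ℝ → ℝ} {C : ℝ}
    (h : ∀ t ∈ S, ∀ x y, |Φ x t - Φ y t| ≤ C * dist x y)
    (hg : ∀ t ∈ S, Tendsto (fun n => Φ (u n) t) atTop (𝓝 (g t))) :
    TendstoUniformlyOn (fun n => Φ (u n)) g atTop S := by
  refine UniformCauchySeqOn.tendstoUniformlyOn_of_tendsto ?_ hg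
  rw [Metric.uniformCauchySeqOn_iff]
  intro ε hε
  obtain ⟨N, hN⟩ := Metric.cauchySeq_iff.1 hu (ε / (|C| + 1)) (by positivity)
  refine ⟨N, fun m hm n hn t ht => ?_⟩
  have h1 := h t ht (u m) (u n)
  have h2 := hN m hm n hn
  rw [lt_div_iff₀ (by positivity)] at h2
  rw [Real.dist_eq]
  have h3 : C * dist (u m) (u n) ≤ |C| * dist (u m) (u n) :=
    mul_le_mul_of_nonneg_right (le_abs_self C) dist_nonneg
  have h4 : 0 ≤ dist (u m) (u n) := dist_nonneg
  linarith

/-- A Cauchy sequence converges uniformly on `[0, T₀]`, and its two derivatives converge uniformly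
on each `[s, T₀]`, which identifies the derivatives of the limit. The pointwise bounds of the class
are closed conditions. -/
theorem PS2.completeSpace (hT : 0 < T₀) (hω : ∀ t ∈ Ioc 0 T₀, 0 < ω t)
    (hω' : AntitoneOn ω (Ioc 0 T₀)) (hψ' : AntitoneOn ψ (Ioc 0 T₀)) :
    letI : MetricSpace (PS2 T₀ μ₁ μ₂ ω ψ) := PS2.metricSpace hT hω
    CompleteSpace (PS2 T₀ μ₁ μ₂ ω ψ) := by
  let _ : MetricSpace (PS2 T₀ μ₁ μ₂ ω ψ) := PS2.metricSpace hT hω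
  refine Metric.complete_of_cauchySeq_tendsto fun u hu => ?_
  have k0 : ∀ t ∈ Icc 0 T₀, ∀ x y : PS2 T₀ μ₁ μ₂ ω ψ,
      |speedFun x.1 t - speedFun y.1 t| ≤ 1 * dist x y := fun t ht x y => by
    rw [one_mul]
    exact PS2.abs_speedFun_sub_le hT hω x y ht
  have k1 : ∀ s ∈ Ioo 0 T₀, ∀ t ∈ Icc s T₀, ∀ x y : PS2 T₀ μ₁ μ₂ ω ψ,
      |D1 x.1 t - D1 y.1 t| ≤ ω s / s ^ 2 * dist x y := fun s hs t ht x y =>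
    PS2.abs_D1_sub_le hω hω' x y hs ht
  have k2 : ∀ s ∈ Ioo 0 T₀, ∀ t ∈ Icc s T₀, ∀ x y : PS2 T₀ μ₁ μ₂ ω ψ,
      |D2 x.1 t - D2 y.1 t| ≤ ω s ^ 2 * Real.exp (ψ s) / s ^ 3 * dist x y := fun s hs t ht x y =>
    PS2.abs_D2_sub_le hω hω' hψ' x y hs ht
  have hhalf : ∀ t ∈ Ioc 0 T₀, t / 2 ∈ Ioo 0 T₀ ∧ t ∈ Icc (t / 2) T₀ := fun t ht =>
    ⟨⟨by linarith [ht.1], by linarith [ht.1, ht.2]⟩, by linarith [ht.1], ht.2⟩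
  obtain ⟨g, hg⟩ := exists_forall_tendsto_of_abs_sub_le hu (Φ := fun c => speedFun c.1)
    (S := Icc 0 T₀) fun t ht => ⟨_, k0 t ht⟩
  obtain ⟨g₁, hg₁⟩ := exists_forall_tendsto_of_abs_sub_le hu (Φ := fun c => D1 c.1)
    (S := Ioc 0 T₀) fun t ht => ⟨_, k1 _ (hhalf t ht).1 t (hhalf t ht).2⟩
  obtain ⟨g₂, hg₂⟩ := exists_forall_tendsto_of_abs_sub_le hu (Φ := fun c => D2 c.1)
    (S := Ioc 0 T₀) fun t ht => ⟨_, k2 _ (hhalf t ht).1 t (hhalf t ht).2⟩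
  have hsub : ∀ s ∈ Ioo 0 T₀, Icc s T₀ ⊆ Ioc 0 T₀ := fun s hs t ht => ⟨hs.1.trans_le ht.1, ht.2⟩
  have u0 := tendstoUniformlyOn_of_abs_sub_le hu (Φ := fun c => speedFun c.1) k0 hg
  have u1 : ∀ s ∈ Ioo 0 T₀, _ := fun s hs => tendstoUniformlyOn_of_abs_sub_le hu
    (Φ := fun c => D1 c.1) (k1 s hs) fun t ht => hg₁ t (hsub s hs ht)
  have u2 : ∀ s ∈ Ioo 0 T₀, _ := fun s hs => tendstoUniformlyOn_of_abs_sub_le hu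
    (Φ := fun c => D2 c.1) (k2 s hs) fun t ht => hg₂ t (hsub s hs ht)
  obtain ⟨c, e0, e1, e2⟩ := PS2.exists_of_hasDerivWithinAt (μ₁ := μ₁) (μ₂ := μ₂) (ω := ω) (ψ := ψ)
    (u0.continuousOn (Frequently.of_forall fun n => continuousOn_speedFun _))
    (fun t ht => hasDerivWithinAt_Ioc_of_tendstoUniformlyOn hT
      (fun n t ht => PS2.hasDerivWithinAt_speedFun (u n) ht) u1
      (fun t ht => hg t (Ioc_subset_Icc_self ht)) ht)
    (fun t ht => hasDerivWithinAt_Ioc_of_tendstoUniformlyOn hT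
      (fun n t ht => PS2.hasDerivWithinAt_D1 (u n) ht) u2 hg₁ ht)
    (continuousOn_Ioc_of_tendstoUniformlyOn hT (fun n => PS2.continuousOn_D2 (u n)) u2)
    (fun t ht => ⟨ge_of_tendsto' (hg t (Ioo_subset_Icc_self ht)) fun n => ((u n).2.2.1 t ht).1,
      le_of_tendsto' (hg t (Ioo_subset_Icc_self ht)) fun n => ((u n).2.2.1 t ht).2⟩)
    (fun t ht => le_of_tendsto' (hg₁ t ht).abs fun n => (u n).2.2.2.1 t ht)
    (fun t ht => le_of_tendsto' (hg₂ t ht).abs fun n => (u n).2.2.2.2 t ht)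
  refine ⟨c, Metric.tendsto_atTop.2 fun ε hε => ?_⟩
  obtain ⟨N, hN⟩ := Metric.cauchySeq_iff.1 hu (ε / 4) (by positivity)
  refine ⟨N, fun n hn => ?_⟩
  have hev : ∀ᶠ m in atTop, PS2.d (u n) (u m) ≤ ε / 4 := by
    filter_upwards [eventually_ge_atTop N] with m hm
    exact (hN n hn m hm).le
  -- The derivatives need not converge uniformly up to `0`; the limit `m → ∞` is taken pointwise, at
  -- fixed `t`, in the weighted bounds for `u n` and `u m`.
  have : PS2.d (u n) c ≤ ε / 4 + ε / 4 + ε / 4 := by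
    refine PS2.d_le hT (fun t ht => ?_) (fun t ht => ?_) (fun t ht => ?_)
    · have ht' := Ioo_subset_Icc_self ht
      rw [e0 t ht']
      refine le_of_tendsto ((hg t ht').const_sub _).abs ?_
      filter_upwards [hev] with m hm
      exact (PS2.le_d hω (u n) (u m) ht).1.trans hm
    · have ht' := Ioo_subset_Ioc_self ht
      rw [e1 t ht']
      refine le_of_tendsto (((hg₁ t ht').const_sub _).abs.const_mul _) ?_
      filter_upwards [hev] with m hm
      exact (PS2.le_d hω (u n) (u m) ht).2.1.trans hm
    · have ht' := Ioo_subset_Ioc_self ht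
      rw [e2 t ht']
      refine le_of_tendsto (((hg₂ t ht').const_sub _).abs.const_mul _) ?_
      filter_upwards [hev] with m hm
      exact (PS2.le_d hω (u n) (u m) ht).2.2.trans hm
  exact this.trans_lt (by linarith)

end Speeds

/-! ## Choice of the time scale -/

/-- Let `g t = ω t * exp (ψ t) / t` and let `B` be the first point of a dyadic sequence with `x ≤ g
B`, so that `g (2 * B) < x`. The second inequality gives `L ≥ 1 + ψ (2 * B)` for the logarithm `L`
in the statement. Moreover `log x ≤ L + log ω + |log r|` at `r = 2 * B`, and `K` times each summand
is at most a third of `ω * L`: the first two because `ω` is large, the third because `ω ψ / |log r|`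
is. Dyadic points make continuity of `ω` and `ψ` unnecessary. -/
theorem exists_time_scale {T₀ : ℝ} {ω ψ : ℝ → ℝ} (hT₀ : 0 < T₀)
    (hω_pos : ∀ t ∈ Ioc 0 T₀, 0 < ω t) (hψ_pos : ∀ t ∈ Ioc 0 T₀, 0 < ψ t)
    (hω_lim : Tendsto ω (𝓝[>] 0) atTop)
    (hωψ_lim : Tendsto (fun t => ω t * ψ t / |Real.log t|) (𝓝[>] 0) atTop)
    {K τ : ℝ} (hK : 0 ≤ K) (hτ : 0 < τ) :
    ∃ Λ, ∀ x ≥ Λ, ∃ B > 0, 2 * B < τ ∧ 2 * B ≤ T₀ ∧ 24 ≤ ω (2 * B) ∧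
      x ≤ ω B * Real.exp (ψ B) / B ∧ 1 ≤ Real.log (6 * B * x / ω (2 * B)) ∧
      K * Real.log x ≤ ω (2 * B) * Real.log (6 * B * x / ω (2 * B)) := by
  have hlog : ∀ᶠ y in atTop, 3 * K * Real.log y ≤ y := by
    have := (Real.isLittleO_log_id_atTop.const_mul_left (3 * K)).bound one_pos
    filter_upwards [this, eventually_ge_atTop 0] with y hy hy0
    simp only [id, one_mul, Real.norm_eq_abs, abs_of_nonneg hy0] at hy
    exact (le_abs_self _).trans hy
  have hev : ∀ᶠ r in 𝓝[>] (0 : ℝ), 3 * K ≤ ω r ∧ 24 ≤ ω r ∧ 3 * K * Real.log (ω r) ≤ ω r ∧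
      3 * K * |Real.log r| ≤ ω r * ψ r ∧ r < τ := by
    filter_upwards [hω_lim.eventually_ge_atTop (3 * K), hω_lim.eventually_ge_atTop 24,
      hω_lim.eventually hlog, hωψ_lim.eventually_ge_atTop (3 * K), Ioo_mem_nhdsGT hτ,
      Ioo_mem_nhdsGT one_pos] with r h1 h2 h3 h4 h5 h6
    have : 0 < |Real.log r| := abs_pos.2 (Real.log_neg h6.1 h6.2).ne
    exact ⟨h1, h2, h3, (le_div_iff₀ this).1 h4, h5.2⟩
  obtain ⟨r₀, hr₀, hr⟩ := mem_nhdsGT_iff_exists_Ioo_subset.1 hev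
  have hr₀ : 0 < r₀ := hr₀
  set R := min T₀ (r₀ / 2) with hR
  have hR0 : 0 < R := by positivity
  let g : ℝ → ℝ := fun t => ω t * Real.exp (ψ t) / t
  let D : ℕ → ℝ := fun j => R / 2 ^ j
  have hD0 : ∀ j, 0 < D j := fun j => by positivity
  have hDR : ∀ j, D j ≤ R := fun j => div_le_self hR0.le (one_le_pow₀ one_le_two)
  have hDT : ∀ j, D j ∈ Ioc 0 T₀ := fun j => ⟨hD0 j, (hDR j).trans (min_le_left _ _)⟩
  have hDr : ∀ j, D j ∈ Ioo 0 r₀ := fun j =>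
    ⟨hD0 j, ((hDR j).trans (min_le_right _ _)).trans_lt (by linarith)⟩
  have hDlim : Tendsto D atTop (𝓝[>] 0) := by
    refine tendsto_nhdsWithin_iff.2 ⟨?_, Eventually.of_forall hD0⟩
    have := (tendsto_pow_atTop_nhds_zero_of_lt_one (r := (1 / 2 : ℝ)) (by norm_num)
      (by norm_num)).const_mul R
    simpa [D, div_eq_mul_inv] using this
  have hglim : Tendsto (fun j => g (D j)) atTop atTop := by
    have h1 := (hω_lim.comp hDlim).const_mul_atTop (inv_pos.2 hR0)
    refine tendsto_atTop_mono (fun j => ?_) h1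
    have hw := hω_pos _ (hDT j)
    have he : 1 ≤ Real.exp (ψ (D j)) := Real.one_le_exp (hψ_pos _ (hDT j)).le
    simp only [g, Function.comp]
    rw [inv_mul_eq_div]
    have := hD0 j
    exact div_le_div₀ (by positivity) (by nlinarith) this (hDR j)
  -- This threshold excludes index `0`, so the first good dyadic point has a predecessor, which
  -- serves as `2 * B`.
  refine ⟨g (D 0) + 1, fun x hx => ?_⟩
  have hex : ∃ j, x ≤ g (D j) := (hglim.eventually_ge_atTop x).exists
  classical
  obtain ⟨i, hi⟩ : ∃ i, Nat.find hex = i + 1 := by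
    refine Nat.exists_eq_succ_of_ne_zero fun h => ?_
    have := Nat.find_spec hex
    rw [h] at this
    linarith
  have h1 : x ≤ g (D (i + 1)) := hi ▸ Nat.find_spec hex
  have h2 : g (D i) < x := not_le.1 (Nat.find_min hex (by omega))
  have hDi : 2 * D (i + 1) = D i := by
    simp only [D, pow_succ]
    field_simp
  obtain ⟨c1, c2, c3, c4, c5⟩ := hr (hDr i)
  refine ⟨D (i + 1), hD0 _, ?_⟩
  rw [hDi]
  have hB : D (i + 1) = D i / 2 := by linarith
  have hr0 := hD0 i
  have hψ := hψ_pos _ (hDT i)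
  have hgW : ω (D i) * Real.exp (ψ (D i)) / D i < x := h2
  set r := D i
  set W := ω r
  have hW : 0 < W := by linarith
  have hx0 : 0 < x := lt_trans (by positivity) hgW
  set L := Real.log (6 * D (i + 1) * x / W) with hL
  -- Here `6 * B * x / W = 3 * r * x / W > 3 * exp (ψ r)`, and `3 > e`.
  have hLψ : 1 + ψ r ≤ L := by
    rw [hL, Real.le_log_iff_exp_le (by rw [hB]; positivity), hB, le_div_iff₀ hW, Real.exp_add]
    rw [div_lt_iff₀ hr0] at hgW
    have := Real.exp_one_lt_d9
    have h3 : 0 < Real.exp (ψ r) * W := by positivity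
    nlinarith
  have hlogx : Real.log x ≤ L + Real.log W + |Real.log r| := by
    rw [hL, hB, Real.log_div (by positivity) hW.ne',
      show 6 * (r / 2) * x = 3 * (r * x) by ring, Real.log_mul (by norm_num) (by positivity),
      Real.log_mul hr0.ne' hx0.ne']
    have := Real.log_nonneg (show (1 : ℝ) ≤ 3 by norm_num)
    have := neg_abs_le (Real.log r)
    linarith
  refine ⟨c5, (hDT i).2, c2, h1, by linarith, ?_⟩
  have := mul_le_mul_of_nonneg_left hlogx hK
  nlinarith

/-! ## A resonant perturbation of a constant coefficient -/

theorem hasDerivAt_eq_zero_of_eventually {f : ℝ → ℝ} {f' t : ℝ} (h : HasDerivAt f f' t)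
    (h0 : ∀ᶠ x in 𝓝 t, f x = 0) : f' = 0 :=
  h.unique ((hasDerivAt_const t (0 : ℝ)).congr_of_eventuallyEq h0)

theorem hasDerivAt_eq_zero_of_isOpen {f f' : ℝ → ℝ} {U : Set ℝ} (hU : IsOpen U)
    (h : ∀ t, HasDerivAt f (f' t) t) (h0 : ∀ t ∈ U, f t = 0) : ∀ t ∈ U, f' t = 0 := fun t ht =>
  hasDerivAt_eq_zero_of_eventually (h t) (by
    filter_upwards [hU.mem_nhds ht] with x hx
    exact h0 x hx)

/-- A smooth function that vanishes for `x ≤ 1` and equals `1/x` for `x ≥ 2`. -/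
def cutInv (x : ℝ) : ℝ := Real.smoothTransition (x - 1) * x⁻¹

open scoped ContDiff in
theorem contDiff_cutInv : ContDiff ℝ ∞ cutInv := by
  rw [contDiff_iff_contDiffAt]
  intro x
  rcases lt_or_ge x 1 with hx | hx
  · refine (contDiffAt_const (c := (0 : ℝ))).congr_of_eventuallyEq ?_
    filter_upwards [Iio_mem_nhds hx] with y hy
    rw [cutInv, Real.smoothTransition.zero_of_nonpos (by linarith [show y < 1 from hy]), zero_mul]
  · have h1 : ContDiffAt ℝ ∞ (fun y : ℝ => Real.smoothTransition (y - 1)) x :=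
      (Real.smoothTransition.contDiff.comp (contDiff_id.sub contDiff_const)).contDiffAt
    exact h1.mul (contDiffAt_inv ℝ (by linarith))

/-- Compactness handles `[0, 2]`; beyond `2` the function is `x⁻¹`, whose derivatives have exactly
this size. -/
theorem iteratedDeriv_cutInv_bound (j : ℕ) :
    ∃ C, ∀ x > 0, |iteratedDeriv j cutInv x| ≤ C / x ^ (j + 1) := by
  obtain ⟨C, hC⟩ := (isCompact_Icc (a := (0 : ℝ)) (b := 2)).exists_bound_of_continuousOn
    (contDiff_cutInv.continuous_iteratedDeriv j (by exact_mod_cast le_top)).continuousOn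
  refine ⟨max (|C| * 2 ^ (j + 1)) (j.factorial), fun x hx => ?_⟩
  rw [le_div_iff₀ (by positivity)]
  rcases le_or_gt x 2 with h | h
  · refine le_trans ?_ (le_max_left _ _)
    have := (hC x ⟨hx.le, h⟩).trans (le_abs_self C)
    rw [Real.norm_eq_abs] at this
    gcongr
  · refine le_trans (le_of_eq ?_) (le_max_right _ _)
    have he : cutInv =ᶠ[𝓝 x] fun y => y⁻¹ := by
      filter_upwards [Ioi_mem_nhds h] with y hy
      rw [cutInv, Real.smoothTransition.one_of_one_le (by linarith [show 2 < y from hy]), one_mul]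
    rw [he.iteratedDeriv_eq, iteratedDeriv_eq_iterate, iter_deriv_inv, abs_mul, abs_mul, abs_pow, abs_neg,
      abs_one, one_pow, one_mul, Nat.abs_cast, abs_of_pos (by positivity)]
    rw [mul_assoc]
    have : x ^ (-1 - (j : ℤ)) * x ^ (j + 1) = 1 := by
      rw [← zpow_natCast, ← zpow_add₀ hx.ne']
      push_cast
      rw [show (-1 - (j : ℤ) + (j + 1)) = 0 by ring, zpow_zero]
    rw [this, mul_one]

theorem hasDerivAt_iteratedDeriv_cutInv (j : ℕ) (x : ℝ) :
    HasDerivAt (iteratedDeriv j cutInv) (iteratedDeriv (j + 1) cutInv x) x := by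
  rw [iteratedDeriv_succ]
  exact ((contDiff_cutInv.differentiable_iteratedDeriv j
    (by exact_mod_cast WithTop.coe_lt_top _)) x).hasDerivAt

/-- A profile `h` that equals `1/t` in `[2a,b]` and is supported in `[a,2b]`, with its derivatives. -/
theorem exists_profile : ∃ C ≥ (1 : ℝ), ∀ a b : ℝ, 0 < a → 2 * a ≤ b → ∃ h : ℕ → ℝ → ℝ,
    (∀ j t, HasDerivAt (h j) (h (j + 1) t) t) ∧ (∀ t ≤ a, h 0 t = 0) ∧
    (∀ t ≥ 2 * b, h 0 t = 0) ∧ (∀ t ∈ Icc (2 * a) b, h 0 t = 1 / t) ∧ (∀ t, 0 ≤ h 0 t) ∧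
    ∀ j ≤ 3, ∀ t > 0, |h j t| ≤ C / t ^ (j + 1) := by
  choose C hC using iteratedDeriv_cutInv_bound
  let M : ℝ := ∑ j ∈ Finset.range 4, |C j|
  have hM : ∀ j ≤ 3, C j ≤ M := fun j hj => (le_abs_self _).trans
    (Finset.single_le_sum (f := fun j => |C j|) (fun _ _ => abs_nonneg _)
      (Finset.mem_range.2 (by omega)))
  have hM0 : 0 ≤ M := Finset.sum_nonneg fun _ _ => abs_nonneg _
  refine ⟨1 + 2 * M, by linarith, fun a b ha hab => ?_⟩
  have hb : 0 < b := by linarith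
  -- The profile is the difference of the dilates of `cutInv` at scales `a` and `b`: each equals `1
  -- / t` from twice its scale on, so the tails cancel beyond `2 * b`. Scale invariance keeps the
  -- constant in the bounds independent of `a` and `b`.
  let f : ℝ → ℕ → ℝ → ℝ := fun a j t => iteratedDeriv j cutInv (t / a) / a ^ (j + 1)
  have hf : ∀ a > 0, ∀ j t, HasDerivAt (f a j) (f a (j + 1) t) t := by
    intro a ha j t
    have h1 := ((hasDerivAt_iteratedDeriv_cutInv j (t / a)).comp t
      ((hasDerivAt_id t).div_const a)).div_const (a ^ (j + 1))
    refine h1.congr_deriv ?_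
    simp only [f]
    field_simp
    ring
  have hfb : ∀ a > 0, ∀ j ≤ 3, ∀ t > 0, |f a j t| ≤ M / t ^ (j + 1) := by
    intro a ha j hj t ht
    have h1 := hC j (t / a) (by positivity)
    simp only [f]
    rw [abs_div, abs_of_pos (by positivity : 0 < a ^ (j + 1)), div_le_iff₀ (by positivity)]
    refine h1.trans ?_
    rw [div_pow, div_div_eq_mul_div, div_mul_eq_mul_div]
    have := hM j hj
    gcongr
  have hf0 : ∀ a > 0, ∀ t, f a 0 t = Real.smoothTransition (t / a - 1) * t⁻¹ := by
    intro a ha t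
    simp only [f, iteratedDeriv_zero, cutInv, zero_add, pow_one]
    rw [inv_div]
    field_simp
  have hmain : ∀ t, f a 0 t - f b 0 t =
      (Real.smoothTransition (t / a - 1) - Real.smoothTransition (t / b - 1)) * t⁻¹ := fun t => by
    rw [hf0 a ha, hf0 b hb, sub_mul]
  have hzero : ∀ c > 0, ∀ t ≤ c, Real.smoothTransition (t / c - 1) = 0 := fun c hc t ht =>
    Real.smoothTransition.zero_of_nonpos (by
      have := (div_le_one hc).2 ht
      linarith)
  have hone : ∀ c > 0, ∀ t ≥ 2 * c, Real.smoothTransition (t / c - 1) = 1 := fun c hc t ht =>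
    Real.smoothTransition.one_of_one_le (by
      have := (le_div_iff₀ hc).2 ht
      linarith)
  refine ⟨fun j t => f a j t - f b j t, fun j t => (hf a ha j t).sub (hf b hb j t),
    fun t ht => ?_, fun t ht => ?_, fun t ht => ?_, fun t => ?_, fun j hj t ht => ?_⟩
  · refine (hmain t).trans ?_
    rw [hzero a ha t ht, hzero b hb t (by linarith)]
    simp
  · refine (hmain t).trans ?_
    rw [hone a ha t (by linarith), hone b hb t ht]
    simp
  · refine (hmain t).trans ?_
    rw [hone a ha t ht.1, hzero b hb t ht.2]
    simp
  · refine le_of_le_of_eq ?_ (hmain t).symm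
    rcases le_or_gt t 0 with h | h
    · rw [hzero a ha t (by linarith), hzero b hb t (by linarith)]
      simp
    · refine mul_nonneg (sub_nonneg.2 (Real.smoothTransition.monotone ?_)) (by positivity)
      have : t / b ≤ t / a := by gcongr; linarith
      linarith
  · refine (abs_sub _ _).trans ?_
    have h1 := hfb a ha j hj t ht
    have h2 := hfb b hb j hj t ht
    have h3 : (1 + 2 * M) / t ^ (j + 1) = 1 / t ^ (j + 1) + (M / t ^ (j + 1) + M / t ^ (j + 1)) := by
      ring
    have h4 : 0 ≤ 1 / t ^ (j + 1) := by positivity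
    linarith

/-! ### The explicit resonant coefficient and its growing solution. -/

section Resonance

variable (s x : ℝ) (p : ℕ → ℝ → ℝ)

/-- With `θ = s x t`, the function `w = sin θ · exp (∫ p sin² θ) / (s x)` solves
`w'' + x² (s² - q) w = 0` for this `q`. -/
def resonance (t : ℝ) : ℝ :=
  (4 * (s * x) * p 0 t * (Real.sin (s * x * t) * Real.cos (s * x * t)) +
    p 1 t * Real.sin (s * x * t) ^ 2 + p 0 t ^ 2 * Real.sin (s * x * t) ^ 4) / x ^ 2

/-- The first derivative of `resonance`. -/
def resonance₁ (t : ℝ) : ℝ :=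
  (6 * (s * x) * p 1 t * (Real.sin (s * x * t) * Real.cos (s * x * t)) +
    4 * (s * x) ^ 2 * p 0 t * (Real.cos (s * x * t) ^ 2 - Real.sin (s * x * t) ^ 2) +
    p 2 t * Real.sin (s * x * t) ^ 2 + 2 * (p 0 t * p 1 t) * Real.sin (s * x * t) ^ 4 +
    4 * (s * x) * p 0 t ^ 2 * (Real.sin (s * x * t) ^ 3 * Real.cos (s * x * t))) / x ^ 2

/-- The second derivative of `resonance`. -/
def resonance₂ (t : ℝ) : ℝ :=
  (8 * (s * x) * p 2 t * (Real.sin (s * x * t) * Real.cos (s * x * t)) +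
    10 * (s * x) ^ 2 * p 1 t * (Real.cos (s * x * t) ^ 2 - Real.sin (s * x * t) ^ 2) -
    16 * (s * x) ^ 3 * p 0 t * (Real.sin (s * x * t) * Real.cos (s * x * t)) +
    p 3 t * Real.sin (s * x * t) ^ 2 +
    2 * (p 1 t ^ 2 + p 0 t * p 2 t) * Real.sin (s * x * t) ^ 4 +
    16 * (s * x) * (p 0 t * p 1 t) * (Real.sin (s * x * t) ^ 3 * Real.cos (s * x * t)) +
    4 * (s * x) ^ 2 * p 0 t ^ 2 * (3 * (Real.sin (s * x * t) ^ 2 * Real.cos (s * x * t) ^ 2) -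
      Real.sin (s * x * t) ^ 4)) / x ^ 2

theorem hasDerivAt_sin_mul (m t : ℝ) :
    HasDerivAt (fun t => Real.sin (m * t)) (m * Real.cos (m * t)) t := by
  have := ((hasDerivAt_id t).const_mul m).sin
  simpa [mul_comm] using this

theorem hasDerivAt_cos_mul (m t : ℝ) :
    HasDerivAt (fun t => Real.cos (m * t)) (-(m * Real.sin (m * t))) t := by
  have := ((hasDerivAt_id t).const_mul m).cos
  simpa [mul_comm] using this

variable {s x p}

theorem hasDerivAt_resonance (hp : ∀ j t, HasDerivAt (p j) (p (j + 1) t) t) (t : ℝ) :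
    HasDerivAt (resonance s x p) (resonance₁ s x p t) t := by
  have hS := hasDerivAt_sin_mul (s * x) t
  have hC := hasDerivAt_cos_mul (s * x) t
  have h := ((((hp 0 t).const_mul (4 * (s * x))).mul (hS.mul hC)).add
    ((hp 1 t).mul (hS.pow 2))).add (((hp 0 t).pow 2).mul (hS.pow 4))
  refine (h.div_const (x ^ 2)).congr_deriv ?_
  simp only [resonance₁, Pi.mul_apply, Pi.pow_apply]
  push_cast
  ring

theorem hasDerivAt_resonance₁ (hp : ∀ j t, HasDerivAt (p j) (p (j + 1) t) t) (t : ℝ) :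
    HasDerivAt (resonance₁ s x p) (resonance₂ s x p t) t := by
  have hS := hasDerivAt_sin_mul (s * x) t
  have hC := hasDerivAt_cos_mul (s * x) t
  have h := ((((((hp 1 t).const_mul (6 * (s * x))).mul (hS.mul hC)).add
    (((hp 0 t).const_mul (4 * (s * x) ^ 2)).mul ((hC.pow 2).sub (hS.pow 2)))).add
    ((hp 2 t).mul (hS.pow 2))).add ((((hp 0 t).mul (hp 1 t)).const_mul 2).mul (hS.pow 4))).add
    ((((hp 0 t).pow 2).const_mul (4 * (s * x))).mul ((hS.pow 3).mul hC))
  refine (h.div_const (x ^ 2)).congr_deriv ?_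
  simp only [resonance₂, Pi.mul_apply, Pi.pow_apply, Pi.sub_apply]
  push_cast
  ring

theorem continuous_resonance₂ (hp : ∀ j t, HasDerivAt (p j) (p (j + 1) t) t) :
    Continuous (resonance₂ s x p) := by
  have hc : ∀ j, Continuous (p j) := fun j =>
    continuous_iff_continuousAt.2 fun t => (hp j t).continuousAt
  have h0 := hc 0
  have h1 := hc 1
  have h2 := hc 2
  have h3 := hc 3
  unfold resonance₂
  fun_prop

theorem abs_mul_le_of_abs_le_one {y z Y : ℝ} (hy : |y| ≤ Y) (hz : |z| ≤ 1) : |y * z| ≤ Y := by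
  rw [abs_mul]
  exact (mul_le_of_le_one_right (abs_nonneg _) hz).trans hy

theorem abs_mul_le_mul_of_abs_le {y z Y Z : ℝ} (hy : |y| ≤ Y) (hz : |z| ≤ Z) :
    |y * z| ≤ Y * Z := by
  rw [abs_mul]
  exact mul_le_mul hy hz (abs_nonneg _) ((abs_nonneg _).trans hy)

/-- Each differentiation costs a factor `x`, whether it falls on the trigonometric factors or on
`p`. The quadratic terms in `p` are reduced to linear ones by `Y ≤ x`. The constant `64` dominates
the coefficient of each power of `s` in the three sums. -/
theorem abs_resonance_le (hs : 0 < s) (hx : 0 < x) {Y t : ℝ} (hYx : Y ≤ x)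
    (h0 : |p 0 t| ≤ Y) (h1 : |p 1 t| ≤ Y * x) (h2 : |p 2 t| ≤ Y * x ^ 2)
    (h3 : |p 3 t| ≤ Y * x ^ 3) :
    |resonance s x p t| ≤ 64 * (1 + s) ^ 3 * (Y / x) ∧
    |resonance₁ s x p t| ≤ 64 * (1 + s) ^ 3 * Y ∧
    |resonance₂ s x p t| ≤ 64 * (1 + s) ^ 3 * (Y * x) := by
  have hY : 0 ≤ Y := (abs_nonneg _).trans h0
  have hS := Real.abs_sin_le_one (s * x * t)
  have hC := Real.abs_cos_le_one (s * x * t)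
  have hSC := Real.sin_sq_add_cos_sq (s * x * t)
  set S := Real.sin (s * x * t) with hSd
  set C := Real.cos (s * x * t) with hCd
  have hpow : ∀ n, |S ^ n| ≤ 1 := fun n => by
    rw [abs_pow]
    exact pow_le_one₀ (abs_nonneg _) hS
  have hSC1 : |S * C| ≤ 1 := abs_mul_le_of_abs_le_one hS hC
  have hSC3 : |S ^ 3 * C| ≤ 1 := abs_mul_le_of_abs_le_one (hpow 3) hC
  have hdiff : |C ^ 2 - S ^ 2| ≤ 1 := abs_le.2 ⟨by nlinarith [sq_nonneg C], by nlinarith [sq_nonneg S]⟩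
  have hlast : |(3 * (S ^ 2 * C ^ 2) - S ^ 4) / 4| ≤ 1 := by
    have : C ^ 2 = 1 - S ^ 2 := by linarith
    rw [this]
    have a0 := sq_nonneg S
    have a1 : S ^ 2 ≤ 1 := by nlinarith [sq_nonneg C]
    refine abs_le.2 ⟨?_, ?_⟩ <;> nlinarith
  have q00 : |p 0 t ^ 2| ≤ Y * x := by
    rw [pow_two]
    exact (abs_mul_le_mul_of_abs_le h0 h0).trans (mul_le_mul_of_nonneg_left hYx hY)
  have q01 : |p 0 t * p 1 t| ≤ Y * x ^ 2 := by
    refine (abs_mul_le_mul_of_abs_le h0 h1).trans ?_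
    have := mul_le_mul_of_nonneg_left hYx (by positivity : 0 ≤ Y * x)
    linarith
  have q02 : |p 0 t * p 2 t| ≤ Y * x ^ 3 := by
    refine (abs_mul_le_mul_of_abs_le h0 h2).trans ?_
    have := mul_le_mul_of_nonneg_left hYx (by positivity : 0 ≤ Y * x ^ 2)
    linarith
  have q11 : |p 1 t ^ 2| ≤ Y * x ^ 3 := by
    rw [pow_two]
    refine (abs_mul_le_mul_of_abs_le h1 h1).trans ?_
    have := mul_le_mul_of_nonneg_left hYx (by positivity : 0 ≤ Y * x ^ 2)
    linarith
  have q12 : |p 1 t ^ 2 + p 0 t * p 2 t| ≤ 2 * (Y * x ^ 3) :=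
    (abs_add_le _ _).trans (by linarith)
  have hcoef : ∀ {k y Z : ℝ}, 0 ≤ k → |y| ≤ Z → |k * y| ≤ k * Z := fun hk hy => by
    rw [abs_mul, abs_of_nonneg hk]
    exact mul_le_mul_of_nonneg_left hy hk
  have hs3 : 1 + s + s ^ 2 + s ^ 3 ≤ (1 + s) ^ 3 := by nlinarith [sq_nonneg s]
  have hfin : ∀ {y Z : ℝ}, |y| ≤ 64 * (1 + s + s ^ 2 + s ^ 3) * Z → 0 ≤ Z →
      |y| ≤ 64 * (1 + s) ^ 3 * Z := fun hy hZ => hy.trans (by gcongr)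
  refine ⟨?_, ?_, ?_⟩
  · rw [resonance, abs_div, abs_of_pos (by positivity : 0 < x ^ 2), div_le_iff₀ (by positivity),
      show 64 * (1 + s) ^ 3 * (Y / x) * x ^ 2 = 64 * (1 + s) ^ 3 * (Y * x) by field_simp]
    refine hfin ?_ (by positivity)
    have t1 := abs_mul_le_of_abs_le_one (hcoef (by positivity : 0 ≤ 4 * (s * x)) h0) hSC1
    have t2 := abs_mul_le_of_abs_le_one h1 (hpow 2)
    have t3 := abs_mul_le_of_abs_le_one q00 (hpow 4)
    refine (abs_add_le _ _).trans ((add_le_add (abs_add_le _ _) le_rfl).trans ?_)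
    have u0 : 0 ≤ Y * x := by positivity
    have u1 : 0 ≤ s * (Y * x) := by positivity
    have u2 : 0 ≤ s ^ 2 * (Y * x) := by positivity
    have u3 : 0 ≤ s ^ 3 * (Y * x) := by positivity
    linarith
  · rw [resonance₁, abs_div, abs_of_pos (by positivity : 0 < x ^ 2), div_le_iff₀ (by positivity),
      show 64 * (1 + s) ^ 3 * Y * x ^ 2 = 64 * (1 + s) ^ 3 * (Y * x ^ 2) by ring]
    refine hfin ?_ (by positivity)
    have t1 := abs_mul_le_of_abs_le_one (hcoef (by positivity : 0 ≤ 6 * (s * x)) h1) hSC1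
    have t2 := abs_mul_le_of_abs_le_one (hcoef (by positivity : 0 ≤ 4 * (s * x) ^ 2) h0) hdiff
    have t3 := abs_mul_le_of_abs_le_one h2 (hpow 2)
    have t4 := abs_mul_le_of_abs_le_one (hcoef zero_le_two q01) (hpow 4)
    have t5 := abs_mul_le_of_abs_le_one (hcoef (by positivity : 0 ≤ 4 * (s * x)) q00) hSC3
    refine (abs_add_le _ _).trans ((add_le_add ((abs_add_le _ _).trans (add_le_add
      ((abs_add_le _ _).trans (add_le_add (abs_add_le _ _) le_rfl)) le_rfl)) le_rfl).trans ?_)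
    have u0 : 0 ≤ Y * x ^ 2 := by positivity
    have u1 : 0 ≤ s * (Y * x ^ 2) := by positivity
    have u2 : 0 ≤ s ^ 2 * (Y * x ^ 2) := by positivity
    have u3 : 0 ≤ s ^ 3 * (Y * x ^ 2) := by positivity
    linarith
  · rw [resonance₂, abs_div, abs_of_pos (by positivity : 0 < x ^ 2), div_le_iff₀ (by positivity),
      show 64 * (1 + s) ^ 3 * (Y * x) * x ^ 2 = 64 * (1 + s) ^ 3 * (Y * x ^ 3) by ring]
    refine hfin ?_ (by positivity)
    have t1 := abs_mul_le_of_abs_le_one (hcoef (by positivity : 0 ≤ 8 * (s * x)) h2) hSC1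
    have t2 := abs_mul_le_of_abs_le_one (hcoef (by positivity : 0 ≤ 10 * (s * x) ^ 2) h1) hdiff
    have t3 := abs_mul_le_of_abs_le_one (hcoef (by positivity : 0 ≤ 16 * (s * x) ^ 3) h0) hSC1
    have t4 := abs_mul_le_of_abs_le_one h3 (hpow 2)
    have t5 := abs_mul_le_of_abs_le_one (hcoef zero_le_two q12) (hpow 4)
    have t6 := abs_mul_le_of_abs_le_one (hcoef (by positivity : 0 ≤ 16 * (s * x)) q01) hSC3
    -- The trigonometric factor is only bounded by `4`; it is divided by `4` and the coefficient `4`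
    -- becomes `16`.
    have t7 := abs_mul_le_of_abs_le_one (hcoef (by positivity : 0 ≤ 16 * (s * x) ^ 2) q00) hlast
    rw [show 16 * (s * x) ^ 2 * p 0 t ^ 2 * ((3 * (S ^ 2 * C ^ 2) - S ^ 4) / 4) =
      4 * (s * x) ^ 2 * p 0 t ^ 2 * (3 * (S ^ 2 * C ^ 2) - S ^ 4) by ring] at t7
    refine (abs_add_le _ _).trans ((add_le_add ((abs_add_le _ _).trans (add_le_add
      ((abs_add_le _ _).trans (add_le_add ((abs_add_le _ _).trans (add_le_add
      ((abs_sub _ _).trans (add_le_add (abs_add_le _ _) le_rfl)) le_rfl)) le_rfl)) le_rfl))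
      le_rfl).trans ?_)
    have u0 : 0 ≤ Y * x ^ 3 := by positivity
    have u1 : 0 ≤ s * (Y * x ^ 3) := by positivity
    have u2 : 0 ≤ s ^ 2 * (Y * x ^ 3) := by positivity
    have u3 : 0 ≤ s ^ 3 * (Y * x ^ 3) := by positivity
    linarith

/-- The exponent of the growing solution. -/
def growth (s x : ℝ) (p : ℕ → ℝ → ℝ) (t : ℝ) : ℝ :=
  ∫ r in (0 : ℝ)..t, p 0 r * Real.sin (s * x * r) ^ 2

theorem hasDerivAt_growth (hc : Continuous (p 0)) (t : ℝ) :
    HasDerivAt (growth s x p) (p 0 t * Real.sin (s * x * t) ^ 2) t := by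
  have : Continuous fun r => p 0 r * Real.sin (s * x * r) ^ 2 := by fun_prop
  exact (this.integral_hasStrictDerivAt 0 t).hasDerivAt

theorem growth_zero : growth s x p 0 = 0 := by simp [growth]

/-- The solution is prescribed and `q` is read off from `w''`. The weight `sin²` in the exponent
makes `w''` divisible by `sin (s x t)`, so `q` has no singularity at the zeros of `w`. -/
theorem isModeSolution_resonance (hs : 0 < s) (hx : 0 < x)
    (hp : ∀ j t, HasDerivAt (p j) (p (j + 1) t) t) (T : ℝ) :
    IsModeSolution T (x ^ 2) (fun t => s ^ 2 - resonance s x p t)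
      (fun t => Real.exp (growth s x p t) * Real.sin (s * x * t) / (s * x))
      (fun t => Real.exp (growth s x p t) * (Real.cos (s * x * t) +
        p 0 t * Real.sin (s * x * t) ^ 3 / (s * x))) := by
  have hP := hasDerivAt_growth (s := s) (x := x)
    (continuous_iff_continuousAt.2 fun t => (hp 0 t).continuousAt)
  refine ⟨by simp, by simp [growth_zero], fun t _ => ⟨?_, ?_⟩⟩
  · have hS := hasDerivAt_sin_mul (s * x) t
    refine HasDerivAt.hasDerivWithinAt ((((hP t).exp.mul hS).div_const (s * x)).congr_deriv ?_)
    field_simp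
    ring
  · have hS := hasDerivAt_sin_mul (s * x) t
    have hC := hasDerivAt_cos_mul (s * x) t
    refine HasDerivAt.hasDerivWithinAt (((hP t).exp.mul (hC.add
      (((hp 0 t).mul (hS.pow 3)).div_const (s * x)))).congr_deriv ?_)
    simp only [resonance, Pi.mul_apply, Pi.pow_apply, Pi.add_apply]
    push_cast
    field_simp
    ring

theorem growth_monotone (hp : ∀ j t, HasDerivAt (p j) (p (j + 1) t) t) (h0 : ∀ t, 0 ≤ p 0 t) :
    Monotone (growth s x p) := by
  have hP := hasDerivAt_growth (s := s) (x := x)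
    (continuous_iff_continuousAt.2 fun t => (hp 0 t).continuousAt)
  refine monotone_of_deriv_nonneg (fun t => (hP t).differentiableAt) fun t => ?_
  rw [(hP t).deriv]
  exact mul_nonneg (h0 t) (sq_nonneg _)

/-- As `sin²` has mean `1 / 2`, the integral of `k / t * sin²` is `k / 2 * log` up to an oscillating
term, which is integrated by parts and costs a multiple of `k / (s x a)`. -/
theorem le_growth {a b k : ℝ} (hs : 0 < s) (hx : 0 < x) (ha : 0 < a) (hab : 2 * a ≤ b) (hk : 0 ≤ k)
    (hp : ∀ j t, HasDerivAt (p j) (p (j + 1) t) t) (h0 : ∀ t, 0 ≤ p 0 t)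
    (hk' : ∀ t ∈ Icc (2 * a) b, p 0 t = k / t) :
    k / 2 * Real.log (b / (2 * a)) - k / (4 * (s * x) * a) ≤ growth s x p b := by
  have hP := hasDerivAt_growth (s := s) (x := x)
    (continuous_iff_continuousAt.2 fun t => (hp 0 t).continuousAt)
  set m := s * x with hm
  have hm0 : 0 < m := by positivity
  -- The correction is the boundary term of the integration by parts, with an extra `-1` chosen so
  -- that the remainder has a sign: the derivative becomes `k / (4 m t²) * (sin - cos)²`.
  let M : ℝ → ℝ := fun t => growth s x p t - k / 2 * Real.log t +
    k / (4 * m) * (2 * (Real.sin (m * t) * Real.cos (m * t)) - 1) * t⁻¹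
  have hM : ∀ t > 0, HasDerivAt M (p 0 t * Real.sin (m * t) ^ 2 - k / 2 * t⁻¹ +
      (k / (4 * m) * (2 * (m * Real.cos (m * t) * Real.cos (m * t) +
        Real.sin (m * t) * -(m * Real.sin (m * t)))) * t⁻¹ +
      k / (4 * m) * (2 * (Real.sin (m * t) * Real.cos (m * t)) - 1) * -(t ^ 2)⁻¹)) t := by
    intro t ht
    have hS := hasDerivAt_sin_mul m t
    have hC := hasDerivAt_cos_mul m t
    exact ((hP t).sub ((Real.hasDerivAt_log ht.ne').const_mul (k / 2))).add
      (((((hS.mul hC).const_mul 2).sub_const 1).const_mul (k / (4 * m))).mul (hasDerivAt_inv ht.ne'))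
  have h2a : 0 < 2 * a := by linarith
  have hmono : MonotoneOn M (Icc (2 * a) b) := by
    refine monotoneOn_of_hasDerivWithinAt_nonneg (convex_Icc _ _)
      (fun t ht => (hM t (h2a.trans_le ht.1)).continuousAt.continuousWithinAt)
      (fun t ht => (hM t (h2a.trans_le (interior_subset ht).1)).hasDerivWithinAt) fun t ht => ?_
    have ht' := interior_subset ht
    have ht0 : 0 < t := h2a.trans_le ht'.1
    rw [hk' t ht']
    have hSC := Real.sin_sq_add_cos_sq (m * t)
    set S := Real.sin (m * t)
    set C := Real.cos (m * t)
    have e : k / t * S ^ 2 - k / 2 * t⁻¹ + (k / (4 * m) * (2 * (m * C * C + S * -(m * S))) * t⁻¹ +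
        k / (4 * m) * (2 * (S * C) - 1) * -(t ^ 2)⁻¹) =
        k / (4 * m * t ^ 2) * (S - C) ^ 2 + (k / (2 * t) - k / (4 * m * t ^ 2)) *
          (S ^ 2 + C ^ 2 - 1) := by
      field_simp
      ring
    rw [e, hSC, sub_self, mul_zero, add_zero]
    positivity
  have hle := hmono (left_mem_Icc.2 hab) (right_mem_Icc.2 hab) hab
  have hg : 0 ≤ growth s x p (2 * a) := by
    rw [← growth_zero (s := s) (x := x) (p := p)]
    exact growth_monotone hp h0 h2a.le
  have hb : 0 < b := h2a.trans_le hab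
  have hsc : ∀ y : ℝ, |2 * (Real.sin y * Real.cos y)| ≤ 1 := fun y => by
    rw [← mul_assoc, ← Real.sin_two_mul]
    exact Real.abs_sin_le_one _
  have b1 : k / (4 * m) * (2 * (Real.sin (m * b) * Real.cos (m * b)) - 1) * b⁻¹ ≤ 0 := by
    have := (abs_le.1 (hsc (m * b))).2
    have h1 : 0 ≤ k / (4 * m) := by positivity
    have h2 : 0 ≤ b⁻¹ := by positivity
    exact mul_nonpos_of_nonpos_of_nonneg (mul_nonpos_of_nonneg_of_nonpos h1 (by linarith)) h2
  have b2 : -(k / (4 * m * a)) ≤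
      k / (4 * m) * (2 * (Real.sin (m * (2 * a)) * Real.cos (m * (2 * a))) - 1) * (2 * a)⁻¹ := by
    have := (abs_le.1 (hsc (m * (2 * a)))).1
    rw [show -(k / (4 * m * a)) = k / (4 * m) * (-2) * (2 * a)⁻¹ by field_simp]
    gcongr
    linarith
  rw [Real.log_div hb.ne' h2a.ne']
  simp only [M] at hle
  linarith

end Resonance

/-- A coefficient supported in `[a,2b]` which produces the growth
`exp (k log (b/2a))` of the energy at frequency `x`, when superposed to `s²`. -/
theorem exists_resonance {s : ℝ} (hs : 0 < s) : ∃ C ≥ (1 : ℝ), ∀ x a b k : ℝ, 0 < x → 0 < a →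
    2 * a ≤ b → 0 < k → 1 ≤ x * a → C * k ≤ x * a → ∃ q q₁ q₂ w w₁ : ℝ → ℝ,
    (∀ t, HasDerivAt q (q₁ t) t) ∧ (∀ t, HasDerivAt q₁ (q₂ t) t) ∧ Continuous q₂ ∧
    (∀ t < a, q t = 0 ∧ q₁ t = 0 ∧ q₂ t = 0) ∧
    (∀ t ≥ 2 * b, q t = 0 ∧ q₁ t = 0 ∧ q₂ t = 0) ∧
    (∀ t > 0, |q t| ≤ C * k / (x * a) ∧ |q₁ t| ≤ C * k / t ∧ |q₂ t| ≤ C * k * x / t) ∧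
    (∀ T, IsModeSolution T (x ^ 2) (fun t => s ^ 2 - q t) w w₁) ∧
    Real.exp (k * Real.log (b / (2 * a)) - k / (2 * (s * x) * a)) ≤
      w₁ (2 * b) ^ 2 + s ^ 2 * x ^ 2 * w (2 * b) ^ 2 := by
  obtain ⟨C, hC1, hC⟩ := exists_profile
  -- The constant combines the profile constant `C` with the one of `abs_resonance_le`.
  refine ⟨64 * (1 + s) ^ 3 * C, ?_, fun x a b k hx ha hab hk hxa hkx => ?_⟩
  · have : 1 ≤ (1 + s) ^ 3 := one_le_pow₀ (by linarith)
    nlinarith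
  have hC0 : 0 < C := by linarith
  obtain ⟨h, hd, hz, hz', hmid, hpos, hbd⟩ := hC a b ha hab
  have hb : 0 < b := by linarith
  let p : ℕ → ℝ → ℝ := fun j t => k * h j t
  have hp : ∀ j t, HasDerivAt (p j) (p (j + 1) t) t := fun j t => (hd j t).const_mul k
  have hzero : ∀ U : Set ℝ, IsOpen U → (∀ t ∈ U, h 0 t = 0) → ∀ j, ∀ t ∈ U, h j t = 0 := by
    intro U hU h0 j
    induction j with
    | zero => exact h0
    | succ j ih => exact hasDerivAt_eq_zero_of_isOpen hU (hd j) ih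
  have hpl : ∀ j, ∀ t < a, p j t = 0 := fun j t ht => by
    simp only [p, hzero (Iio a) isOpen_Iio (fun t ht => hz t (le_of_lt ht)) j t ht, mul_zero]
  have hpr : ∀ j, ∀ t ≥ 2 * b, p j t = 0 := by
    intro j t ht
    have h1 : ∀ t > 2 * b, p j t = 0 := fun t ht => by
      simp only [p, hzero (Ioi (2 * b)) isOpen_Ioi (fun t ht => hz' t (le_of_lt ht)) j t ht, mul_zero]
    have hc : Continuous (p j) := continuous_iff_continuousAt.2 fun t => (hp j t).continuousAt
    have : closure (Ioi (2 * b)) ⊆ {t | p j t = 0} :=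
      closure_minimal (fun t ht => h1 t ht) (isClosed_eq hc continuous_const)
    rw [closure_Ioi] at this
    exact this ht
  have hres0 : ∀ t, (∀ j, p j t = 0) →
      resonance s x p t = 0 ∧ resonance₁ s x p t = 0 ∧ resonance₂ s x p t = 0 := fun t ht => by
    simp [resonance, resonance₁, resonance₂, ht]
  refine ⟨resonance s x p, resonance₁ s x p, resonance₂ s x p, _, _, hasDerivAt_resonance hp,
    hasDerivAt_resonance₁ hp, continuous_resonance₂ hp, fun t ht => hres0 t fun j => hpl j t ht,
    fun t ht => hres0 t fun j => hpr j t ht, fun t ht => ?_, isModeSolution_resonance hs hx hp, ?_⟩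
  · rcases lt_or_ge t a with hta | hta
    · obtain ⟨e0, e1, e2⟩ := hres0 t fun j => hpl j t hta
      rw [e0, e1, e2, abs_zero]
      refine ⟨by positivity, by positivity, by positivity⟩
    · have hxt : 1 / t ≤ x := by
        rw [div_le_iff₀ ht]
        nlinarith
      have hYa : C * k / t ≤ C * k / a := by gcongr
      have hYx : C * k / t ≤ x := by
        rw [div_le_iff₀ ht]
        have : 1 ≤ (1 + s) ^ 3 := one_le_pow₀ (by linarith)
        have h2 : C * k ≤ 64 * (1 + s) ^ 3 * C * k := by
          have : 0 < C * k := by positivity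
          nlinarith
        nlinarith
      have hj : ∀ j ≤ 3, |p j t| ≤ C * k / t * x ^ j := by
        intro j hj
        have h1 := hbd j hj t ht
        simp only [p]
        rw [abs_mul, abs_of_pos hk]
        calc k * |h j t| ≤ k * (C / t ^ (j + 1)) := mul_le_mul_of_nonneg_left h1 hk.le
          _ = C * k / t * (1 / t) ^ j := by
              rw [pow_succ, div_pow, one_pow]
              field_simp
          _ ≤ _ := by gcongr
      have key := abs_resonance_le hs hx hYx (by simpa using hj 0 (by omega))
        (by simpa using hj 1 (by omega)) (hj 2 (by omega)) (hj 3 (by omega))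
      refine ⟨key.1.trans ?_, key.2.1.trans (le_of_eq ?_), key.2.2.trans (le_of_eq ?_)⟩
      · calc _ ≤ 64 * (1 + s) ^ 3 * (C * k / a / x) := by gcongr
          _ = _ := by field_simp
      · ring
      · ring
  · have hge := le_growth (s := s) (x := x) (p := p) hs hx ha hab hk.le hp
      (fun t => mul_nonneg hk.le (hpos t)) fun t ht => by
        simp only [p, hmid t ht, mul_one_div]
    have hmono := growth_monotone (s := s) (x := x) hp (fun t => mul_nonneg hk.le (hpos t))
      (by linarith : b ≤ 2 * b)
    have hSC := Real.sin_sq_add_cos_sq (s * x * (2 * b))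
    -- At `2 * b` the profile vanishes, and `sin² + cos² = 1` makes the energy exactly `exp (2 *
    -- growth)`.
    have e : (Real.exp (growth s x p (2 * b)) * (Real.cos (s * x * (2 * b)) +
        p 0 (2 * b) * Real.sin (s * x * (2 * b)) ^ 3 / (s * x))) ^ 2 + s ^ 2 * x ^ 2 *
        (Real.exp (growth s x p (2 * b)) * Real.sin (s * x * (2 * b)) / (s * x)) ^ 2 =
        Real.exp (2 * growth s x p (2 * b)) := by
      rw [hpr 0 _ le_rfl, two_mul (growth s x p (2 * b)), Real.exp_add, zero_mul, zero_div, add_zero]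
      rw [show s ^ 2 * x ^ 2 * (Real.exp (growth s x p (2 * b)) * Real.sin (s * x * (2 * b)) /
        (s * x)) ^ 2 = (Real.exp (growth s x p (2 * b)) * Real.sin (s * x * (2 * b))) ^ 2 by
          field_simp]
      linear_combination Real.exp (growth s x p (2 * b)) ^ 2 * hSC
    rw [e]
    refine Real.exp_le_exp.2 ?_
    have : k / (2 * (s * x) * a) = 2 * (k / (4 * (s * x) * a)) := by
      field_simp
      norm_num
    rw [this]
    linarith

/-! ## Density of the activating speeds -/

section Density

variable {T₀ μ₁ μ₂ : ℝ} {ω ψ : ℝ → ℝ}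

theorem PS2.speedFun_mem_Icc (hT : 0 < T₀) (c : PS2 T₀ μ₁ μ₂ ω ψ) {t : ℝ} (ht : t ∈ Icc 0 T₀) :
    speedFun c.1 t ∈ Icc μ₁ μ₂ := by
  have hc : ContinuousOn (speedFun c.1) (closure (Ioo 0 T₀)) := by
    simpa only [closure_Ioo hT.ne] using continuousOn_speedFun c.1
  rw [← closure_Ioo hT.ne] at ht
  exact ⟨le_on_closure (fun x hx => (c.2.2.1 x hx).1) continuousOn_const hc ht,
    le_on_closure (fun x hx => (c.2.2.1 x hx).2) hc continuousOn_const ht⟩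

theorem exists_smoothTransition_deriv : ∃ (M : ℝ) (S₁ S₂ : ℝ → ℝ), 0 ≤ M ∧
    (∀ x, HasDerivAt Real.smoothTransition (S₁ x) x) ∧ (∀ x, HasDerivAt S₁ (S₂ x) x) ∧
    Continuous S₂ ∧ (∀ x, |S₁ x| ≤ M ∧ |S₂ x| ≤ M) ∧ ∀ x ≥ 1, S₁ x = 0 ∧ S₂ x = 0 := by
  have hS : ContDiff ℝ 2 Real.smoothTransition := Real.smoothTransition.contDiff
  have hS1 : ContDiff ℝ 1 (deriv Real.smoothTransition) := by
    have : ContDiff ℝ (1 + 1) Real.smoothTransition := by rwa [one_add_one_eq_two]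
    exact (contDiff_succ_iff_deriv.1 this).2.2
  have h1 : ∀ x, HasDerivAt Real.smoothTransition (deriv Real.smoothTransition x) x := fun x =>
    (hS.differentiable two_ne_zero x).hasDerivAt
  have h2 : ∀ x, HasDerivAt (deriv Real.smoothTransition)
      (deriv (deriv Real.smoothTransition) x) x := fun x =>
    (hS1.differentiable one_ne_zero x).hasDerivAt
  have c1 : Continuous (deriv Real.smoothTransition) := hS1.continuous
  have c2 : Continuous (deriv (deriv Real.smoothTransition)) := hS1.continuous_deriv le_rfl
  have hr1 : ∀ x ∈ Ioi (1 : ℝ), deriv Real.smoothTransition x = 0 :=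
    hasDerivAt_eq_zero_of_isOpen (f := fun x => Real.smoothTransition x - 1) isOpen_Ioi
      (fun x => (h1 x).sub_const 1) fun x hx => by
        rw [Real.smoothTransition.one_of_one_le (le_of_lt hx), sub_self]
  have hr2 := hasDerivAt_eq_zero_of_isOpen isOpen_Ioi h2 hr1
  have hl1 : ∀ x ∈ Iio (0 : ℝ), deriv Real.smoothTransition x = 0 :=
    hasDerivAt_eq_zero_of_isOpen isOpen_Iio h1 fun x hx =>
      Real.smoothTransition.zero_of_nonpos (le_of_lt hx)
  have hl2 := hasDerivAt_eq_zero_of_isOpen isOpen_Iio h2 hl1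
  have hcl : ∀ f : ℝ → ℝ, Continuous f → (∀ x ∈ Ioi (1 : ℝ), f x = 0) → ∀ x ≥ 1, f x = 0 := by
    intro f hf h x hx
    have : closure (Ioi (1 : ℝ)) ⊆ {t | f t = 0} :=
      closure_minimal (fun t ht => h t ht) (isClosed_eq hf continuous_const)
    rw [closure_Ioi] at this
    exact this hx
  obtain ⟨A, hA⟩ := (isCompact_Icc (a := (0 : ℝ)) (b := 1)).exists_bound_of_continuousOn
    c1.continuousOn
  obtain ⟨B, hB⟩ := (isCompact_Icc (a := (0 : ℝ)) (b := 1)).exists_bound_of_continuousOn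
    c2.continuousOn
  refine ⟨max |A| |B|, _, _, by positivity, h1, h2, c2, fun x => ?_,
    fun x hx => ⟨hcl _ c1 hr1 x hx, hcl _ c2 hr2 x hx⟩⟩
  rcases lt_or_ge x 0 with hx | hx
  · rw [hl1 x hx, hl2 x hx, abs_zero]
    exact ⟨by positivity, by positivity⟩
  rcases le_or_gt x 1 with hx' | hx'
  · exact ⟨(hA x ⟨hx, hx'⟩).trans ((le_abs_self _).trans (le_max_left _ _)),
      (hB x ⟨hx, hx'⟩).trans ((le_abs_self _).trans (le_max_right _ _))⟩
  · rw [hr1 x hx', hr2 x hx', abs_zero]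
    exact ⟨by positivity, by positivity⟩

theorem weighted_D1_le {w t y a : ℝ} (hw : 0 < w) (ht : 0 < t) (h : |y| ≤ a * (w / t)) :
    t ^ 2 / w * |y| ≤ a * t := by
  calc t ^ 2 / w * |y| ≤ t ^ 2 / w * (a * (w / t)) := by gcongr
    _ = a * t := by field_simp

theorem weighted_D2_le {w t y a v : ℝ} (hw : 0 < w) (ht : 0 < t)
    (h : |y| ≤ a * (w ^ 2 / t ^ 2 * Real.exp v)) :
    t ^ 3 * Real.exp (-v) / w ^ 2 * |y| ≤ a * t := by
  calc t ^ 3 * Real.exp (-v) / w ^ 2 * |y|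
      ≤ t ^ 3 * Real.exp (-v) / w ^ 2 * (a * (w ^ 2 / t ^ 2 * Real.exp v)) := by gcongr
    _ = a * t := by rw [Real.exp_neg]; field_simp

/-- On `(0, 2τ)` one has `1 / τ ≤ 2 / t`, so the derivatives of a cutoff at scale `τ` obey bounds in
`t` with `M` independent of `τ`. This is the form comparable with the class. -/
theorem exists_cutoff : ∃ M ≥ (0 : ℝ), ∀ τ > 0, ∃ χ χ₁ χ₂ : ℝ → ℝ,
    (∀ t, HasDerivAt χ (χ₁ t) t) ∧ (∀ t, HasDerivAt χ₁ (χ₂ t) t) ∧ Continuous χ₂ ∧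
    (∀ t, 0 ≤ χ t ∧ χ t ≤ 1) ∧ (∀ t ≥ 2 * τ, χ t = 1 ∧ χ₁ t = 0 ∧ χ₂ t = 0) ∧
    (∀ t ≤ τ, χ t = 0) ∧
    ∀ t ∈ Ioo 0 (2 * τ), |χ₁ t| ≤ 2 * M / t ∧ |χ₂ t| ≤ 4 * M / t ^ 2 := by
  obtain ⟨M, S₁, S₂, hM, hS, hS1, hS2, hSb, hSz⟩ := exists_smoothTransition_deriv
  refine ⟨M, hM, fun τ hτ0 => ?_⟩
  let χ : ℝ → ℝ := fun t => Real.smoothTransition (t / τ - 1)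
  let χ₁ : ℝ → ℝ := fun t => S₁ (t / τ - 1) / τ
  let χ₂ : ℝ → ℝ := fun t => S₂ (t / τ - 1) / τ ^ 2
  have hin : ∀ t, HasDerivAt (fun t => t / τ - 1) (1 / τ) t := fun t =>
    ((hasDerivAt_id t).div_const τ).sub_const 1
  have hχ : ∀ t, HasDerivAt χ (χ₁ t) t := fun t =>
    ((hS _).comp t (hin t)).congr_deriv (by simp only [χ₁]; ring)
  have hχ1 : ∀ t, HasDerivAt χ₁ (χ₂ t) t := fun t =>
    (((hS1 _).comp t (hin t)).div_const τ).congr_deriv (by simp only [χ₂]; field_simp)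
  have hχI : ∀ t, 0 ≤ χ t ∧ χ t ≤ 1 := fun t =>
    ⟨Real.smoothTransition.nonneg _, Real.smoothTransition.le_one _⟩
  have hχr : ∀ t ≥ 2 * τ, χ t = 1 ∧ χ₁ t = 0 ∧ χ₂ t = 0 := by
    intro t ht
    have : 1 ≤ t / τ - 1 := by
      have := (le_div_iff₀ hτ0).2 ht
      linarith
    obtain ⟨h1, h2⟩ := hSz _ this
    exact ⟨Real.smoothTransition.one_of_one_le this, by simp [χ₁, h1], by simp [χ₂, h2]⟩
  have hχl : ∀ t ≤ τ, χ t = 0 := fun t ht => Real.smoothTransition.zero_of_nonpos (by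
    have := (div_le_one hτ0).2 ht
    linarith)
  have hχb : ∀ t ∈ Ioo 0 (2 * τ), |χ₁ t| ≤ 2 * M / t ∧ |χ₂ t| ≤ 4 * M / t ^ 2 := by
    intro t ht
    obtain ⟨h1, h2⟩ := hSb (t / τ - 1)
    have ht0 := ht.1
    have ht2 : t ≤ 2 * τ := ht.2.le
    constructor
    · simp only [χ₁]
      rw [abs_div, abs_of_pos hτ0, div_le_div_iff₀ hτ0 ht0]
      nlinarith [abs_nonneg (S₁ (t / τ - 1))]
    · simp only [χ₂]
      rw [abs_div, abs_of_pos (by positivity : 0 < τ ^ 2), div_le_div_iff₀ (by positivity)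
        (by positivity)]
      have : t ^ 2 ≤ 4 * τ ^ 2 := by nlinarith
      calc _ ≤ M * (4 * τ ^ 2) := mul_le_mul h2 this (by positivity) hM
        _ = _ := by ring
  exact ⟨χ, χ₁, χ₂, hχ, hχ1, by fun_prop, hχI, hχr, hχl, hχb⟩

/-- Shrinking `f` by `1 - θ` frees a fraction `θ` of the allowed size `w / t`; once `w` is large
this fraction pays for the term where the cutoff is differentiated. -/
theorem abs_cutoff_deriv_le {θ M δ w t x₁ y x f : ℝ} (ht : 0 < t) (hM : 0 ≤ M) (hδ : 0 ≤ δ)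
    (hx₁ : |x₁| ≤ 2 * M / t) (hy : |y| ≤ δ) (hx : |x| ≤ 1) (hf : |f| ≤ (1 - θ) * (w / t))
    (hw : 4 * M * δ + 4 * M ≤ θ * w) : |x₁ * y + x * f| ≤ w / t := by
  have h1 := abs_mul_le_mul_of_abs_le hx₁ hy
  have h2 := (abs_mul_le_mul_of_abs_le hx hf).trans_eq (one_mul _)
  have h3 : 2 * M / t * δ ≤ θ * (w / t) := by
    rw [div_mul_eq_mul_div, ← mul_div_assoc]
    have : 0 ≤ M * δ := by positivity
    exact div_le_div_of_nonneg_right (by linarith) ht.le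
  exact (abs_add_le _ _).trans ((add_le_add (h1.trans h3) h2).trans (le_of_eq (by ring)))

theorem abs_cutoff_deriv₂_le {θ M δ w t x₁ x₂ y x f f' v : ℝ} (ht : 0 < t) (hM : 0 ≤ M)
    (hδ : 0 ≤ δ) (hθ : 0 ≤ θ) (hx₁ : |x₁| ≤ 2 * M / t) (hx₂ : |x₂| ≤ 4 * M / t ^ 2) (hy : |y| ≤ δ)
    (hx : |x| ≤ 1) (hf : |f| ≤ (1 - θ) * (w / t))
    (hf' : |f'| ≤ (1 - θ) * (w ^ 2 / t ^ 2 * Real.exp v)) (hv : 0 ≤ v) (hw1 : 1 ≤ w)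
    (hw : 4 * M * δ + 4 * M ≤ θ * w) :
    |x₂ * y + x₁ * f + (x₁ * f + x * f')| ≤ w ^ 2 / t ^ 2 * Real.exp v := by
  have h1 := abs_mul_le_mul_of_abs_le hx₂ hy
  have h1' := abs_mul_le_mul_of_abs_le hx₁ hf
  have h2 := (abs_mul_le_mul_of_abs_le hx hf').trans_eq (one_mul _)
  have he : 1 ≤ Real.exp v := Real.one_le_exp hv
  have h3 : 4 * M / t ^ 2 * δ + 2 * (2 * M / t * ((1 - θ) * (w / t))) ≤
      θ * (w ^ 2 / t ^ 2 * Real.exp v) := by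
    calc _ = (4 * M * δ + 4 * M * (1 - θ) * w) / t ^ 2 := by field_simp; ring
      _ ≤ (θ * w ^ 2) / t ^ 2 := by
        have a1 : 4 * M * δ ≤ 4 * M * δ * w := le_mul_of_one_le_right (by positivity) hw1
        have a2 : 0 ≤ M * w * θ := by positivity
        have a3 := mul_le_mul_of_nonneg_right hw (zero_le_one.trans hw1)
        exact div_le_div_of_nonneg_right (by linarith) (by positivity)
      _ = θ * (w ^ 2 / t ^ 2 * 1) := by ring
      _ ≤ _ := by gcongr
  have := (abs_add_le (x₂ * y + x₁ * f) (x₁ * f + x * f')).trans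
    (add_le_add (abs_add_le _ _) (abs_add_le _ _))
  linarith

set_option maxHeartbeats 1000000 in
/-- The speeds that are constant near `0`, with a value strictly between `μ₁` and `μ₂`, are
dense. -/
theorem exists_constant_near_zero (hT₀ : 0 < T₀) (hμ : μ₁ < μ₂)
    (hω_pos : ∀ t ∈ Ioc 0 T₀, 0 < ω t) (hψ_pos : ∀ t ∈ Ioc 0 T₀, 0 < ψ t)
    (hω_lim : Tendsto ω (𝓝[>] 0) atTop) (c₀ : PS2 T₀ μ₁ μ₂ ω ψ) {ε : ℝ} (hε : 0 < ε) :
    ∃ c : PS2 T₀ μ₁ μ₂ ω ψ, PS2.d c c₀ < ε ∧ ∃ τ γ : ℝ, 0 < τ ∧ τ ≤ T₀ ∧ μ₁ < γ ∧ γ < μ₂ ∧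
      ∀ t ∈ Icc 0 τ, speedFun c.1 t = γ := by
  obtain ⟨M, hM, hcut⟩ := exists_cutoff
  set f := speedFun c₀.1 with hf
  set m := (μ₁ + μ₂) / 2 with hm
  set δ := μ₂ - μ₁ with hδ
  have hδ0 : 0 < δ := by linarith
  -- Mixing with the midpoint `m` in proportion `θ` leaves room in every constraint of the class,
  -- and in particular puts the value at `0` strictly between `μ₁` and `μ₂`.
  set θ := min (1 / 2) (ε / (8 * (δ + T₀))) with hθ
  have hθ0 : 0 < θ := by positivity
  have hθ1 : θ ≤ 1 / 2 := min_le_left _ _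
  have hθε : θ * (δ + T₀) ≤ ε / 8 := by
    have : θ ≤ ε / (8 * (δ + T₀)) := min_le_right _ _
    calc θ * (δ + T₀) ≤ ε / (8 * (δ + T₀)) * (δ + T₀) := by gcongr
      _ = ε / 8 := by field_simp
  have hθδ : θ * δ ≤ ε / 8 := by nlinarith
  have hθT : θ * T₀ ≤ ε / 8 := by nlinarith
  let F : ℝ → ℝ := fun t => (1 - θ) * f t + θ * m
  set γ := F 0 with hγ
  have hfI : ∀ t ∈ Icc 0 T₀, μ₁ ≤ f t ∧ f t ≤ μ₂ := fun t ht => c₀.speedFun_mem_Icc hT₀ ht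
  have hFI : ∀ t ∈ Icc 0 T₀, μ₁ + θ * δ / 2 ≤ F t ∧ F t ≤ μ₂ - θ * δ / 2 := by
    intro t ht
    obtain ⟨h1, h2⟩ := hfI t ht
    have hm1 : m = μ₁ + δ / 2 := by rw [hm, hδ]; ring
    have hm2 : m = μ₂ - δ / 2 := by rw [hm, hδ]; ring
    constructor
    · simp only [F]
      rw [hm1]
      nlinarith
    · simp only [F]
      rw [hm2]
      nlinarith
  have h0T : (0 : ℝ) ∈ Icc 0 T₀ := ⟨le_rfl, hT₀.le⟩
  have hγI := hFI 0 h0T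
  have hFc : ContinuousOn F (Icc 0 T₀) :=
    (continuousOn_const.mul (continuousOn_speedFun _)).add continuousOn_const
  have hFγ : ∀ t ∈ Icc 0 T₀, |F t - γ| ≤ δ := by
    intro t ht
    have h1 := hFI t ht
    have : 0 < θ * δ := by positivity
    exact abs_le.2 ⟨by linarith [h1.1, hγI.2], by linarith [h1.2, hγI.1]⟩
  -- choice of the scale
  have ev1 : ∀ᶠ t in 𝓝[>] (0 : ℝ), max 1 ((4 * M * δ + 4 * M) / θ) ≤ ω t :=
    hω_lim.eventually_ge_atTop _
  have ev2 : ∀ᶠ t in 𝓝[>] (0 : ℝ), |F t - γ| < ε / 8 := by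
    have h1 : Tendsto F (𝓝[>] 0) (𝓝 γ) :=
      ((hFc 0 h0T).mono_of_mem_nhdsWithin (Icc_mem_nhdsGT hT₀) : ContinuousWithinAt F (Ioi 0) 0)
    have := Metric.tendsto_nhds.1 h1 (ε / 8) (by positivity)
    simpa only [Real.dist_eq] using this
  obtain ⟨r, hr, hrs⟩ := mem_nhdsGT_iff_exists_Ioo_subset.1 (ev1.and ev2)
  have hr : 0 < r := hr
  -- On `(0, 2τ)`, `ω` must be large and `F` close to `γ`. There the weighted differences of the
  -- derivatives are at most `2 * t < 4 * τ`, whence `ε / 64`.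
  set τ := min (min (r / 2) (T₀ / 2)) (ε / 64) with hτ
  have hτ0 : 0 < τ := by positivity
  have hτr : 2 * τ ≤ r := by
    have : τ ≤ r / 2 := (min_le_left _ _).trans (min_le_left _ _)
    linarith
  have hτT : 2 * τ ≤ T₀ := by
    have : τ ≤ T₀ / 2 := (min_le_left _ _).trans (min_le_right _ _)
    linarith
  have hτε : τ ≤ ε / 64 := min_le_right _ _
  obtain ⟨χ, χ₁, χ₂, hχ, hχ1, hcχ2, hχI, hχr, hχl, hχb⟩ := hcut τ hτ0
  set f₁ := D1 c₀.1 with hf₁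
  set f₂ := D2 c₀.1 with hf₂
  let g : ℝ → ℝ := fun t => γ + χ t * (F t - γ)
  let g₁ : ℝ → ℝ := fun t => χ₁ t * (F t - γ) + χ t * ((1 - θ) * f₁ t)
  let g₂ : ℝ → ℝ := fun t => χ₂ t * (F t - γ) + χ₁ t * ((1 - θ) * f₁ t) +
    (χ₁ t * ((1 - θ) * f₁ t) + χ t * ((1 - θ) * f₂ t))
  have dF : ∀ t ∈ Ioc 0 T₀, HasDerivWithinAt (fun t => F t - γ) ((1 - θ) * f₁ t) (Ioc 0 T₀) t :=
    fun t ht => (((c₀.hasDerivWithinAt_speedFun ht).const_mul (1 - θ)).add_const (θ * m)).sub_const γ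
  have dg : ∀ t ∈ Ioc 0 T₀, HasDerivWithinAt g (g₁ t) (Ioc 0 T₀) t := fun t ht =>
    ((hχ t).hasDerivWithinAt.mul (dF t ht)).const_add γ
  have dg1 : ∀ t ∈ Ioc 0 T₀, HasDerivWithinAt g₁ (g₂ t) (Ioc 0 T₀) t := fun t ht =>
    ((hχ1 t).hasDerivWithinAt.mul (dF t ht)).add
      ((hχ t).hasDerivWithinAt.mul ((c₀.hasDerivWithinAt_D1 ht).const_mul (1 - θ)))
  have hcχ : Continuous χ := continuous_iff_continuousAt.2 fun t => (hχ t).continuousAt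
  have hcχ1 : Continuous χ₁ := continuous_iff_continuousAt.2 fun t => (hχ1 t).continuousAt
  have hIoc : Ioc 0 T₀ ⊆ Icc 0 T₀ := Ioc_subset_Icc_self
  have hFγc : ContinuousOn (fun t => F t - γ) (Icc 0 T₀) := hFc.sub continuousOn_const
  have cf1 : ContinuousOn (fun t => (1 - θ) * f₁ t) (Ioc 0 T₀) :=
    continuousOn_const.mul c₀.continuousOn_D1
  have cf2 : ContinuousOn (fun t => (1 - θ) * f₂ t) (Ioc 0 T₀) :=
    continuousOn_const.mul c₀.continuousOn_D2
  have cg2 : ContinuousOn g₂ (Ioc 0 T₀) :=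
    ((hcχ2.continuousOn.mul (hFγc.mono hIoc)).add (hcχ1.continuousOn.mul cf1)).add
      ((hcχ1.continuousOn.mul cf1).add (hcχ.continuousOn.mul cf2))
  have cg : ContinuousOn g (Icc 0 T₀) := continuousOn_const.add (hcχ.continuousOn.mul hFγc)
  have b0 : ∀ t ∈ Ioo 0 T₀, μ₁ ≤ g t ∧ g t ≤ μ₂ := by
    intro t ht
    obtain ⟨h1, h2⟩ := hFI t (Ioo_subset_Icc_self ht)
    obtain ⟨h3, h4⟩ := hχI t
    have : 0 < θ * δ := by positivity
    have e : g t = (1 - χ t) * γ + χ t * F t := by simp only [g]; ring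
    rw [e]
    constructor <;> nlinarith [hγI.1, hγI.2]
  have hω1 : ∀ t ∈ Ioo 0 (2 * τ), 1 ≤ ω t ∧ 4 * M * δ + 4 * M ≤ θ * ω t := by
    intro t ht
    have := (hrs ⟨ht.1, ht.2.trans_le hτr⟩).1
    refine ⟨(le_max_left _ _).trans this, ?_⟩
    have h2 := (le_max_right _ _).trans this
    rw [div_le_iff₀ hθ0] at h2
    linarith
  have bf1 : ∀ t ∈ Ioc 0 T₀, |(1 - θ) * f₁ t| ≤ (1 - θ) * (ω t / t) := fun t ht => by
    rw [abs_mul, abs_of_nonneg (by linarith : 0 ≤ 1 - θ)]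
    exact mul_le_mul_of_nonneg_left (c₀.2.2.2.1 t ht) (by linarith)
  have bf2 : ∀ t ∈ Ioc 0 T₀, |(1 - θ) * f₂ t| ≤ (1 - θ) * (ω t ^ 2 / t ^ 2 * Real.exp (ψ t)) :=
    fun t ht => by
      rw [abs_mul, abs_of_nonneg (by linarith : 0 ≤ 1 - θ)]
      exact mul_le_mul_of_nonneg_left (c₀.2.2.2.2 t ht) (by linarith)
  have hχabs : ∀ t, |χ t| ≤ 1 := fun t => abs_le.2 ⟨by linarith [(hχI t).1], (hχI t).2⟩
  have b1 : ∀ t ∈ Ioc 0 T₀, |g₁ t| ≤ ω t / t := by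
    intro t ht
    rcases lt_or_ge t (2 * τ) with h | h
    · exact abs_cutoff_deriv_le ht.1 hM hδ0.le (hχb t ⟨ht.1, h⟩).1 (hFγ t (hIoc ht)) (hχabs t)
        (bf1 t ht) (hω1 t ⟨ht.1, h⟩).2
    · obtain ⟨e0, e1, e2⟩ := hχr t h
      have : 0 ≤ ω t / t := div_nonneg (hω_pos t ht).le ht.1.le
      have e : g₁ t = (1 - θ) * f₁ t := by
        change χ₁ t * (F t - γ) + χ t * ((1 - θ) * f₁ t) = _
        rw [e0, e1]
        ring
      rw [e]
      exact (bf1 t ht).trans (mul_le_of_le_one_left this (by linarith))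
  have b2 : ∀ t ∈ Ioc 0 T₀, |g₂ t| ≤ ω t ^ 2 / t ^ 2 * Real.exp (ψ t) := by
    intro t ht
    rcases lt_or_ge t (2 * τ) with h | h
    · exact abs_cutoff_deriv₂_le ht.1 hM hδ0.le hθ0.le (hχb t ⟨ht.1, h⟩).1 (hχb t ⟨ht.1, h⟩).2
        (hFγ t (hIoc ht)) (hχabs t) (bf1 t ht) (bf2 t ht) (hψ_pos t ht).le (hω1 t ⟨ht.1, h⟩).1
        (hω1 t ⟨ht.1, h⟩).2
    · obtain ⟨e0, e1, e2⟩ := hχr t h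
      have : 0 ≤ ω t ^ 2 / t ^ 2 * Real.exp (ψ t) := by positivity
      have e : g₂ t = (1 - θ) * f₂ t := by
        change χ₂ t * (F t - γ) + χ₁ t * ((1 - θ) * f₁ t) +
          (χ₁ t * ((1 - θ) * f₁ t) + χ t * ((1 - θ) * f₂ t)) = _
        rw [e0, e1, e2]
        ring
      rw [e]
      exact (bf2 t ht).trans (mul_le_of_le_one_left this (by linarith))
  obtain ⟨c, e0, e1, e2⟩ := PS2.exists_of_hasDerivWithinAt cg dg dg1 cg2 b0 b1 b2
  refine ⟨c, ?_, τ, γ, hτ0, by linarith, by have : 0 < θ * δ := by positivity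
                                            linarith [hγI.1],
    by have : 0 < θ * δ := by positivity
       linarith [hγI.2], fun t ht => ?_⟩
  · have hd : PS2.d c c₀ ≤ ε / 4 + ε / 8 + ε / 8 := by
      refine PS2.d_le hT₀ (fun t ht => ?_) (fun t ht => ?_) (fun t ht => ?_)
      · have ht' := Ioo_subset_Icc_self ht
        rw [e0 t ht']
        obtain ⟨h1, h2⟩ := hfI t ht'
        have hA : |F t - f t| ≤ ε / 8 := by
          have : F t - f t = θ * (m - f t) := by simp only [F]; ring
          rw [this, abs_mul, abs_of_pos hθ0]
          refine le_trans (mul_le_mul_of_nonneg_left ?_ hθ0.le) hθδ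
          exact abs_le.2 ⟨by linarith, by linarith⟩
        have hB : |g t - F t| ≤ ε / 8 := by
          rcases lt_or_ge t (2 * τ) with h | h
          · have e : g t - F t = -((1 - χ t) * (F t - γ)) := by simp only [g]; ring
            rw [e, abs_neg]
            have h3 : |1 - χ t| ≤ 1 := abs_le.2 ⟨by linarith [(hχI t).2], by linarith [(hχI t).1]⟩
            exact (abs_mul_le_mul_of_abs_le h3 (hrs ⟨ht.1, h.trans_le hτr⟩).2.le).trans_eq
              (one_mul _)
          · have e : g t - F t = 0 := by simp only [g, (hχr t h).1]; ring
            rw [e, abs_zero]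
            positivity
        calc |g t - f t| = |(g t - F t) + (F t - f t)| := by ring_nf
          _ ≤ ε / 4 := (abs_add_le _ _).trans (by linarith)
      · have ht' := Ioo_subset_Ioc_self ht
        rw [e1 t ht']
        have hw := hω_pos t ht'
        rcases lt_or_ge t (2 * τ) with h | h
        · refine (weighted_D1_le (a := 2) hw ht.1 ?_).trans (by linarith)
          refine (abs_sub _ _).trans ?_
          linarith [b1 t ht', c₀.2.2.2.1 t ht']
        · refine (weighted_D1_le (a := θ) hw ht.1 ?_).trans
            ((mul_le_mul_of_nonneg_left ht.2.le hθ0.le).trans hθT)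
          obtain ⟨x0, x1, x2⟩ := hχr t h
          have e : g₁ t - D1 c₀.1 t = -(θ * D1 c₀.1 t) := by
            simp only [g₁, x0, x1, hf₁]
            ring
          rw [e, abs_neg, abs_mul, abs_of_pos hθ0]
          exact mul_le_mul_of_nonneg_left (c₀.2.2.2.1 t ht') hθ0.le
      · have ht' := Ioo_subset_Ioc_self ht
        rw [e2 t ht']
        have hw := hω_pos t ht'
        rcases lt_or_ge t (2 * τ) with h | h
        · refine (weighted_D2_le (a := 2) hw ht.1 ?_).trans (by linarith)
          refine (abs_sub _ _).trans ?_
          linarith [b2 t ht', c₀.2.2.2.2 t ht']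
        · refine (weighted_D2_le (a := θ) hw ht.1 ?_).trans
            ((mul_le_mul_of_nonneg_left ht.2.le hθ0.le).trans hθT)
          obtain ⟨x0, x1, x2⟩ := hχr t h
          have e : g₂ t - D2 c₀.1 t = -(θ * D2 c₀.1 t) := by
            simp only [g₂, x0, x1, x2, hf₂]
            ring
          rw [e, abs_neg, abs_mul, abs_of_pos hθ0]
          exact mul_le_mul_of_nonneg_left (c₀.2.2.2.2 t ht') hθ0.le
    linarith
  · rw [e0 t ⟨ht.1, by linarith [ht.2]⟩]
    simp only [g, hχl t ht.2]
    ring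

/-- The energy decays at most exponentially, at a rate controlled by the logarithmic derivative of
the coefficient. -/
theorem IsModeSolution.energy_ge {T l B Q : ℝ} {c c₁ w w₁ : ℝ → ℝ} (hl : 0 ≤ l) (hB : 0 ≤ B)
    (hw : IsModeSolution T l c w w₁)
    (hc : ∀ t ∈ Icc B T, HasDerivWithinAt c (c₁ t) (Icc B T) t)
    (hcB : 0 ≤ c B) (hQ : 0 ≤ Q) (hQc : ∀ t ∈ Icc B T, |c₁ t| ≤ Q * c t) {t : ℝ} (ht : t ∈ Icc B T) :
    (w₁ B ^ 2 + c B * l * w B ^ 2) * Real.exp (-(Q * T)) ≤ w₁ t ^ 2 + c t * l * w t ^ 2 := by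
  have hsub : Icc B T ⊆ Icc 0 T := Icc_subset_Icc_left hB
  let E : ℝ → ℝ := fun t => w₁ t ^ 2 + c t * l * w t ^ 2
  -- The mixed terms `w w₁` cancel by the equation, so `E' = c₁ l w²`; the factor `exp (Q t)`
  -- compensates for its possible negativity.
  have hd : ∀ t ∈ Icc B T, HasDerivWithinAt (fun t => E t * Real.exp (Q * t))
      ((c₁ t + Q * c t) * l * w t ^ 2 * Real.exp (Q * t) + Q * w₁ t ^ 2 * Real.exp (Q * t))
      (Icc B T) t := by
    intro t ht
    have h1 := (hw.2.2 t (hsub ht)).1.mono hsub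
    have h2 := (hw.2.2 t (hsub ht)).2.mono hsub
    have h3 : HasDerivAt (fun t => Real.exp (Q * t)) (Real.exp (Q * t) * (Q * 1)) t :=
      ((hasDerivAt_id t).const_mul Q).exp
    refine (((h2.pow 2).add (((hc t ht).mul_const l).mul (h1.pow 2))).mul
      h3.hasDerivWithinAt).congr_deriv ?_
    simp only [Pi.add_apply, Pi.mul_apply, Pi.pow_apply]
    push_cast
    ring
  have hmono : MonotoneOn (fun t => E t * Real.exp (Q * t)) (Icc B T) := by
    refine monotoneOn_of_hasDerivWithinAt_nonneg (convex_Icc _ _)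
      (fun t ht => (hd t ht).continuousWithinAt)
      (fun t ht => (hd t (interior_subset ht)).mono interior_subset) fun t ht => ?_
    have h1 := (abs_le.1 (hQc t (interior_subset ht))).1
    have h2 : 0 ≤ c₁ t + Q * c t := by linarith
    positivity
  have hBT : B ≤ T := ht.1.trans ht.2
  have h := hmono (left_mem_Icc.2 hBT) ht ht.1
  simp only at h
  -- Nonnegativity of `E t` is read off the monotonicity, since that of `c` is assumed only at `B`.
  have hEt : 0 ≤ E B * Real.exp (Q * B) → E t * Real.exp (Q * t) ≤ E t * Real.exp (Q * T) := by
    intro h0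
    have : 0 ≤ E t := by
      by_contra hneg
      have := mul_neg_of_neg_of_pos (not_le.1 hneg) (Real.exp_pos (Q * t))
      linarith
    refine mul_le_mul_of_nonneg_left (Real.exp_le_exp.2 (mul_le_mul_of_nonneg_left ht.2 hQ)) this
  have hE0 : 0 ≤ E B := by positivity
  have hexp : 1 ≤ Real.exp (Q * B) := Real.one_le_exp (by positivity)
  have h5 : E B ≤ E t * Real.exp (Q * T) :=
    ((le_mul_of_one_le_right hE0 hexp).trans h).trans (hEt (by positivity))
  rw [Real.exp_neg, ← div_eq_mul_inv, div_le_iff₀ (Real.exp_pos _)]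
  exact h5

end Density

/-! ### Perturbing to resonance, and the residual set of speeds. -/

section Main

variable {T₀ μ₁ μ₂ : ℝ} {ω ψ : ℝ → ℝ}

theorem PS2.D1_D2_eq_zero_of_const {τ γ : ℝ} (hτ : τ ≤ T₀) (c : PS2 T₀ μ₁ μ₂ ω ψ)
    (hc : ∀ t ∈ Icc 0 τ, speedFun c.1 t = γ) {t : ℝ} (ht : t ∈ Ioo 0 τ) :
    D1 c.1 t = 0 ∧ D2 c.1 t = 0 := by
  have h1 : ∀ t ∈ Ioo 0 τ, D1 c.1 t = 0 := by
    intro t ht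
    have h := (c.hasDerivWithinAt_speedFun ⟨ht.1, ht.2.le.trans hτ⟩).hasDerivAt
      (Ioc_mem_nhds ht.1 (ht.2.trans_le hτ))
    refine h.unique ((hasDerivAt_const t γ).congr_of_eventuallyEq ?_)
    filter_upwards [Ioo_mem_nhds ht.1 ht.2] with y hy
    exact hc y (Ioo_subset_Icc_self hy)
  refine ⟨h1 t ht, ?_⟩
  have h := (c.hasDerivWithinAt_D1 ⟨ht.1, ht.2.le.trans hτ⟩).hasDerivAt
    (Ioc_mem_nhds ht.1 (ht.2.trans_le hτ))
  refine hasDerivAt_eq_zero_of_eventually h ?_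
  filter_upwards [Ioo_mem_nhds ht.1 ht.2] with y hy
  exact h1 y hy

/-- Subtracting a small perturbation supported where the speed is constant. -/
theorem PS2.exists_sub_perturbation (hT₀ : 0 < T₀) (hω_pos : ∀ t ∈ Ioc 0 T₀, 0 < ω t)
    {τ γ η B ε : ℝ} (hτ : τ ≤ T₀) (c : PS2 T₀ μ₁ μ₂ ω ψ)
    (hc : ∀ t ∈ Icc 0 τ, speedFun c.1 t = γ) (hγ₁ : μ₁ + η ≤ γ) (hγ₂ : γ ≤ μ₂ - η) (hB : 0 < B)
    (hBτ : B < τ) (hε : η + B + B < ε) {q q₁ q₂ : ℝ → ℝ}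
    (hq : ∀ t, HasDerivAt q (q₁ t) t) (hq₁ : ∀ t, HasDerivAt q₁ (q₂ t) t) (hq₂ : Continuous q₂)
    (hqB : ∀ t ≥ B, q t = 0 ∧ q₁ t = 0 ∧ q₂ t = 0) (b0 : ∀ t > 0, |q t| ≤ η)
    (b1 : ∀ t ∈ Ioo 0 B, |q₁ t| ≤ ω t / t)
    (b2 : ∀ t ∈ Ioo 0 B, |q₂ t| ≤ ω t ^ 2 / t ^ 2 * Real.exp (ψ t)) :
    ∃ c' : PS2 T₀ μ₁ μ₂ ω ψ, PS2.d c' c < ε ∧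
      (∀ t ∈ Icc 0 T₀, speedFun c'.1 t = speedFun c.1 t - q t) ∧
      ∀ t ∈ Icc B T₀, D1 c'.1 t = D1 c.1 t := by
  have hIoc : Ioc 0 T₀ ⊆ Icc 0 T₀ := Ioc_subset_Icc_self
  have hd0 := fun t (ht : t ∈ Ioo 0 B) =>
    c.D1_D2_eq_zero_of_const hτ hc (t := t) ⟨ht.1, ht.2.trans hBτ⟩
  have hη : 0 ≤ η := (abs_nonneg _).trans (b0 1 one_pos)
  obtain ⟨c', e0, e1, e2⟩ := PS2.exists_of_hasDerivWithinAt (μ₁ := μ₁) (μ₂ := μ₂) (ω := ω) (ψ := ψ)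
    (g := fun t => speedFun c.1 t - q t) (g₁ := fun t => D1 c.1 t - q₁ t)
    (g₂ := fun t => D2 c.1 t - q₂ t)
    ((continuousOn_speedFun c.1).sub fun t _ => (hq t).continuousAt.continuousWithinAt)
    (fun t ht => (c.hasDerivWithinAt_speedFun ht).sub (hq t).hasDerivWithinAt)
    (fun t ht => (c.hasDerivWithinAt_D1 ht).sub (hq₁ t).hasDerivWithinAt)
    (c.continuousOn_D2.sub hq₂.continuousOn)
    (fun t ht => by
      rcases lt_or_ge t B with h | h
      · rw [hc t ⟨ht.1.le, (h.trans hBτ).le⟩]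
        have := abs_le.1 (b0 t ht.1)
        constructor <;> linarith
      · rw [(hqB t h).1, sub_zero]
        exact c.2.2.1 t ht)
    (fun t ht => by
      rcases lt_or_ge t B with h | h
      · rw [(hd0 t ⟨ht.1, h⟩).1, zero_sub, abs_neg]
        exact b1 t ⟨ht.1, h⟩
      · rw [(hqB t h).2.1, sub_zero]
        exact c.2.2.2.1 t ht)
    (fun t ht => by
      rcases lt_or_ge t B with h | h
      · rw [(hd0 t ⟨ht.1, h⟩).2, zero_sub, abs_neg]
        exact b2 t ⟨ht.1, h⟩
      · rw [(hqB t h).2.2, sub_zero]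
        exact c.2.2.2.2 t ht)
  refine ⟨c', ?_, e0, fun t ht => ?_⟩
  · refine (PS2.d_le hT₀ (a₀ := η) (a₁ := B) (a₂ := B) (fun t ht => ?_) (fun t ht => ?_)
      (fun t ht => ?_)).trans_lt hε
    · rw [e0 t (Ioo_subset_Icc_self ht), sub_sub_cancel_left, abs_neg]
      exact b0 t ht.1
    · rw [e1 t (Ioo_subset_Ioc_self ht), sub_sub_cancel_left, abs_neg]
      rcases lt_or_ge t B with h | h
      · refine (weighted_D1_le (a := 1) (hω_pos t (Ioo_subset_Ioc_self ht)) ht.1 ?_).trans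
          (by linarith)
        rw [one_mul]
        exact b1 t ⟨ht.1, h⟩
      · rw [(hqB t h).2.1, abs_zero, mul_zero]
        exact hB.le
    · rw [e2 t (Ioo_subset_Ioc_self ht), sub_sub_cancel_left, abs_neg]
      rcases lt_or_ge t B with h | h
      · refine (weighted_D2_le (a := 1) (hω_pos t (Ioo_subset_Ioc_self ht)) ht.1 ?_).trans
          (by linarith)
        rw [one_mul]
        exact b2 t ⟨ht.1, h⟩
      · rw [(hqB t h).2.2, abs_zero, mul_zero]
        exact hB.le
  · rw [e1 t ⟨hB.trans_le ht.1, ht.2⟩, (hqB t ht.1).2.1, sub_zero]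

/-- A speed that is constant near `0` can be perturbed slightly so that the mode of a given large
frequency `x` gets a large energy. -/
theorem exists_resonant_speed (hT₀ : 0 < T₀) (hμ₁ : 0 < μ₁)
    (hω_pos : ∀ t ∈ Ioc 0 T₀, 0 < ω t) (hψ_pos : ∀ t ∈ Ioc 0 T₀, 0 < ψ t)
    (hω_anti : AntitoneOn ω (Ioc 0 T₀)) (hψ_anti : AntitoneOn ψ (Ioc 0 T₀))
    (hω_lim : Tendsto ω (𝓝[>] 0) atTop)
    (hωψ_lim : Tendsto (fun t => ω t * ψ t / |Real.log t|) (𝓝[>] 0) atTop)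
    (c : PS2 T₀ μ₁ μ₂ ω ψ) {τ γ : ℝ} (hτ : 0 < τ) (hτT : τ ≤ T₀) (hγ₁ : μ₁ < γ) (hγ₂ : γ < μ₂)
    (hc : ∀ t ∈ Icc 0 τ, speedFun c.1 t = γ) {ε σ : ℝ} (hε : 0 < ε) (hσ : 0 < σ) (N : ℕ) :
    ∃ Λ, ∀ x ≥ Λ, ∃ c' : PS2 T₀ μ₁ μ₂ ω ψ, PS2.d c' c < ε ∧ ∃ w w₁,
      IsModeSolution T₀ (x ^ 2) (speedFun c'.1) w w₁ ∧
      ∀ t ∈ Icc σ T₀, x ^ N < w₁ t ^ 2 + x ^ 2 * w t ^ 2 := by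
  have hγ0 : 0 < γ := hμ₁.trans hγ₁
  set s := √γ with hs
  have hs0 : 0 < s := Real.sqrt_pos.2 hγ0
  have hs2 : s ^ 2 = γ := Real.sq_sqrt hγ0.le
  obtain ⟨C, hC1, hC⟩ := exists_resonance hs0
  have hC0 : 0 < C := by linarith
  set η := min (min (γ - μ₁) (μ₂ - γ)) (min 1 (ε / 4)) with hη
  have hη0 : 0 < η := lt_min (lt_min (by linarith) (by linarith)) (by positivity)
  have hη1 : η ≤ γ - μ₁ := (min_le_left _ _).trans (min_le_left _ _)
  have hη2 : η ≤ μ₂ - γ := (min_le_left _ _).trans (min_le_right _ _)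
  have hη3 : η ≤ 1 := (min_le_right _ _).trans (min_le_left _ _)
  have hη4 : η ≤ ε / 4 := (min_le_right _ _).trans (min_le_right _ _)
  -- With `k = κ * W` and `x * a = W / 24`, the bound `C * k / (x * a)` for `q` becomes exactly `η`.
  set κ := η / (24 * C) with hκ
  have hκ0 : 0 < κ := by positivity
  have hκC : 24 * (C * κ) = η := by rw [hκ]; field_simp
  set ρ := min (min τ σ) (ε / 4) with hρ
  have hρ0 : 0 < ρ := by positivity
  obtain ⟨Λ, hΛ⟩ := exists_time_scale hT₀ hω_pos hψ_pos hω_lim hωψ_lim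
    (K := (N + 1) / κ) (by positivity) hρ0
  have hτm : τ ∈ Ioc 0 T₀ := ⟨hτ, hτT⟩
  -- The perturbation lives before `B < τ` and the original speed is constant up to `τ`, so on `[B,
  -- T₀]` the logarithmic derivative is bounded by a constant depending on neither `B` nor `x`.
  set Q := ω τ / τ / μ₁ with hQ
  have hQ0 : 0 < Q := by
    have := hω_pos τ hτm
    positivity
  -- All losses independent of `x` are collected in `D`; the exponent `N + 1` is sought instead of
  -- `N`, and the spare factor `x > D` absorbs them.
  set D := max 1 μ₂ * Real.exp (12 * κ / s + Q * T₀) with hD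
  refine ⟨max (max Λ 1) (D + 1), fun x hx => ?_⟩
  have hxΛ : Λ ≤ x := (le_max_left _ _).trans ((le_max_left _ _).trans hx)
  have hx1 : 1 ≤ x := (le_max_right _ _).trans ((le_max_left _ _).trans hx)
  have hxD : D < x := by linarith [(le_max_right (max Λ 1) (D + 1)).trans hx]
  have hx0 : 0 < x := by linarith
  obtain ⟨B, hB, hBρ, hBT, hW24, hxg, hL1, hKL⟩ := hΛ x hxΛ
  have hBτ : B < τ := by
    have : ρ ≤ τ := (min_le_left _ _).trans (min_le_left _ _)
    linarith
  have hBσ : B < σ := by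
    have : ρ ≤ σ := (min_le_left _ _).trans (min_le_right _ _)
    linarith
  have hBε : 2 * B < ε / 4 := hBρ.trans_le (min_le_right _ _)
  have h2B : 2 * B ∈ Ioc 0 T₀ := ⟨by linarith, hBT⟩
  have hBm : B ∈ Ioc 0 T₀ := ⟨hB, by linarith⟩
  set W := ω (2 * B) with hW
  have hW0 : 0 < W := by linarith
  have hWle : ∀ t ∈ Ioo 0 B, W ≤ ω t := fun t ht =>
    hω_anti ⟨ht.1, by linarith [ht.2]⟩ h2B (by linarith [ht.2])
  set L := Real.log (6 * B * x / W) with hL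
  have hxa : x * (W / (24 * x)) = W / 24 := by field_simp
  have hba : B / 2 / (2 * (W / (24 * x))) = 6 * B * x / W := by
    field_simp
    norm_num
  have h2ab : 2 * (W / (24 * x)) ≤ B / 2 := by
    have h1 : 1 ≤ 6 * B * x / W := by
      by_contra h
      have := Real.log_nonpos (by positivity) (not_le.1 h).le
      linarith
    rw [← hba, le_div_iff₀ (by positivity), one_mul] at h1
    exact h1
  have hCk : C * (κ * W) = η * (W / 24) := by rw [← hκC]; ring
  -- Here `a = W / (24 * x)` and `b = B / 2`, so the perturbation ends at `B`; `W ≥ 24` gives `x * a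
  -- ≥ 1`.
  obtain ⟨q, q₁, q₂, w, w₁, hq, hq₁, hq₂, -, hqB, hqb, hsol, hen⟩ := hC x (W / (24 * x)) (B / 2)
    (κ * W) hx0 (by positivity) h2ab (by positivity) (by rw [hxa]; linarith)
    (by rw [hxa, hCk]; exact mul_le_of_le_one_left (by positivity) hη3)
  rw [mul_div_cancel₀ B two_ne_zero] at hqB hen
  have hCW : C * (κ * W) ≤ W := by
    rw [hCk]
    nlinarith
  have b1 : ∀ t ∈ Ioo 0 B, |q₁ t| ≤ W / t := fun t ht =>
    (hqb t ht.1).2.1.trans (div_le_div_of_nonneg_right hCW ht.1.le)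
  obtain ⟨c', hd, e0, e1⟩ := c.exists_sub_perturbation (η := η) (ε := ε) hT₀ hω_pos hτT hc
    (by linarith) (by linarith) hB hBτ (by linarith) hq hq₁ hq₂ hqB
    (fun t ht => (hqb t ht).1.trans (by rw [hxa, hCk, mul_div_cancel_right₀ _ (by positivity)]))
    (fun t ht => (b1 t ht).trans (div_le_div_of_nonneg_right (hWle t ht) ht.1.le))
    (fun t ht => by
      have htm : t ∈ Ioc 0 T₀ := ⟨ht.1, by linarith [ht.2]⟩
      have ht0 := ht.1
      have hwt := hω_pos t htm
      -- The constraint on the second derivative holds at `B` by the choice of scale, and it only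
      -- weakens as `t` decreases, by monotonicity of `ω` and `ψ`.
      have hxt : x ≤ ω t * Real.exp (ψ t) / t := by
        refine hxg.trans ?_
        have h1 := hω_anti htm hBm ht.2.le
        have h2 := hψ_anti htm hBm ht.2.le
        have h3 := ht.2.le
        gcongr
      refine (hqb t ht.1).2.2.trans ?_
      calc C * (κ * W) * x / t ≤ ω t * (ω t * Real.exp (ψ t) / t) / t := by
            have := hCW.trans (hWle t ht)
            gcongr
        _ = _ := by field_simp)
  obtain ⟨z, z₁, hz⟩ := exists_isModeSolution (l := x ^ 2) hT₀.le (continuousOn_speedFun c'.1)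
  refine ⟨c', hd, z, z₁, hz, fun t ht => ?_⟩
  have hBT' : B ≤ T₀ := hBm.2
  -- the energy at time `B`
  have hzw : z B = w B ∧ z₁ B = w₁ B := by
    have hw : IsModeSolution B (x ^ 2) (speedFun c'.1) w w₁ := by
      obtain ⟨i0, i1, hi⟩ := hsol B
      refine ⟨i0, i1, fun r hr => ⟨(hi r hr).1, ?_⟩⟩
      rw [e0 r ⟨hr.1, hr.2.trans hBT'⟩, hc r ⟨hr.1, hr.2.trans hBτ.le⟩, ← hs2]
      exact (hi r hr).2
    exact (hz.mono hBT').unique ((continuousOn_speedFun c'.1).mono (Icc_subset_Icc_right hBT'))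
      hw (right_mem_Icc.2 hB.le)
  have hcB : speedFun c'.1 B = s ^ 2 := by
    rw [e0 B ⟨hB.le, hBT'⟩, hc B ⟨hB.le, hBτ.le⟩, (hqB B le_rfl).1, sub_zero, hs2]
  have hEB : Real.exp (κ * W * L - 12 * κ / s) ≤ z₁ B ^ 2 + speedFun c'.1 B * x ^ 2 * z B ^ 2 := by
    rw [hzw.1, hzw.2, hcB]
    rw [hba] at hen
    refine le_of_eq_of_le ?_ hen
    congr 2
    field_simp
    norm_num
  -- the energy after time `B`
  have htB : t ∈ Icc B T₀ := ⟨by linarith [ht.1], ht.2⟩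
  have hcI : ∀ r ∈ Icc B T₀, speedFun c'.1 r ∈ Icc μ₁ μ₂ := fun r hr =>
    c'.speedFun_mem_Icc hT₀ ⟨hB.le.trans hr.1, hr.2⟩
  have hEt := hz.energy_ge (B := B) (Q := Q) (c₁ := D1 c'.1) (sq_nonneg x) hB.le
    (fun r hr => (c'.hasDerivWithinAt_speedFun ⟨hB.trans_le hr.1, hr.2⟩).mono
      fun y hy => ⟨hB.trans_le hy.1, hy.2⟩) (by rw [hcB]; positivity) hQ0.le
    (fun r hr => by
      have hr0 : 0 < r := hB.trans_le hr.1
      have h1 : |D1 c'.1 r| ≤ Q * μ₁ := by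
        rw [e1 r hr, hQ, div_mul_cancel₀ _ hμ₁.ne']
        rcases lt_or_ge r τ with h | h
        · rw [(c.D1_D2_eq_zero_of_const hτT hc ⟨hr0, h⟩).1, abs_zero]
          exact div_nonneg (hω_pos τ hτm).le hτ.le
        · refine (c.2.2.2.1 r ⟨hr0, hr.2⟩).trans ?_
          exact div_le_div₀ (hω_pos τ hτm).le (hω_anti hτm ⟨hr0, hr.2⟩ h) hτ h
      exact h1.trans (mul_le_mul_of_nonneg_left (hcI r hr).1 hQ0.le)) htB
  have hEle : z₁ t ^ 2 + speedFun c'.1 t * x ^ 2 * z t ^ 2 ≤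
      max 1 μ₂ * (z₁ t ^ 2 + x ^ 2 * z t ^ 2) := by
    have h1 : speedFun c'.1 t ≤ max 1 μ₂ := (hcI t htB).2.trans (le_max_right _ _)
    have h2 : 0 ≤ x ^ 2 * z t ^ 2 := by positivity
    have h3 := mul_le_mul_of_nonneg_right h1 h2
    have h4 := mul_le_mul_of_nonneg_right (le_max_left 1 μ₂) (sq_nonneg (z₁ t))
    linarith
  have hgrow : x ^ (N + 1) ≤ Real.exp (κ * W * L) := by
    rw [← Real.log_le_iff_le_exp (by positivity), Real.log_pow]
    rw [div_mul_eq_mul_div, div_le_iff₀ hκ0] at hKL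
    push_cast
    linarith
  have hm : 0 < max 1 μ₂ := by positivity
  have hchain : x ^ (N + 1) * Real.exp (-(12 * κ / s + Q * T₀)) ≤
      max 1 μ₂ * (z₁ t ^ 2 + x ^ 2 * z t ^ 2) := by
    refine le_trans ?_ (hEt.trans hEle)
    calc _ ≤ Real.exp (κ * W * L) * Real.exp (-(12 * κ / s + Q * T₀)) := by gcongr
      _ = Real.exp (κ * W * L - 12 * κ / s) * Real.exp (-(Q * T₀)) := by
        rw [← Real.exp_add, ← Real.exp_add]
        congr 1
        ring
      _ ≤ _ := mul_le_mul_of_nonneg_right hEB (Real.exp_pos _).le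
  have hfin : max 1 μ₂ * x ^ N < x ^ (N + 1) * Real.exp (-(12 * κ / s + Q * T₀)) := by
    rw [Real.exp_neg, ← div_eq_mul_inv, lt_div_iff₀ (Real.exp_pos _), pow_succ']
    calc _ = D * x ^ N := by rw [hD]; ring
      _ < x * x ^ N := mul_lt_mul_of_pos_right hxD (by positivity)
  exact lt_of_mul_lt_mul_left (hfin.trans_le hchain) hm.le

/-- The speeds for which some mode of eigenvalue at least `2 ^ k` has a large energy at all times
`t ≥ T₀ / (k + 1)`. -/
def activators (T₀ μ₁ μ₂ : ℝ) (ω ψ : ℝ → ℝ) (l : ℕ → ℝ) (k : ℕ) : Set (PS2 T₀ μ₁ μ₂ ω ψ) :=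
  {c | ∃ n, (2 : ℝ) ^ k ≤ l n ∧ ∃ w w₁, IsModeSolution T₀ (l n) (speedFun c.1) w w₁ ∧
    ∀ t ∈ Icc (T₀ / (k + 1)) T₀, l n ^ (4 * k) < w₁ t ^ 2 + l n * w t ^ 2}

theorem isOpen_activators (hT₀ : 0 < T₀) (hω_pos : ∀ t ∈ Ioc 0 T₀, 0 < ω t) (l : ℕ → ℝ) (k : ℕ) :
    letI : MetricSpace (PS2 T₀ μ₁ μ₂ ω ψ) := PS2.metricSpace hT₀ hω_pos
    IsOpen (activators T₀ μ₁ μ₂ ω ψ l k) := by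
  let _ : MetricSpace (PS2 T₀ μ₁ μ₂ ω ψ) := PS2.metricSpace hT₀ hω_pos
  rw [Metric.isOpen_iff]
  rintro c ⟨n, hn, w, w₁, hw, hE⟩
  obtain ⟨ε, hε, h⟩ := hw.energy_stable hT₀.le (by positivity) (continuousOn_speedFun c.1) hE
  refine ⟨ε, hε, fun c' hc' => ⟨n, hn, h _ (continuousOn_speedFun c'.1) fun t ht => ?_⟩⟩
  refine (PS2.abs_speedFun_sub_le hT₀ hω_pos c c' ht).trans ?_
  have : dist c c' < ε := by rwa [dist_comm]
  exact this.le

theorem dense_activators (hT₀ : 0 < T₀) (hμ₁ : 0 < μ₁) (hμ₂ : μ₁ < μ₂)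
    (hω_pos : ∀ t ∈ Ioc 0 T₀, 0 < ω t) (hψ_pos : ∀ t ∈ Ioc 0 T₀, 0 < ψ t)
    (hω_anti : AntitoneOn ω (Ioc 0 T₀)) (hψ_anti : AntitoneOn ψ (Ioc 0 T₀))
    (hω_lim : Tendsto ω (𝓝[>] 0) atTop)
    (hωψ_lim : Tendsto (fun t => ω t * ψ t / |Real.log t|) (𝓝[>] 0) atTop)
    {l : ℕ → ℝ} (hl : ¬ BddAbove (range l)) (k : ℕ) :
    letI : MetricSpace (PS2 T₀ μ₁ μ₂ ω ψ) := PS2.metricSpace hT₀ hω_pos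
    Dense (activators T₀ μ₁ μ₂ ω ψ l k) := by
  let _ : MetricSpace (PS2 T₀ μ₁ μ₂ ω ψ) := PS2.metricSpace hT₀ hω_pos
  rw [Metric.dense_iff]
  intro c₀ ε hε
  obtain ⟨c₁, hc₁, τ, γ, hτ, hτT, hγ₁, hγ₂, hconst⟩ :=
    exists_constant_near_zero hT₀ hμ₂ hω_pos hψ_pos hω_lim c₀ (half_pos hε)
  -- The frequency is `x = √l`, so the energy level `l ^ (4 * k)` is the power `2 * (4 * k)` of `x`.
  obtain ⟨Λ, hΛ⟩ := exists_resonant_speed hT₀ hμ₁ hω_pos hψ_pos hω_anti hψ_anti hω_lim hωψ_lim c₁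
    hτ hτT hγ₁ hγ₂ hconst (half_pos hε) (σ := T₀ / (k + 1)) (by positivity) (2 * (4 * k))
  obtain ⟨_, ⟨n, rfl⟩, hn⟩ := not_bddAbove_iff.1 hl (max (2 ^ k) (Λ ^ 2))
  have hn0 : 0 ≤ l n := (by positivity : (0 : ℝ) ≤ max (2 ^ k) (Λ ^ 2)).trans hn.le
  have hsq : √(l n) ^ 2 = l n := Real.sq_sqrt hn0
  obtain ⟨c, hc, w, w₁, hw, hE⟩ := hΛ √(l n)
    (Real.le_sqrt_of_sq_le ((le_max_right _ _).trans hn.le))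
  rw [pow_mul, hsq] at hE
  rw [hsq] at hw
  refine ⟨c, ?_, n, (le_max_left _ _).trans hn.le, w, w₁, hw, hE⟩
  rw [Metric.mem_ball]
  have h1 : dist c c₁ < ε / 2 := hc
  have h2 : dist c₁ c₀ < ε / 2 := hc₁
  linarith [dist_triangle c c₁ c₀]

theorem infiniteDerivativeLoss_of_mem_activators {H : Type*} [NormedAddCommGroup H]
    [InnerProductSpace ℝ H] [CompleteSpace H] {A : H →ₗ.[ℝ] H} (hA : IsSelfAdjoint A)
    {e : ℕ → H} {l : ℕ → ℝ} (he : Orthonormal ℝ e) (heig : ∀ n, IsEigenpair A (e n) (l n))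
    (hT₀ : 0 < T₀) {c : PS2 T₀ μ₁ μ₂ ω ψ} (hc : ∀ k, c ∈ activators T₀ μ₁ μ₂ ω ψ l k) :
    InfiniteDerivativeLoss A T₀ (speedFun c.1) := by
  choose n hn w w₁ hw hE using hc
  have hlim : Tendsto (fun k => l (n k)) atTop atTop :=
    tendsto_atTop_mono hn (tendsto_pow_atTop_atTop_of_one_lt one_lt_two)
  -- Different `k` may select the same eigenvector. Strictly increasing eigenvalues along a
  -- subsequence ensure that the selected vectors are distinct, hence orthonormal; as `φ i ≥ i`, the
  -- bounds at level `φ i` imply those at level `i`.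
  obtain ⟨φ, hφ, hlφ⟩ := strictMono_subseq_of_tendsto_atTop hlim
  have hinj : Function.Injective fun i => n (φ i) := fun i j hij => by
    refine hlφ.injective ?_
    simp only [Function.comp]
    exact congrArg l hij
  have h2 : ∀ i, (2 : ℝ) ^ i ≤ l (n (φ i)) := fun i =>
    (pow_le_pow_right₀ one_le_two (hφ.id_le i)).trans (hn (φ i))
  refine infiniteDerivativeLoss_of_modes hA (he.comp _ hinj) (l := fun i => l (n (φ i)))
    (fun i => heig _) h2 hT₀ (fun i => hw (φ i)) fun i t ht => ?_
  have h1 : 1 ≤ l (n (φ i)) := (one_le_pow₀ one_le_two).trans (h2 i)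
  have hi : i ≤ φ i := hφ.id_le i
  have hir : (i : ℝ) ≤ φ i := by exact_mod_cast hi
  refine (pow_le_pow_right₀ h1 (by omega)).trans_lt (hE (φ i) t ⟨le_trans ?_ ht.1, ht.2⟩)
  gcongr

end Main

end DerivLoss

end

theorem theorem2p10 {H : Type*} [NormedAddCommGroup H] [InnerProductSpace ℝ H] [CompleteSpace H]
    (A : H →ₗ.[ℝ] H) (hA : IsSelfAdjoint A) (hA_nonneg : ∀ x : A.domain, 0 ≤ inner ℝ (A x) (x : H))
    (hA_mult : DerivLoss.IsUnboundedPosMult A)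
    (T₀ μ₁ μ₂ : ℝ) (hT₀ : 0 < T₀) (hμ₁ : 0 < μ₁) (hμ₂ : μ₁ < μ₂)
    (ω ψ : ℝ → ℝ)
    (hω_pos : ∀ t ∈ Set.Ioc 0 T₀, 0 < ω t) (hψ_pos : ∀ t ∈ Set.Ioc 0 T₀, 0 < ψ t)
    (hω_anti : AntitoneOn ω (Set.Ioc 0 T₀)) (hψ_anti : AntitoneOn ψ (Set.Ioc 0 T₀))
    (hω_lim : Filter.Tendsto ω (nhdsWithin 0 (Set.Ioi 0)) Filter.atTop)
    (hωψ_lim : Filter.Tendsto (fun t => ω t * ψ t / |Real.log t|)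
      (nhdsWithin 0 (Set.Ioi 0)) Filter.atTop) :
    letI : MetricSpace (DerivLoss.PS2 T₀ μ₁ μ₂ ω ψ) := DerivLoss.PS2.metricSpace hT₀ hω_pos
    CompleteSpace (DerivLoss.PS2 T₀ μ₁ μ₂ ω ψ) ∧
      {c : DerivLoss.PS2 T₀ μ₁ μ₂ ω ψ |
        DerivLoss.InfiniteDerivativeLoss A T₀ (DerivLoss.speedFun c.1)} ∈
          residual (DerivLoss.PS2 T₀ μ₁ μ₂ ω ψ) := by
  let _ : MetricSpace (DerivLoss.PS2 T₀ μ₁ μ₂ ω ψ) := DerivLoss.PS2.metricSpace hT₀ hω_pos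
  obtain ⟨e, l, he, -, hl, heig⟩ := hA_mult
  refine ⟨DerivLoss.PS2.completeSpace hT₀ hω_pos hω_anti hψ_anti, ?_⟩
  have hres : ⋂ k, DerivLoss.activators T₀ μ₁ μ₂ ω ψ l k ∈
      residual (DerivLoss.PS2 T₀ μ₁ μ₂ ω ψ) :=
    countable_iInter_mem.2 fun k => residual_of_dense_open
      (DerivLoss.isOpen_activators hT₀ hω_pos l k)
      (DerivLoss.dense_activators hT₀ hμ₁ hμ₂ hω_pos hψ_pos hω_anti hψ_anti hω_lim hωψ_lim hl k)
  filter_upwards [hres] with c hc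
  exact DerivLoss.infiniteDerivativeLoss_of_mem_activators hA he heig hT₀ (mem_iInter.1 hc)
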